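/- **Setting.** Elements of $\mathbb C\otimes\mathbb H$ are written $u=q_1+iq_2$ with $q_1,q_2\in\mathbb H$ ($i$ the imaginary unit of $\mathbb C$, commuting with $\mathbb H$); $\langle q_1+iq_2,w_1+iw_2\rangle:=\overline{q_1}w_1+\overline{q_2}w_2\in\mathbb H$ and $|u|^2=\langle u,u\rangle$. Let $e_1,e_2,e_3$ be the imaginary units of $\mathbb H$, $m\ge 1$ an integer, and let $H^m_0=H^m_0(\Omega,\mathbb C\otimes\mathbb H)$ be the closure of $C_0^\infty(\Omega,\mathbb C\otimes\mathbb H)$ in the Sobolev space $H^m(\Omega,\mathbb C\otimes\mathbb H)$; $\|\cdot\|$ is the norm of $L^2=L^2(\Omega,\mathbb C\otimes\mathbb H)$. An open set $\Omega\subset\mathbb R^3$ has *property (R) with respect to* $P\in\mathbb R^3\setminus\overline\Omega$ if, for every unit vector $\omega$ such that the ray $\{P+r\omega: r\ge 0\}$ meets $\Omega$, one has $P+r\omega\in\Omega$ for all $r>r(\omega):=\inf\{r\ge 0: P+r\omega\in\Omega\}$; it has *property (R)* if this holds for some such $P$. A *bounded weight function for $\Omega$ with rate of exponential decay $\lambda>0$*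 is a bounded $\phi\in C^1(\overline\Omega)$, positive on $\Omega$, such that either (hill) $\Omega$ has property (R) with respect to some $P$ and $\frac{d}{dr}\left[r^2\phi(P+r\omega)\right]\le-\lambda r^2\phi(P+r\omega)$ whenever $|\omega|=1$, $r>0$, $P+r\omega\in\Omega$; or (ridge) there are a unit vector $v$ and a point $Q$ such that $\langle x-Q,v\rangle>0$, $x+tv\in\Omega$ and $\partial_v\phi(x)\le-\lambda\phi(x)$ for all $x\in\Omega$ and $t\ge 0$. For real functions $a_1,a_2,a_3$ put $T:=i^{m-1}\sum_{l=1}^3a_l e_l\partial_{x_l}^m$, and for $s\in\mathbb H$, $\sigma\in\{1,-1\}$ and $u,v\in H^m_0$ put $$\begin{aligned} b_s(u,v):={}&\sum_{l=1}^3\int_\Omega\langle a_l^2\partial_{x_l}^mu,\partial_{x_l}^mv\rangle\,dx+|s|^2\int_\Omega\langle u,v\rangle\,dx+\sum_{l=1}^3\sum_{\substack{t_1+t_2=m\\ t_2\le m-1}}\binom m{t_1}\int_\Omega\langle\partial_{x_l}^{t_1}(a_l^2)\,\partial_{x_l}^mu,\partial_{x_l}^{t_2}v\rangle\,dx\\ &+\sum_{l=1}^3\sum_{k=1}^m(-1)^k\sum_{t_1+t_2+t_3=m-k}\binom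 mk\binom{m-k}{t_1,t_2,t_3}\int_\Omega\langle\partial_{x_l}^{t_1}a_l\,\partial_{x_l}^{t_2+k}a_l\,\partial_{x_l}^mu,\partial_{x_l}^{t_3}v\rangle\,dx\\ &+\sigma\sum_{l<j}\sum_{k=1}^m(-1)^k\sum_{t_1+t_2+t_3=m-k}\binom mk\binom{m-k}{t_1,t_2,t_3}\Big(\int_\Omega\langle e_le_j\,\partial_{x_l}^{t_1}a_l\,\partial_{x_l}^{t_2+k}a_j\,\partial_{x_j}^mu,\partial_{x_l}^{t_3}v\rangle\,dx\\ &\qquad\qquad-\int_\Omega\langle e_le_j\,\partial_{x_j}^{t_1}a_j\,\partial_{x_j}^{t_2+k}a_l\,\partial_{x_l}^mu,\partial_{x_j}^{t_3}v\rangle\,dx\Big)-2\,\mathrm{Re}(s)\int_\Omega\langle Tu,v\rangle\,dx .\end{aligned}$$ With $\sigma=-1$ this is the form obtained from $\langle (T^2-2\mathrm{Re}(s)T+|s|^2)u,v\rangle_{L^2}$ by integration by parts. **Theorem.** For every integer $m\ge1$ there is a constant $K(m)>0$ with the following property. Let $\Omega\subset\mathbb R^3$ be an unbounded domain with $C^1$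 boundary and property (R), let $\phi$ be a bounded weight function for $\Omega$ with rate of exponential decay $\lambda>0$, and let $C>0$. Then there is a constant $K(m,\phi,\lambda)>0$, depending also on $C$ and on the domain $\Omega$ of $\phi$, such that the following holds for all $a_1,a_2,a_3\in C^m(\overline\Omega,\mathbb R)\cap L^\infty(\Omega)$ with $|\partial_{x_l}^ta_j(x)|^2\le C\phi(x)$ for all $x\in\Omega$, $t=1,\dots,m$ and $j,l=1,2,3$. Put $$M:=K(m)\max_{\substack{l=1,2,3\\ t=1,\dots,m}}\ \sup_{x\in\Omega}|\partial_{x_l}^ta_l(x)|^2+K(m,\phi,\lambda),\qquad C_T:=\min_{l=1,2,3}\ \inf_{x\in\Omega}a_l^2(x),$$ and suppose that $C_T>0$ and $\frac12C_T-M>0$. Then for every $s\in\mathbb H\setminus\{0\}$ with $\mathrm{Re}(s)=0$ and for each of the two signs $\sigma=\pm1$: (I) for every $F\in L^2(\Omega,\mathbb C\otimes\mathbb H)$ there is a unique $u\in H^m_0$ with $b_s(u,v)=\langle F,v\rangle_{L^2}$ for all $v\in H^m_0$; moreover every $u\in H^m_0$, in particular this solution, satisfies $$\|u\|^2\le\frac1{|s|^2}\,\mathrm{Re}\,b_s(u,u);$$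 (II) for every $u\in H^m_0$ one has $Tu\in L^2$ and $$C_1\|Tu\|^2\le\mathrm{Re}\,b_s(u,u),\qquad\text{where } C_1:=\frac{C_T-2M}{2C_T}>0 .$$ -/

import Mathlib

open MeasureTheory Set
open scoped Quaternion

noncomputable section

namespace QuatOp

/-- Three-dimensional Euclidean space. -/
abbrev E3 : Type := EuclideanSpace ℝ (Fin 3)

/-! ### The space `ℂ ⊗ ℍ` -/

/-- `ℂ ⊗ ℍ`: the element `q₁ + i q₂` is the pair `(q₁, q₂)`, with `|u|² = |q₁|² + |q₂|²`. -/
abbrev CH : Type := WithLp 2 (ℍ[ℝ] × ℍ[ℝ])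

/-- The `ℍ`-valued scalar product `⟨q₁ + i q₂, w₁ + i w₂⟩ = q̄₁ w₁ + q̄₂ w₂`. -/
def hInner (u v : CH) : ℍ[ℝ] := star u.fst * v.fst + star u.snd * v.snd

/-- Multiplication by the imaginary unit `i` of `ℂ`: `i (q₁ + i q₂) = -q₂ + i q₁`. -/
def mulI (u : CH) : CH := WithLp.toLp 2 (-u.snd, u.fst)

/-- Left multiplication by a quaternion: `q (q₁ + i q₂) = q q₁ + i q q₂`. -/
def qmul (q : ℍ[ℝ]) (u : CH) : CH := WithLp.toLp 2 (q * u.fst, q * u.snd)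

/-- The imaginary units `e₁, e₂, e₃` of `ℍ`. -/
def unitE : Fin 3 → ℍ[ℝ] := ![⟨0, 1, 0, 0⟩, ⟨0, 0, 1, 0⟩, ⟨0, 0, 0, 1⟩]

/-! ### Classical derivatives -/

/-- The partial derivative `∂_{x_l} f`. -/
def pd {F : Type*} [NormedAddCommGroup F] [NormedSpace ℝ F] (l : Fin 3) (f : E3 → F) : E3 → F :=
  fun x => fderiv ℝ f x (EuclideanSpace.single l 1)

/-- The iterated partial derivative `∂_{x_l}^t f`. -/
def pdIter {F : Type*} [NormedAddCommGroup F] [NormedSpace ℝ F]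
    (l : Fin 3) (t : ℕ) (f : E3 → F) : E3 → F :=
  (pd l)^[t] f

/-- The derivative `∂^b f = ∂_{x_1}^{b_1} ∂_{x_2}^{b_2} ∂_{x_3}^{b_3} f`. -/
def multiPd {F : Type*} [NormedAddCommGroup F] [NormedSpace ℝ F]
    (b : Fin 3 → ℕ) (f : E3 → F) : E3 → F :=
  pdIter 0 (b 0) (pdIter 1 (b 1) (pdIter 2 (b 2) f))

/-- `f ∈ C^k(Ω̄)`: `f` is of class `C^k` on the open set `Ω` and all its partial derivatives of
order at most `k` extend continuously to the closure of `Ω`. -/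
def ContDiffClosure (k : ℕ) (Ω : Set E3) (f : E3 → ℝ) : Prop :=
  ContDiffOn ℝ k f Ω ∧
    ∀ b : Fin 3 → ℕ, ∑ i, b i ≤ k →
      ∃ g : E3 → ℝ, ContinuousOn g (closure Ω) ∧ EqOn (multiPd b f) g Ω

/-- `ψ ∈ C₀^∞(Ω, F)`. -/
def IsTestFun {F : Type*} [NormedAddCommGroup F] [NormedSpace ℝ F]
    (Ω : Set E3) (ψ : E3 → F) : Prop :=
  ContDiff ℝ (⊤ : ℕ∞) ψ ∧ HasCompactSupport ψ ∧ tsupport ψ ⊆ Ω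

/-! ### Domains and weights -/

/-- The boundary of the open set `Ω` is of class `C¹`: near each boundary point, `Ω` is the
sublevel set of a `C¹` function with non-vanishing differential at that point. -/
def HasC1Boundary (Ω : Set E3) : Prop :=
  ∀ p ∈ frontier Ω, ∃ r > 0, ∃ g : E3 → ℝ, ContDiffOn ℝ 1 g (Metric.ball p r) ∧
    fderiv ℝ g p ≠ 0 ∧ ∀ y ∈ Metric.ball p r, y ∈ Ω ↔ g y < 0

/-- `Ω` has property `(R)` with respect to the point `P ∉ Ω̄`: if a ray from `P` in a unit
direction `ω` meets `Ω` and `r(ω)` is the infimum of the `r ≥ 0` with `P + r ω ∈ Ω`, then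
`P + r ω ∈ Ω` for all `r > r(ω)`. -/
def PropertyRAt (Ω : Set E3) (P : E3) : Prop :=
  P ∉ closure Ω ∧
    ∀ ω : E3, ‖ω‖ = 1 → (∃ r : ℝ, 0 ≤ r ∧ P + r • ω ∈ Ω) →
      ∀ r : ℝ, sInf {r : ℝ | 0 ≤ r ∧ P + r • ω ∈ Ω} < r → P + r • ω ∈ Ω

/-- Property `(R)`. -/
def PropertyR (Ω : Set E3) : Prop := ∃ P : E3, PropertyRAt Ω P

/-- `φ` decays radially at rate `lam` along the rays from `P`:
`d/dr [r² φ(P + r ω)] ≤ - lam r² φ(P + r ω)` on `Ω`. -/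
def RadialDecay (Ω : Set E3) (P : E3) (φ : E3 → ℝ) (lam : ℝ) : Prop :=
  ∀ ω : E3, ‖ω‖ = 1 → ∀ r : ℝ, 0 < r → P + r • ω ∈ Ω →
    deriv (fun ρ : ℝ => ρ ^ 2 * φ (P + ρ • ω)) r ≤ -lam * (r ^ 2 * φ (P + r • ω))

/-- `Ω` is contained in the half-space `⟨x - Q, v⟩ > 0`, `|v| = 1`, every half-line in the
direction `v` that starts in `Ω` stays in `Ω`, and `∂_v φ ≤ - lam φ` on `Ω`. -/
def RidgeDecay (Ω : Set E3) (φ : E3 → ℝ) (lam : ℝ) : Prop :=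
  ∃ Q v : E3, ‖v‖ = 1 ∧ (∀ x ∈ Ω, 0 < inner ℝ (x - Q) v) ∧
    (∀ x ∈ Ω, ∀ t : ℝ, 0 ≤ t → x + t • v ∈ Ω) ∧
    ∀ x ∈ Ω, fderiv ℝ φ x v ≤ -lam * φ x

/-- `φ` is a bounded weight function for `Ω` with rate of exponential decay `lam`: either it is an
exponentially decaying hill around a point with respect to which `Ω` has property `(R)`, or `Ω`
lies in a half-space and `φ` is an exponentially decaying ridge. -/
def IsBoundedWeight (Ω : Set E3) (φ : E3 → ℝ) (lam : ℝ) : Prop :=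
  0 < lam ∧ ContDiffClosure 1 Ω φ ∧ (∀ x ∈ Ω, 0 < φ x) ∧ (∃ B : ℝ, ∀ x ∈ Ω, φ x ≤ B) ∧
    ((∃ P : E3, PropertyRAt Ω P ∧ RadialDecay Ω P φ lam) ∨ RidgeDecay Ω φ lam)

/-! ### Sobolev spaces -/

/-- `L²(Ω, ℂ ⊗ ℍ)`. -/
abbrev L2 (Ω : Set E3) : Type := Lp CH 2 (volume.restrict Ω)

/-- `w` is the weak derivative `∂^b u` in `Ω`. -/
def IsWeakDeriv (Ω : Set E3) (b : Fin 3 → ℕ) (u w : L2 Ω) : Prop :=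
  ∀ ψ : E3 → ℝ, IsTestFun Ω ψ →
    (∫ x in Ω, multiPd b ψ x • u x) = (-1 : ℝ) ^ (∑ i, b i) • (∫ x in Ω, ψ x • w x)

open Classical in
/-- The weak derivative `∂^b u` of `u ∈ L²(Ω, ℂ ⊗ ℍ)` (zero if there is none in `L²`). -/
def weakDeriv (Ω : Set E3) (b : Fin 3 → ℕ) (u : L2 Ω) : L2 Ω :=
  if h : ∃ w : L2 Ω, IsWeakDeriv Ω b u w then h.choose else 0

/-- The weak derivative `∂_{x_l}^t u`. -/
def wd (Ω : Set E3) (l : Fin 3) (t : ℕ) (u : L2 Ω) : L2 Ω := weakDeriv Ω (Pi.single l t) u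

/-- `u ∈ H^m(Ω, ℂ ⊗ ℍ)`. -/
def MemH (m : ℕ) (Ω : Set E3) (u : L2 Ω) : Prop :=
  ∀ b : Fin 3 → ℕ, ∑ i, b i ≤ m → ∃ w : L2 Ω, IsWeakDeriv Ω b u w

/-- The norm of `H^m(Ω, ℂ ⊗ ℍ)`. -/
def hNorm (m : ℕ) (Ω : Set E3) (u : L2 Ω) : ℝ :=
  Real.sqrt (∑ k ∈ Finset.range (m + 1), ∑ b ∈ Finset.piAntidiag (Finset.univ : Finset (Fin 3)) k,
    ‖weakDeriv Ω b u‖ ^ 2)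

/-- `u ∈ H^m_0(Ω, ℂ ⊗ ℍ)`, the closure of `C₀^∞(Ω, ℂ ⊗ ℍ)` in `H^m(Ω, ℂ ⊗ ℍ)`. -/
def MemH0 (m : ℕ) (Ω : Set E3) (u : L2 Ω) : Prop :=
  MemH m Ω u ∧ ∀ ε > 0, ∃ v : L2 Ω,
    (∃ ψ : E3 → CH, IsTestFun Ω ψ ∧ v =ᵐ[volume.restrict Ω] ψ) ∧ hNorm m Ω (u - v) < ε

/-! ### The operator and the sesquilinear form -/

/-- `T u = i^{m-1} (a₁ e₁ ∂_{x_1}^m u + a₂ e₂ ∂_{x_2}^m u + a₃ e₃ ∂_{x_3}^m u)`. -/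
def opT (m : ℕ) (Ω : Set E3) (a : Fin 3 → E3 → ℝ) (u : L2 Ω) : E3 → CH :=
  fun x => mulI^[m - 1] (∑ l, a l x • qmul (unitE l) (wd Ω l m u x))

/-- The form `b_s(u, v)`. The sign `σ` is the one in front of the part that contains the products
`e_l e_j` with `l < j`; for `σ = -1` this is `⟨Q_s(T) u, v⟩_{L²}` integrated by parts, with
`Q_s(T) = T² - 2 Re(s) T + |s|²`. -/
def bForm (σ : ℝ) (m : ℕ) (Ω : Set E3) (a : Fin 3 → E3 → ℝ) (s : ℍ[ℝ]) (u v : L2 Ω) : ℍ[ℝ] :=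
  (∑ l, (∫ x in Ω, hInner ((a l x) ^ 2 • wd Ω l m u x) (wd Ω l m v x)))
  + ‖s‖ ^ 2 • (∫ x in Ω, hInner (u x) (v x))
  + (∑ l, ∑ t ∈ (Finset.HasAntidiagonal.antidiagonal m).filter (fun t => t.2 ≤ m - 1),
      (m.choose t.1 : ℝ) •
        (∫ x in Ω,
          hInner (pdIter l t.1 (fun y => (a l y) ^ 2) x • wd Ω l m u x) (wd Ω l t.2 v x)))
  + (∑ l, ∑ k ∈ Finset.Icc 1 m,
      ∑ t ∈ Finset.piAntidiag (Finset.univ : Finset (Fin 3)) (m - k),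
        ((-1) ^ k * (m.choose k : ℝ) * (Nat.multinomial Finset.univ t : ℝ)) •
          (∫ x in Ω,
            hInner ((pdIter l (t 0) (a l) x * pdIter l (t 1 + k) (a l) x) • wd Ω l m u x)
              (wd Ω l (t 2) v x)))
  + σ • (∑ l, ∑ j ∈ Finset.Ioi l, ∑ k ∈ Finset.Icc 1 m,
      ∑ t ∈ Finset.piAntidiag (Finset.univ : Finset (Fin 3)) (m - k),
        ((-1) ^ k * (m.choose k : ℝ) * (Nat.multinomial Finset.univ t : ℝ)) •
          ((∫ x in Ω, hInner
              (qmul (unitE l * unitE j)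
                ((pdIter l (t 0) (a l) x * pdIter l (t 1 + k) (a j) x) • wd Ω j m u x))
              (wd Ω l (t 2) v x))
            - (∫ x in Ω, hInner
              (qmul (unitE l * unitE j)
                ((pdIter j (t 0) (a j) x * pdIter j (t 1 + k) (a l) x) • wd Ω l m u x))
              (wd Ω j (t 2) v x))))
  - (2 * s.re) • (∫ x in Ω, hInner (opT m Ω a u x) (v x))

/-- `u ∈ H^m_0` is a weak solution with datum `F`: `b_s(u, v) = ⟨F, v⟩_{L²}` for `v ∈ H^m_0`. -/
def IsWeakSolution (σ : ℝ) (m : ℕ) (Ω : Set E3) (a : Fin 3 → E3 → ℝ) (s : ℍ[ℝ])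
    (F u : L2 Ω) : Prop :=
  MemH0 m Ω u ∧ ∀ v : L2 Ω, MemH0 m Ω v →
    bForm σ m Ω a s u v = ∫ x in Ω, hInner (F x) (v x)

/-! ### The constants -/

/-- `C_T = min_l inf_{x ∈ Ω} a_l(x)²`. -/
def constCT (Ω : Set E3) (a : Fin 3 → E3 → ℝ) : ℝ := ⨅ l : Fin 3, ⨅ x : Ω, (a l x) ^ 2

/-- `M = K₁ max_{l, 1 ≤ t ≤ m} sup_{x ∈ Ω} |∂_{x_l}^t a_l(x)|² + K₂`. -/
def constM (K₁ K₂ : ℝ) (m : ℕ) (Ω : Set E3) (a : Fin 3 → E3 → ℝ) : ℝ :=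
  K₁ * (⨆ p : Fin 3 × Finset.Icc 1 m, ⨆ x : Ω, |pdIter p.1 (p.2 : ℕ) (a p.1) x| ^ 2) + K₂

end QuatOp

end

open QuatOp

open MeasureTheory Set
open scoped Quaternion

noncomputable section

namespace QuatOp

/-! Put `A = ∑ ‖a_l ∂_l^m u‖²` and `D = ∑ ‖∂_l^m u‖²`. For `Re s = 0` the term with `T` disappears,
and `Re b_s(u,u)` is `A + |s|²‖u‖²` plus terms in which a derivative falls on a coefficient. The
core of the proof bounds these terms by a constant times `E = √A √D + D`, where the constant depends
only on `m`, `C` and the weight. Since `A ≥ C_T D`, a large `C_T` makes `E` a small fraction of `A`,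
and the form dominates `½‖Tu‖² + D + |s|²‖u‖²` (`IsElliptic`). Lax-Milgram then gives (I), and (II)
follows from `C₁ ≤ ½`. Only absolute values of the error terms are used, so both signs `σ` are
treated alike.

Three difficulties arise in the bound by `E`.

Lower order derivatives of `u` are not controlled by `D` on an unbounded domain, but each comes with
a differentiated coefficient, hence with a factor `√φ`. Integrating the divergence of `φ ν |w|²`,
with `ν` the direction of the rays, gives a weighted Poincaré inequality (`DecayField.poincare`).
Iterating it bounds `∫ φ |∂^t u|²` by derivatives of order `m`, and the mixed ones among these by
`D` (`sqNorm_le_pureNorm`).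

The terms with `e_l e_j` contain `a_l ∂_j^m u`, which `A` does not control when `a_l` is much larger
than `a_j`. The whole sum is a commutator `g ∂_l^m(a_l u) - ∂_l^m(a_l g u)` (`commutator_sum`) with
`g = a_j - c_j` for any constant `c_j`, because `a_j` is always differentiated. In the second half
`∂_l^m` and `∂_j^m` are exchanged by parts (`integral_bilin_pdIter_swap`), which puts `∂_l^m u` next
to `a_l`.

This needs a bound for `a_j - c_j` that does not depend on `a_j` (`DecayField.oscillation`). Along a
ray the gradient of `a_j` decays like `e^{-λt/2}`, so the variation along the ray is bounded, and
since `Ω` is connected the values far out on any two rays approach each other. The same bound yields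
`‖Tu‖² = A + O(E)`: with constant coefficients the mixed terms of `‖Tu‖²` cancel because the units
anticommute. -/

section Derivatives

variable {F G : Type*} [NormedAddCommGroup F] [NormedSpace ℝ F]
  [NormedAddCommGroup G] [NormedSpace ℝ G]

/-! ### Partial derivatives -/

@[simp] lemma pdIter_zero (l : Fin 3) (f : E3 → F) : pdIter l 0 f = f := rfl

lemma pdIter_succ (l : Fin 3) (t : ℕ) (f : E3 → F) :
    pdIter l (t + 1) f = pd l (pdIter l t f) := Function.iterate_succ_apply' _ _ _

lemma pdIter_succ' (l : Fin 3) (t : ℕ) (f : E3 → F) :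
    pdIter l (t + 1) f = pdIter l t (pd l f) := Function.iterate_succ_apply _ _ _

lemma pdIter_add (l : Fin 3) (s t : ℕ) (f : E3 → F) :
    pdIter l (s + t) f = pdIter l s (pdIter l t f) := Function.iterate_add_apply _ _ _ _

lemma multiPd_single (l : Fin 3) (t : ℕ) (f : E3 → F) :
    multiPd (Pi.single l t) f = pdIter l t f := by
  fin_cases l <;> simp [multiPd]

@[simp] lemma multiPd_zero (f : E3 → F) : multiPd 0 f = f := rfl

lemma pd_eqOn {Ω : Set E3} (hΩ : IsOpen Ω) (l : Fin 3) {f g : E3 → F} (h : EqOn f g Ω) :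
    EqOn (pd l f) (pd l g) Ω := fun x hx => by
  have : f =ᶠ[nhds x] g := Filter.eventuallyEq_of_mem (hΩ.mem_nhds hx) h
  simp only [pd, this.fderiv_eq]

lemma pdIter_eqOn {Ω : Set E3} (hΩ : IsOpen Ω) (l : Fin 3) (t : ℕ) {f g : E3 → F}
    (h : EqOn f g Ω) : EqOn (pdIter l t f) (pdIter l t g) Ω := by
  induction t with
  | zero => exact h
  | succ t ih => rw [pdIter_succ, pdIter_succ]; exact pd_eqOn hΩ l ih

lemma contDiffOn_pd {Ω : Set E3} (hΩ : IsOpen Ω) (l : Fin 3) {n : ℕ} {f : E3 → F}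
    (hf : ContDiffOn ℝ (n + 1 : ℕ) f Ω) : ContDiffOn ℝ n (pd l f) Ω := by
  have := hf.fderiv_of_isOpen (m := n) hΩ (by norm_cast)
  exact this.clm_apply contDiffOn_const

lemma contDiffOn_pdIter {Ω : Set E3} (hΩ : IsOpen Ω) (l : Fin 3) {n t : ℕ} {f : E3 → F}
    (hf : ContDiffOn ℝ (n + t : ℕ) f Ω) : ContDiffOn ℝ n (pdIter l t f) Ω := by
  induction t generalizing n with
  | zero => exact hf
  | succ t ih =>
    rw [pdIter_succ]
    exact contDiffOn_pd hΩ l (ih (by rwa [add_right_comm]))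

lemma continuousOn_pdIter {Ω : Set E3} (hΩ : IsOpen Ω) (l : Fin 3) {m t : ℕ} (ht : t ≤ m)
    {f : E3 → F} (hf : ContDiffOn ℝ m f Ω) : ContinuousOn (pdIter l t f) Ω :=
  (contDiffOn_pdIter (n := 0) hΩ l (by simpa using hf.of_le (by exact_mod_cast ht))).continuousOn

lemma contDiff_pd (l : Fin 3) {f : E3 → F} (hf : ContDiff ℝ (⊤ : ℕ∞) f) :
    ContDiff ℝ (⊤ : ℕ∞) (pd l f) := by
  have := hf.fderiv_right (m := (⊤ : ℕ∞)) (by norm_cast)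
  exact this.clm_apply contDiff_const

lemma contDiff_pdIter (l : Fin 3) (t : ℕ) {f : E3 → F} (hf : ContDiff ℝ (⊤ : ℕ∞) f) :
    ContDiff ℝ (⊤ : ℕ∞) (pdIter l t f) := by
  induction t with
  | zero => exact hf
  | succ t ih => rw [pdIter_succ]; exact contDiff_pd l ih

lemma contDiff_multiPd (b : Fin 3 → ℕ) {f : E3 → F} (hf : ContDiff ℝ (⊤ : ℕ∞) f) :
    ContDiff ℝ (⊤ : ℕ∞) (multiPd b f) :=
  contDiff_pdIter _ _ (contDiff_pdIter _ _ (contDiff_pdIter _ _ hf))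

lemma contDiff_nat_of_top {n : ℕ} {f : E3 → F} (hf : ContDiff ℝ (⊤ : ℕ∞) f) :
    ContDiff ℝ n f := hf.of_le (by exact_mod_cast le_top)

lemma tsupport_pd_subset (l : Fin 3) (f : E3 → F) : tsupport (pd l f) ⊆ tsupport f :=
  tsupport_fderiv_apply_subset ℝ _

lemma tsupport_pdIter_subset (l : Fin 3) (t : ℕ) (f : E3 → F) :
    tsupport (pdIter l t f) ⊆ tsupport f := by
  induction t with
  | zero => exact subset_rfl
  | succ t ih => rw [pdIter_succ]; exact (tsupport_pd_subset l _).trans ih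

lemma tsupport_multiPd_subset (b : Fin 3 → ℕ) (f : E3 → F) :
    tsupport (multiPd b f) ⊆ tsupport f :=
  (tsupport_pdIter_subset _ _ _).trans
    ((tsupport_pdIter_subset _ _ _).trans (tsupport_pdIter_subset _ _ _))

lemma pd_comm (i j : Fin 3) {f : E3 → F} (hf : ContDiff ℝ (⊤ : ℕ∞) f) :
    pd i (pd j f) = pd j (pd i f) := by
  have hd : Differentiable ℝ (fderiv ℝ f) :=
    (hf.fderiv_right (m := (⊤ : ℕ∞)) (by norm_cast)).differentiable (by simp)
  have key : ∀ (i j : Fin 3) (x : E3), pd i (pd j f) x =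
      fderiv ℝ (fderiv ℝ f) x (EuclideanSpace.single i 1) (EuclideanSpace.single j 1) := by
    intro i j x
    unfold pd
    rw [fderiv_clm_apply (hd x) (by fun_prop)]
    simp
  ext x
  rw [key, key]
  have h2 : ((2 : ℕ∞) : WithTop ℕ∞) ≤ ((⊤ : ℕ∞) : WithTop ℕ∞) := WithTop.coe_le_coe.2 le_top
  have := (hf.contDiffAt (x := x)).isSymmSndFDerivAt (by simpa using h2)
  exact this _ _

lemma pdIter_pd_comm (i j : Fin 3) (t : ℕ) {f : E3 → F} (hf : ContDiff ℝ (⊤ : ℕ∞) f) :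
    pdIter i t (pd j f) = pd j (pdIter i t f) := by
  induction t with
  | zero => rfl
  | succ t ih => rw [pdIter_succ, ih, pd_comm i j (contDiff_pdIter i t hf), pdIter_succ]

lemma pdIter_comm (i j : Fin 3) (s t : ℕ) {f : E3 → F} (hf : ContDiff ℝ (⊤ : ℕ∞) f) :
    pdIter i s (pdIter j t f) = pdIter j t (pdIter i s f) := by
  induction t with
  | zero => rfl
  | succ t ih => rw [pdIter_succ, pdIter_pd_comm i j s (contDiff_pdIter j t hf), ih, pdIter_succ]

lemma multiPd_pd_comm (b : Fin 3 → ℕ) (i : Fin 3) {f : E3 → F} (hf : ContDiff ℝ (⊤ : ℕ∞) f) :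
    multiPd b (pd i f) = pd i (multiPd b f) := by
  unfold multiPd
  rw [pdIter_pd_comm _ _ _ hf, pdIter_pd_comm _ _ _ (contDiff_pdIter _ _ hf),
    pdIter_pd_comm _ _ _ (contDiff_pdIter _ _ (contDiff_pdIter _ _ hf))]

lemma pd_multiPd (b : Fin 3 → ℕ) (i : Fin 3) {f : E3 → F} (hf : ContDiff ℝ (⊤ : ℕ∞) f) :
    pd i (multiPd b f) = multiPd (b + Pi.single i 1) f := by
  rw [← multiPd_pd_comm b i hf]
  fin_cases i
  · simp only [multiPd, Fin.zero_eta, Pi.add_apply, Pi.single_apply]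
    simp only [↓reduceIte, one_ne_zero, add_zero, Fin.reduceEq]
    rw [pdIter_pd_comm _ _ _ hf, pdIter_pd_comm _ _ _ (contDiff_pdIter _ _ hf), pdIter_succ']
  · simp only [multiPd, Fin.mk_one, Pi.add_apply, Pi.single_apply]
    simp only [↓reduceIte, zero_ne_one, add_zero, Fin.reduceEq]
    rw [pdIter_pd_comm _ _ _ hf, pdIter_succ']
  · simp only [multiPd, Fin.reduceFinMk, Pi.add_apply, Pi.single_apply]
    simp only [↓reduceIte, add_zero, Fin.reduceEq]
    rw [pdIter_succ']

lemma IsTestFun.multiPd {Ω : Set E3} {f : E3 → F} (hf : IsTestFun Ω f) (b : Fin 3 → ℕ) :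
    IsTestFun Ω (multiPd b f) :=
  ⟨contDiff_multiPd b hf.1, hf.2.1.mono' ((subset_tsupport _).trans (tsupport_multiPd_subset b f)),
    (tsupport_multiPd_subset b f).trans hf.2.2⟩

lemma IsTestFun.pd {Ω : Set E3} {f : E3 → F} (hf : IsTestFun Ω f) (l : Fin 3) :
    IsTestFun Ω (pd l f) :=
  ⟨contDiff_pd l hf.1, hf.2.1.mono' ((subset_tsupport _).trans (tsupport_pd_subset l f)),
    (tsupport_pd_subset l f).trans hf.2.2⟩

lemma IsTestFun.pdIter {Ω : Set E3} {f : E3 → F} (hf : IsTestFun Ω f) (l : Fin 3) (t : ℕ) :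
    IsTestFun Ω (pdIter l t f) := by
  rw [← multiPd_single]; exact hf.multiPd _

lemma IsTestFun.memLp {Ω : Set E3} {f : E3 → F} (hf : IsTestFun Ω f) (p : ENNReal)
    (μ : Measure E3) [IsFiniteMeasureOnCompacts μ] : MemLp f p μ :=
  hf.1.continuous.memLp_of_hasCompactSupport hf.2.1

lemma pdIter_clm_comp (L : F →L[ℝ] G) (l : Fin 3) (t : ℕ) {f : E3 → F}
    (hf : ContDiff ℝ (⊤ : ℕ∞) f) :
    pdIter l t (fun x => L (f x)) = fun x => L (pdIter l t f x) := by
  induction t with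
  | zero => rfl
  | succ t ih =>
    rw [pdIter_succ, ih, pdIter_succ]
    ext x
    have hd : DifferentiableAt ℝ (QuatOp.pdIter l t f) x :=
      (contDiff_pdIter l t hf).differentiable (by simp) x
    have := (L.hasFDerivAt.comp x hd.hasFDerivAt).fderiv
    simp only [QuatOp.pd]
    erw [this]
    rfl

lemma multiPd_clm_comp (L : F →L[ℝ] G) (b : Fin 3 → ℕ) {f : E3 → F}
    (hf : ContDiff ℝ (⊤ : ℕ∞) f) :
    multiPd b (fun x => L (f x)) = fun x => L (multiPd b f x) := by
  unfold QuatOp.multiPd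
  rw [pdIter_clm_comp L _ _ hf, pdIter_clm_comp L _ _ (contDiff_pdIter _ _ hf),
    pdIter_clm_comp L _ _ (contDiff_pdIter _ _ (contDiff_pdIter _ _ hf))]

lemma multiPd_add (b : Fin 3 → ℕ) {f g : E3 → F}
    (hf : ContDiff ℝ (⊤ : ℕ∞) f) (hg : ContDiff ℝ (⊤ : ℕ∞) g) :
    multiPd b (f + g) = multiPd b f + multiPd b g := by
  -- Additivity is a case of commuting with linear maps: apply `fst + snd`, `fst` and `snd` to the
  -- pair `(f, g)`.
  have h1 := multiPd_clm_comp (ContinuousLinearMap.fst ℝ F F + ContinuousLinearMap.snd ℝ F F) b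
    (hf.prodMk hg)
  have h2 := multiPd_clm_comp (ContinuousLinearMap.fst ℝ F F) b (hf.prodMk hg)
  have h3 := multiPd_clm_comp (ContinuousLinearMap.snd ℝ F F) b (hf.prodMk hg)
  have e1 : (f + g) = fun x => (ContinuousLinearMap.fst ℝ F F + ContinuousLinearMap.snd ℝ F F)
      ((f x, g x)) := by ext x; simp
  rw [e1, h1]
  ext x
  simpa using congrArg₂ (· + ·) (congrFun h2 x).symm (congrFun h3 x).symm

lemma IsTestFun.clm_comp {Ω : Set E3} {f : E3 → F} (hf : IsTestFun Ω f) (L : F →L[ℝ] G) :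
    IsTestFun Ω (fun x => L (f x)) := by
  have hs : Function.support (fun x => L (f x)) ⊆ Function.support f := by
    intro x hx hfx
    exact hx (by simp [hfx])
  exact ⟨L.contDiff.comp hf.1, hf.2.1.mono hs, (closure_mono hs).trans hf.2.2⟩

lemma IsTestFun.add {Ω : Set E3} {f g : E3 → F} (hf : IsTestFun Ω f) (hg : IsTestFun Ω g) :
    IsTestFun Ω (f + g) :=
  ⟨hf.1.add hg.1, hf.2.1.add hg.2.1,
    (tsupport_add f g).trans (union_subset hf.2.2 hg.2.2)⟩

end Derivatives

section Leibniz

open Finset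

variable {F : Type*} [NormedAddCommGroup F] [NormedSpace ℝ F]

/-! ### The Leibniz rule -/

lemma pd_smul (l : Fin 3) {f : E3 → ℝ} {g : E3 → F} {x : E3} (hf : DifferentiableAt ℝ f x)
    (hg : DifferentiableAt ℝ g x) :
    pd l (fun y => f y • g y) x = f x • pd l g x + pd l f x • g x := by
  simp only [pd]
  rw [fderiv_fun_smul hf hg]
  simp

lemma pd_sum {ι : Type*} (l : Fin 3) (s : Finset ι) {f : ι → E3 → F} {x : E3}
    (hf : ∀ i ∈ s, DifferentiableAt ℝ (f i) x) :
    pd l (fun y => ∑ i ∈ s, f i y) x = ∑ i ∈ s, pd l (f i) x := by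
  simp only [pd]
  rw [fderiv_fun_sum hf]
  simp

lemma pd_const_smul (l : Fin 3) (c : ℝ) {f : E3 → F} {x : E3} (hf : DifferentiableAt ℝ f x) :
    pd l (fun y => c • f y) x = c • pd l f x := by
  simp only [pd]
  rw [fderiv_fun_const_smul hf]
  simp

lemma differentiableAt_pdIter {Ω : Set E3} (hΩ : IsOpen Ω) (l : Fin 3) {m t : ℕ} (ht : t < m)
    {f : E3 → F} (hf : ContDiffOn ℝ m f Ω) {x : E3} (hx : x ∈ Ω) :
    DifferentiableAt ℝ (pdIter l t f) x := by
  have h : ContDiffOn ℝ (1 : ℕ) (pdIter l t f) Ω :=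
    contDiffOn_pdIter hΩ l (hf.of_le (by exact_mod_cast (by omega)))
  exact (h.contDiffAt (hΩ.mem_nhds hx)).differentiableAt (by simp)

/-- The Leibniz rule for iterated partial derivatives. -/
lemma pdIter_smul {Ω : Set E3} (hΩ : IsOpen Ω) (l : Fin 3) (n : ℕ) {f : E3 → ℝ} {g : E3 → F}
    (hf : ContDiffOn ℝ n f Ω) (hg : ContDiffOn ℝ n g Ω) {x : E3} (hx : x ∈ Ω) :
    pdIter l n (fun y => f y • g y) x =
      ∑ p ∈ antidiagonal n, n.choose p.1 • (pdIter l p.1 f x • pdIter l p.2 g x) := by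
  induction n generalizing x with
  | zero => simp
  | succ n ih =>
    have hle : ((n : ℕ) : WithTop ℕ∞) ≤ ((n + 1 : ℕ) : WithTop ℕ∞) := by
      exact_mod_cast Nat.le_succ n
    rw [pdIter_succ, pd_eqOn hΩ l (fun y hy => ih (hf.of_le hle) (hg.of_le hle) hy) hx,
      sum_antidiagonal_choose_succ_nsmul (fun i j => pdIter l i f x • pdIter l j g x) n]
    have hdf : ∀ p ∈ antidiagonal n, DifferentiableAt ℝ (pdIter l p.1 f) x := fun p hp =>
      differentiableAt_pdIter hΩ l (by rw [HasAntidiagonal.mem_antidiagonal] at hp; omega) hf hx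
    have hdg : ∀ p ∈ antidiagonal n, DifferentiableAt ℝ (pdIter l p.2 g) x := fun p hp =>
      differentiableAt_pdIter hΩ l (by rw [HasAntidiagonal.mem_antidiagonal] at hp; omega) hg hx
    rw [pd_sum l (antidiagonal n)
      (f := fun p y => n.choose p.1 • (pdIter l p.1 f y • pdIter l p.2 g y))
      (fun p hp => ((hdf p hp).fun_smul (hdg p hp)).fun_const_smul _), ← sum_add_distrib]
    refine sum_congr rfl fun p hp => ?_
    have h1 : (fun y => n.choose p.1 • (pdIter l p.1 f y • pdIter l p.2 g y)) =
        fun y => (n.choose p.1 : ℝ) • (pdIter l p.1 f y • pdIter l p.2 g y) := by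
      ext y; rw [Nat.cast_smul_eq_nsmul]
    rw [h1, pd_const_smul l _ ((hdf p hp).fun_smul (hdg p hp)), pd_smul l (hdf p hp) (hdg p hp),
      pdIter_succ, pdIter_succ, Nat.cast_smul_eq_nsmul, smul_add,
      n.choose_symm_of_eq_add (HasAntidiagonal.mem_antidiagonal.1 hp).symm]

/-- Moving all derivatives off a factor by alternating sums of derivatives of products. -/
lemma alternating_pdIter_smul {Ω : Set E3} (hΩ : IsOpen Ω) (l : Fin 3) (n : ℕ) {g : E3 → ℝ}
    {h : E3 → F} (hg : ContDiffOn ℝ n g Ω) (hh : ContDiffOn ℝ n h Ω) {x : E3} (hx : x ∈ Ω) :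
    ∑ p ∈ antidiagonal n, n.choose p.1 •
      ((-1 : ℝ) ^ p.1 • pdIter l p.2 (fun y => pdIter l p.1 g y • h y) x) =
      g x • pdIter l n h x := by
  induction n generalizing x g with
  | zero => simp
  | succ n ih =>
    have hle : ((n : ℕ) : WithTop ℕ∞) ≤ ((n + 1 : ℕ) : WithTop ℕ∞) := by
      exact_mod_cast Nat.le_succ n
    have hd : ∀ p ∈ antidiagonal n, DifferentiableAt ℝ
        (pdIter l p.2 (fun y => pdIter l p.1 g y • h y)) x := by
      intro p hp
      rw [HasAntidiagonal.mem_antidiagonal] at hp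
      have hm : ContDiffOn ℝ (n + 1 - p.1 : ℕ) (fun y => pdIter l p.1 g y • h y) Ω :=
        (contDiffOn_pdIter hΩ l (by rwa [Nat.sub_add_cancel (by omega)])).smul
          (hh.of_le (by exact_mod_cast (by omega)))
      exact differentiableAt_pdIter hΩ l (by omega) hm hx
    -- Pascal's rule splits the sum. The part with one more outer derivative is the derivative of
    -- the identity for `n`; the part with one more derivative on `g` is minus the identity for `pd
    -- l g`, which is why the induction runs over all `g`. The product rule leaves `g ∂^{n+1} h`.
    rw [sum_antidiagonal_choose_succ_nsmul
      (fun i j => (-1 : ℝ) ^ i • pdIter l j (fun y => pdIter l i g y • h y) x) n]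
    have h1 : ∑ p ∈ antidiagonal n, n.choose p.1 • ((-1 : ℝ) ^ p.1 •
        pdIter l (p.2 + 1) (fun y => pdIter l p.1 g y • h y) x) =
        pd l (fun y => g y • pdIter l n h y) x := by
      rw [← pd_eqOn hΩ l (fun y hy => ih (hg.of_le hle) (hh.of_le hle) hy) hx,
        pd_sum l (antidiagonal n) (f := fun p y => n.choose p.1 • ((-1 : ℝ) ^ p.1 •
          pdIter l p.2 (fun y => pdIter l p.1 g y • h y) y))
          (fun p hp => ((hd p hp).fun_const_smul _).fun_const_smul _)]
      refine sum_congr rfl fun p hp => ?_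
      have e : (fun y => n.choose p.1 • ((-1 : ℝ) ^ p.1 •
          pdIter l p.2 (fun y => pdIter l p.1 g y • h y) y)) = fun y =>
          ((n.choose p.1 : ℝ) * (-1 : ℝ) ^ p.1) •
            pdIter l p.2 (fun y => pdIter l p.1 g y • h y) y := by
        ext y; rw [mul_smul, Nat.cast_smul_eq_nsmul]
      rw [e, pd_const_smul l _ (hd p hp), mul_smul, Nat.cast_smul_eq_nsmul, pdIter_succ]
    have h2 : ∑ p ∈ antidiagonal n, n.choose p.2 • ((-1 : ℝ) ^ (p.1 + 1) •
        pdIter l p.2 (fun y => pdIter l (p.1 + 1) g y • h y) x) =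
        - (pd l g x • pdIter l n h x) := by
      rw [← ih (contDiffOn_pd hΩ l hg) (hh.of_le hle) hx, ← sum_neg_distrib]
      refine sum_congr rfl fun p hp => ?_
      rw [n.choose_symm_of_eq_add (HasAntidiagonal.mem_antidiagonal.1 hp).symm, pow_succ]
      simp only [mul_neg, mul_one, neg_smul, smul_neg, pdIter_succ']
    rw [h1, h2, pd_smul l ((hg.contDiffAt (hΩ.mem_nhds hx)).differentiableAt (by simp))
      (differentiableAt_pdIter hΩ l (Nat.lt_succ_self n) hh hx), pdIter_succ]
    abel

/-- A trinomial coefficient is a product of two binomial ones, so the Leibniz rule for three factors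
is the rule for two factors applied to `(f g) v` and then to `f g`. -/
lemma sum_piAntidiag_fin_three {M : Type*} [AddCommMonoid M] (n : ℕ) (f : ℕ → ℕ → ℕ → M) :
    ∑ t ∈ piAntidiag (univ : Finset (Fin 3)) n, Nat.multinomial univ t • f (t 0) (t 1) (t 2) =
      ∑ p ∈ antidiagonal n, n.choose p.1 •
        ∑ r ∈ antidiagonal p.1, p.1.choose r.1 • f r.1 r.2 p.2 := by
  simp_rw [Finset.smul_sum]
  rw [sum_sigma']
  refine sum_bij' (fun t _ => ⟨(t 0 + t 1, t 2), (t 0, t 1)⟩)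
    (fun q _ => ![q.2.1, q.2.2, q.1.2]) ?_ ?_ ?_ ?_ ?_
  · intro t ht
    simp only [mem_piAntidiag, Fin.sum_univ_three] at ht
    simp [ht.1]
  · rintro ⟨⟨p, q⟩, ⟨r, s⟩⟩ h
    simp only [mem_sigma, HasAntidiagonal.mem_antidiagonal] at h
    simp [Fin.sum_univ_three, h.2, h.1]
  · intro t _
    ext i; fin_cases i <;> rfl
  · rintro ⟨⟨p, q⟩, ⟨r, s⟩⟩ h
    simp only [mem_sigma, HasAntidiagonal.mem_antidiagonal] at h
    simp [h.2]
  · intro t ht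
    simp only [mem_piAntidiag, Fin.sum_univ_three] at ht
    rw [← mul_smul]
    congr 1
    have h3 : (univ : Finset (Fin 3)) = {2, 0, 1} := by decide
    rw [h3, Nat.multinomial_insert (by decide), Nat.binomial_eq_choose (by decide),
      sum_pair (by decide), ← ht.1]
    congr 1
    rw [show t 2 + (t 0 + t 1) = (t 0 + t 1) + t 2 by ring]
    exact (Nat.choose_symm_add).symm

/-- The Leibniz rule for three factors. -/
lemma pdIter_mul_smul {Ω : Set E3} (hΩ : IsOpen Ω) (l : Fin 3) (n : ℕ) {f g : E3 → ℝ}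
    {v : E3 → F} (hf : ContDiffOn ℝ n f Ω) (hg : ContDiffOn ℝ n g Ω) (hv : ContDiffOn ℝ n v Ω)
    {x : E3} (hx : x ∈ Ω) :
    pdIter l n (fun y => (f y * g y) • v y) x =
      ∑ t ∈ piAntidiag (univ : Finset (Fin 3)) n, Nat.multinomial univ t •
        ((pdIter l (t 0) f x * pdIter l (t 1) g x) • pdIter l (t 2) v x) := by
  rw [sum_piAntidiag_fin_three n
    (fun i j k => (pdIter l i f x * pdIter l j g x) • pdIter l k v x),
    pdIter_smul hΩ l n (hf.mul hg) hv hx]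
  refine sum_congr rfl fun p hp => ?_
  have hp' : ((p.1 : ℕ) : WithTop ℕ∞) ≤ (n : ℕ) := by
    rw [HasAntidiagonal.mem_antidiagonal] at hp; exact_mod_cast (by omega)
  have := pdIter_smul hΩ l p.1 (hf.of_le hp') (hg.of_le hp') hx
  simp only [smul_eq_mul] at this
  rw [this, sum_smul]
  simp only [nsmul_eq_mul, mul_smul, Nat.cast_smul_eq_nsmul]

/-- The commutator of a multiplication operator with `∂^m`, in the form in which it appears after
integration by parts. -/
lemma commutator_sum {Ω : Set E3} (hΩ : IsOpen Ω) (l : Fin 3) (m : ℕ) {f g : E3 → ℝ}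
    {v : E3 → F} (hf : ContDiffOn ℝ m f Ω) (hg : ContDiffOn ℝ m g Ω) (hv : ContDiffOn ℝ m v Ω)
    {x : E3} (hx : x ∈ Ω) :
    ∑ k ∈ Icc 1 m, ∑ t ∈ piAntidiag (univ : Finset (Fin 3)) (m - k),
      ((-1) ^ k * (m.choose k : ℝ) * (Nat.multinomial univ t : ℝ)) •
        ((pdIter l (t 0) f x * pdIter l (t 1 + k) g x) • pdIter l (t 2) v x) =
      g x • pdIter l m (fun y => f y • v y) x - pdIter l m (fun y => (f y * g y) • v y) x := by
  -- With `h = f v` the alternating identity has `∂^m(f g v)` as its term `k = 0`; the terms `k ≥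
  -- 1`, expanded by the Leibniz rule for three factors, are the sum in question.
  have key := alternating_pdIter_smul hΩ l m hg (hf.smul hv) hx
  rw [Nat.sum_antidiagonal_eq_sum_range_succ_mk, range_eq_Ico,
    sum_eq_sum_Ico_succ_bot (Nat.succ_pos m)] at key
  rw [eq_sub_iff_add_eq, show (fun y => f y • v y) = f • v from rfl, ← key, add_comm]
  congr 1
  · simp only [Nat.choose_zero_right, pow_zero, one_smul, Nat.sub_zero, pdIter_zero]
    refine pdIter_eqOn hΩ l m (fun y _ => ?_) hx
    simp only [mul_comm (f y), mul_smul, Pi.smul_apply']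
  · refine sum_congr (by ext; simp) fun k hk => ?_
    have hk := Finset.mem_Icc.1 hk
    have e : EqOn (fun y => pdIter l k g y • (f • v) y)
        (fun y => (f y * pdIter l k g y) • v y) Ω := fun y _ => by
      simp only [mul_comm (f y), mul_smul, Pi.smul_apply']
    have hle : (((m - k : ℕ) : ℕ) : WithTop ℕ∞) ≤ (m : ℕ) := by exact_mod_cast (by omega)
    rw [pdIter_eqOn hΩ l (m - k) e hx, pdIter_mul_smul hΩ l (m - k) (hf.of_le hle)
      (contDiffOn_pdIter hΩ l (by rwa [Nat.sub_add_cancel (by omega)])) (hv.of_le hle) hx,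
      ← Nat.cast_smul_eq_nsmul ℝ, ← mul_smul, smul_sum]
    refine sum_congr rfl fun t _ => ?_
    rw [← pdIter_add, ← Nat.cast_smul_eq_nsmul ℝ, ← mul_smul ((m.choose k : ℝ) * (-1) ^ k),
      mul_comm ((-1 : ℝ) ^ k)]

/-- This permits replacing a coefficient by its bounded oscillation wherever it is differentiated at
least once. -/
lemma pdIter_sub_const (l : Fin 3) {t : ℕ} (ht : 1 ≤ t) (f : E3 → ℝ) (c : ℝ) :
    pdIter l t (fun y => f y - c) = pdIter l t f := by
  obtain ⟨t, rfl⟩ := Nat.exists_eq_succ_of_ne_zero (by omega : t ≠ 0)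
  rw [Nat.succ_eq_add_one, pdIter_succ', pdIter_succ']
  congr 1
  ext x
  simp only [pd, fderiv_sub_const]

end Leibniz

section IntegrationByParts

variable {F G W : Type*} [NormedAddCommGroup F] [NormedSpace ℝ F]
  [NormedAddCommGroup G] [NormedSpace ℝ G] [NormedAddCommGroup W] [NormedSpace ℝ W]

/-! ### Integration by parts -/

/-- The inner product of a real inner product space as a continuous bilinear map. -/
def innerBilin (V : Type*) [NormedAddCommGroup V] [InnerProductSpace ℝ V] :
    V →L[ℝ] V →L[ℝ] ℝ :=
  (innerₗ V).mkContinuous₂ 1 fun x y => by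
    simpa using norm_inner_le_norm (𝕜 := ℝ) x y

@[simp] lemma innerBilin_apply {V : Type*} [NormedAddCommGroup V] [InnerProductSpace ℝ V]
    (x y : V) : innerBilin V x y = inner ℝ x y := rfl

lemma continuous_pd (l : Fin 3) {f : E3 → F} (hf : ContDiff ℝ 1 f) : Continuous (pd l f) :=
  (hf.continuous_fderiv (by simp)).clm_apply continuous_const

lemma hasCompactSupport_pd (l : Fin 3) {f : E3 → F} (hf : HasCompactSupport f) :
    HasCompactSupport (pd l f) :=
  hf.mono' ((subset_tsupport _).trans (tsupport_pd_subset l f))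

lemma integrable_bilin (B : F →L[ℝ] G →L[ℝ] W) {f : E3 → F} {g : E3 → G} (hf : Continuous f)
    (hg : Continuous g) (hgc : HasCompactSupport g) : Integrable (fun x => B (f x) (g x)) := by
  refine Continuous.integrable_of_hasCompactSupport (by fun_prop) (hgc.mono fun x hx hx' => ?_)
  exact hx (by simp [hx'])

lemma integral_bilin_pd (B : F →L[ℝ] G →L[ℝ] W) (l : Fin 3) {f : E3 → F} {g : E3 → G}
    (hf : ContDiff ℝ 1 f) (hg : ContDiff ℝ 1 g) (hgc : HasCompactSupport g) :
    ∫ x, B (f x) (pd l g x) = - ∫ x, B (pd l f x) (g x) :=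
  integral_bilinear_fderiv_right_eq_neg_left_of_integrable
    (integrable_bilin B (continuous_pd l hf) hg.continuous hgc)
    (integrable_bilin B hf.continuous (continuous_pd l hg) (hasCompactSupport_pd l hgc))
    (integrable_bilin B hf.continuous hg.continuous hgc)
    (fun x _ => hf.differentiable (by simp) x) (fun x _ => hg.differentiable (by simp) x)

/-- The regularity is asymmetric on purpose: `g` will be a test function times coefficients that are
only of class `C^m`. -/
lemma integral_bilin_pdIter (B : F →L[ℝ] G →L[ℝ] W) (l : Fin 3) (n : ℕ) {f : E3 → F} {g : E3 → G}
    (hf : ContDiff ℝ (⊤ : ℕ∞) f) (hg : ContDiff ℝ n g) (hgc : HasCompactSupport g) :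
    ∫ x, B (f x) (pdIter l n g x) = (-1 : ℝ) ^ n • ∫ x, B (pdIter l n f x) (g x) := by
  induction n generalizing g with
  | zero => simp
  | succ n ih =>
    have hg' : ContDiff ℝ n (pd l g) := by
      rw [← contDiffOn_univ] at hg ⊢; exact contDiffOn_pd isOpen_univ l hg
    rw [pdIter_succ', ih hg' (hasCompactSupport_pd l hgc),
      integral_bilin_pd B l (contDiff_nat_of_top (n := 1) (contDiff_pdIter l n hf))
        (hg.of_le (by exact_mod_cast Nat.le_add_left 1 n)) hgc, pdIter_succ, pow_succ]
    simp

/-- Exchanging two pure derivatives of the same order by integration by parts. -/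
lemma integral_bilin_pdIter_swap (B : F →L[ℝ] G →L[ℝ] W) (l j : Fin 3) (n : ℕ) {f : E3 → F}
    {g : E3 → G} (hf : ContDiff ℝ (⊤ : ℕ∞) f) (hg : ContDiff ℝ n g) (hgc : HasCompactSupport g) :
    ∫ x, B (pdIter j n f x) (pdIter l n g x) = ∫ x, B (pdIter l n f x) (pdIter j n g x) := by
  -- Both sides reduce to the same integral with the same sign `(-1)^n`, as pure derivatives of `f`
  -- commute.
  rw [integral_bilin_pdIter B l n (contDiff_pdIter j n hf) hg hgc,
    integral_bilin_pdIter B j n (contDiff_pdIter l n hf) hg hgc, pdIter_comm l j n n hf]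

lemma integral_multiPd_smul (b : Fin 3 → ℕ) {f : E3 → ℝ} {g : E3 → F}
    (hf : ContDiff ℝ (⊤ : ℕ∞) f) (hg : ContDiff ℝ (⊤ : ℕ∞) g) (hfc : HasCompactSupport f) :
    ∫ x, multiPd b f x • g x = (-1 : ℝ) ^ (∑ i, b i) • ∫ x, f x • multiPd b g x := by
  have key : ∀ (l : Fin 3) (n : ℕ) {f : E3 → ℝ} {g : E3 → F}, ContDiff ℝ (⊤ : ℕ∞) f →
      ContDiff ℝ (⊤ : ℕ∞) g → HasCompactSupport f →
      ∫ x, pdIter l n f x • g x = (-1 : ℝ) ^ n • ∫ x, f x • pdIter l n g x :=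
    fun l n f g hf hg hfc => integral_bilin_pdIter (ContinuousLinearMap.lsmul ℝ ℝ).flip l n hg
      (contDiff_nat_of_top hf) hfc
  have hc : ∀ (l : Fin 3) (n : ℕ) {f : E3 → ℝ}, HasCompactSupport f →
      HasCompactSupport (pdIter l n f) := fun l n f h =>
    h.mono' ((subset_tsupport _).trans (tsupport_pdIter_subset l n f))
  unfold multiPd
  rw [key 0 _ (contDiff_pdIter _ _ (contDiff_pdIter _ _ hf)) hg (hc _ _ (hc _ _ hfc)),
    key 1 _ (contDiff_pdIter _ _ hf) (contDiff_pdIter _ _ hg) (hc _ _ hfc),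
    key 2 _ hf (contDiff_pdIter _ _ (contDiff_pdIter _ _ hg)) hfc,
    Fin.sum_univ_three, pow_add, pow_add, mul_smul, mul_smul,
    pdIter_comm 1 0 _ _ hg, pdIter_comm 2 0 _ _ (contDiff_pdIter _ _ hg), pdIter_comm 2 1 _ _ hg]

end IntegrationByParts

section MaximumPrinciple

/-! ### Estimates of mixed derivatives by pure derivatives -/

/-- A function on a finite set which is dominated by means of its values, one of them at a point of
larger rank, is dominated by its values on the exceptional set. -/
lemma exists_le_of_midpoint {ι : Type*} (S : Finset ι) (T : Set ι) (N : ι → ℝ) (rk : ι → ℕ)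
    (h : ∀ b ∈ S, b ∉ T → ∃ p ∈ S, ∃ q ∈ S, rk b < rk p ∧ 2 * N b ≤ N p + N q)
    {b : ι} (hb : b ∈ S) : ∃ c ∈ S, c ∈ T ∧ N b ≤ N c := by
  -- The rank breaks ties: outside `T` a maximum of `N` would be attained also at a point of larger
  -- rank.
  obtain ⟨c, hc, hmax⟩ := S.exists_max_image (fun b => toLex (N b, rk b)) ⟨b, hb⟩
  have hN : ∀ d ∈ S, N d ≤ N c := fun d hd => by
    rcases Prod.Lex.le_iff.1 (hmax d hd) with h | h
    · exact le_of_lt h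
    · exact le_of_eq h.1
  refine ⟨c, hc, ?_, hN b hb⟩
  by_contra hcT
  obtain ⟨p, hp, q, hq, hrk, hle⟩ := h c hc hcT
  have h1 : N p = N c := le_antisymm (hN p hp) (by linarith [hN q hq])
  rcases Prod.Lex.le_iff.1 (hmax p hp) with h | h
  · exact absurd h1 (ne_of_lt h)
  · exact absurd h.2 (not_le.2 hrk)

variable {V : Type*} [NormedAddCommGroup V] [InnerProductSpace ℝ V]

lemma integral_inner_le {f g : E3 → V} (hf : MemLp f 2) (hg : MemLp g 2) :
    2 * |∫ x, inner ℝ (f x) (g x)| ≤ (∫ x, ‖f x‖ ^ 2) + ∫ x, ‖g x‖ ^ 2 := by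
  have hf2 : Integrable fun x => ‖f x‖ ^ 2 := by simpa using hf.integrable_norm_pow (by norm_num)
  have hg2 : Integrable fun x => ‖g x‖ ^ 2 := by simpa using hg.integrable_norm_pow (by norm_num)
  have h1 : |∫ x, inner ℝ (f x) (g x)| ≤ ∫ x, (‖f x‖ ^ 2 + ‖g x‖ ^ 2) / 2 := by
    rw [← Real.norm_eq_abs]
    refine norm_integral_le_of_norm_le ((hf2.add hg2).div_const 2) (Filter.Eventually.of_forall ?_)
    intro x
    have h2 := norm_inner_le_norm (𝕜 := ℝ) (f x) (g x)
    nlinarith [sq_nonneg (‖f x‖ - ‖g x‖)]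
  rw [integral_div, integral_add hf2 hg2] at h1
  linarith

/-- `‖∂^b u‖²`. -/
def sqNorm (b : Fin 3 → ℕ) (u : E3 → V) : ℝ := ∫ x, ‖multiPd b u x‖ ^ 2

lemma sqNorm_nonneg (b : Fin 3 → ℕ) (u : E3 → V) : 0 ≤ sqNorm b u :=
  integral_nonneg fun _ => by positivity

variable {Ω : Set E3} {u : E3 → V}

/-- With `w = ∂^b u`, one integration by parts gives `‖∂_i w‖² = -⟨w, ∂_i² w⟩`. -/
lemma sqNorm_midpoint (hu : IsTestFun Ω u) (b : Fin 3 → ℕ) (i : Fin 3) :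
    2 * sqNorm (b + Pi.single i 1) u ≤ sqNorm (b + Pi.single i 1 + Pi.single i 1) u +
      sqNorm b u := by
  have h1 : sqNorm (b + Pi.single i 1) u =
      - ∫ x, inner ℝ (multiPd b u x) (multiPd (b + Pi.single i 1 + Pi.single i 1) u x) := by
    have := integral_bilin_pd (innerBilin V) i (contDiff_nat_of_top (n := 1) (hu.multiPd b).1)
      (contDiff_nat_of_top (n := 1) (hu.multiPd (b + Pi.single i 1)).1)
      (hu.multiPd (b + Pi.single i 1)).2.1
    rw [pd_multiPd _ _ hu.1, pd_multiPd _ _ hu.1] at this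
    simp only [innerBilin_apply, real_inner_self_eq_norm_sq] at this
    rw [this, neg_neg]; rfl
  have h2 := integral_inner_le ((hu.multiPd b).memLp 2 volume)
    ((hu.multiPd (b + Pi.single i 1 + Pi.single i 1)).memLp 2 volume)
  rw [h1]
  have h3 := neg_le_abs (∫ x, inner ℝ (multiPd b u x)
    (multiPd (b + Pi.single i 1 + Pi.single i 1) u x))
  unfold sqNorm
  linarith

/-- With `w = ∂^b u`, two integrations by parts give `‖∂_i ∂_j w‖² = ⟨∂_i² w, ∂_j² w⟩`. -/
lemma sqNorm_midpoint_mixed (hu : IsTestFun Ω u) (b : Fin 3 → ℕ) (i j : Fin 3) :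
    2 * sqNorm (b + Pi.single i 1 + Pi.single j 1) u ≤
      sqNorm (b + Pi.single i 1 + Pi.single i 1) u +
      sqNorm (b + Pi.single j 1 + Pi.single j 1) u := by
  have hs : ∀ c, ContDiff ℝ 1 (multiPd c u) := fun c =>
    contDiff_nat_of_top (n := 1) (hu.multiPd c).1
  have h1 : sqNorm (b + Pi.single i 1 + Pi.single j 1) u =
      ∫ x, inner ℝ (multiPd (b + Pi.single i 1 + Pi.single i 1) u x)
        (multiPd (b + Pi.single j 1 + Pi.single j 1) u x) := by
    have e1 := integral_bilin_pd (innerBilin V) j (hs (b + Pi.single i 1))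
      (hs (b + Pi.single i 1 + Pi.single j 1)) (hu.multiPd _).2.1
    have e2 := integral_bilin_pd (innerBilin V) i (hs (b + Pi.single i 1))
      (hs (b + Pi.single j 1 + Pi.single j 1)) (hu.multiPd _).2.1
    rw [pd_multiPd _ _ hu.1, pd_multiPd _ _ hu.1] at e1 e2
    simp only [innerBilin_apply, real_inner_self_eq_norm_sq] at e1 e2
    have e3 : b + Pi.single j 1 + Pi.single j 1 + Pi.single i 1 =
      b + Pi.single i 1 + Pi.single j 1 + Pi.single j 1 := by abel
    rw [e3] at e2
    unfold sqNorm
    linarith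
  have h2 := integral_inner_le ((hu.multiPd (b + Pi.single i 1 + Pi.single i 1)).memLp 2 volume)
    ((hu.multiPd (b + Pi.single j 1 + Pi.single j 1)).memLp 2 volume)
  rw [h1]
  have h3 := le_abs_self (∫ x, inner ℝ (multiPd (b + Pi.single i 1 + Pi.single i 1) u x)
        (multiPd (b + Pi.single j 1 + Pi.single j 1) u x))
  unfold sqNorm
  linarith

/-- The sum `∑_l ‖∂_l^m u‖²`. -/
def pureNorm (m : ℕ) (u : E3 → V) : ℝ := ∑ l, ∫ x, ‖pdIter l m u x‖ ^ 2

lemma pureNorm_nonneg (m : ℕ) (u : E3 → V) : 0 ≤ pureNorm m u :=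
  Finset.sum_nonneg fun _ _ => integral_nonneg fun _ => by positivity

lemma integral_pdIter_le_pureNorm (m : ℕ) (l : Fin 3) (u : E3 → V) :
    ∫ x, ‖pdIter l m u x‖ ^ 2 ≤ pureNorm m u :=
  Finset.single_le_sum (f := fun l => ∫ x, ‖pdIter l m u x‖ ^ 2)
    (fun _ _ => integral_nonneg fun _ => by positivity) (Finset.mem_univ l)

lemma sqNorm_single_le (m : ℕ) (l : Fin 3) (u : E3 → V) :
    sqNorm (Pi.single l m) u ≤ pureNorm m u := by
  unfold sqNorm
  rw [multiPd_single]
  exact integral_pdIter_le_pureNorm m l u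

/-- The rank used in the maximum principle. -/
def sqRank (b : Fin 3 → ℕ) : ℕ := ∑ i, b i ^ 2

lemma exists_eq_add_single {b : Fin 3 → ℕ} {i : Fin 3} (h : b i ≠ 0) :
    ∃ c : Fin 3 → ℕ, b = c + Pi.single i 1 := by
  refine ⟨b - Pi.single i 1, ?_⟩
  refine (tsub_add_cancel_of_le fun k => ?_).symm
  rcases eq_or_ne k i with rfl | hk
  · simpa using Nat.one_le_iff_ne_zero.2 h
  · simp [hk]

/-- A multi-index that is not pure has two non-zero entries. Moving a unit between them in either
direction gives its two neighbours, and moving it towards the larger entry increases the sum of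
squares. -/
lemma mixed_step (hu : IsTestFun Ω u) {m : ℕ} {b : Fin 3 → ℕ} (hb : ∑ i, b i = m)
    (hT : ∀ l, b ≠ Pi.single l m) :
    ∃ p : Fin 3 → ℕ, ∑ i, p i = m ∧ ∃ q : Fin 3 → ℕ, ∑ i, q i = m ∧
      sqRank b < sqRank p ∧ 2 * sqNorm b u ≤ sqNorm p u + sqNorm q u := by
  have hex : ∃ i j : Fin 3, i ≠ j ∧ b i ≠ 0 ∧ b j ≠ 0 := by
    by_contra hcon
    push Not at hcon
    rw [Fin.sum_univ_three] at hb
    by_cases h0 : b 0 = 0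
    · by_cases h1 : b 1 = 0
      · exact hT 2 (by ext k; fin_cases k <;> simp [h0, h1]; omega)
      · have := hcon 1 2 (by decide) h1
        exact hT 1 (by ext k; fin_cases k <;> simp [h0, this]; omega)
    · have h1 := hcon 0 1 (by decide) h0
      have h2 := hcon 0 2 (by decide) h0
      exact hT 0 (by ext k; fin_cases k <;> simp [h1, h2]; omega)
  obtain ⟨i, j, hij, hi, hj⟩ := hex
  wlog hle : b j ≤ b i generalizing i j
  · exact this j i hij.symm hj hi (by omega)
  obtain ⟨c, rfl⟩ := exists_eq_add_single hj
  have hci : c i ≠ 0 := by simpa [Pi.single_apply, hij] using hi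
  obtain ⟨d, rfl⟩ := exists_eq_add_single hci
  refine ⟨d + Pi.single i 1 + Pi.single i 1, ?_, d + Pi.single j 1 + Pi.single j 1, ?_, ?_,
    sqNorm_midpoint_mixed hu d i j⟩
  · rw [← hb]; simp [Finset.sum_add_distrib]
  · rw [← hb]; simp [Finset.sum_add_distrib]
  · unfold sqRank
    fin_cases i <;> fin_cases j <;> simp [Fin.sum_univ_three, Pi.single_apply] at hij hle ⊢ <;>
      nlinarith

/-- Derivatives of order `m` are controlled by the pure derivatives of order `m`. -/
lemma sqNorm_le_pureNorm (hu : IsTestFun Ω u) {m : ℕ} {b : Fin 3 → ℕ} (hb : ∑ i, b i = m) :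
    sqNorm b u ≤ pureNorm m u := by
  obtain ⟨c, -, ⟨l, rfl⟩, hle⟩ := exists_le_of_midpoint
    (Finset.piAntidiag (Finset.univ : Finset (Fin 3)) m) {b | ∃ l, b = Pi.single l m}
    (fun b => sqNorm b u) sqRank (b := b) (fun b hb hT => by
      simp only [Finset.mem_piAntidiag, mem_ofPred_eq, not_exists] at hb hT
      obtain ⟨p, hp, q, hq, h⟩ := mixed_step hu hb.1 hT
      exact ⟨p, by simpa using hp, q, by simpa using hq, h⟩) (by simpa using hb)
  exact hle.trans (sqNorm_single_le m l u)

/-- Derivatives of order at most `m` are controlled by `u` and the pure derivatives of order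
`m`. -/
lemma sqNorm_le_add (hu : IsTestFun Ω u) {m : ℕ} {b : Fin 3 → ℕ} (hb : ∑ i, b i ≤ m) :
    sqNorm b u ≤ sqNorm 0 u + pureNorm m u := by
  obtain ⟨c, -, hc, hle⟩ := exists_le_of_midpoint
    ((Finset.range (m + 1)).biUnion (Finset.piAntidiag (Finset.univ : Finset (Fin 3))))
    {b | b = 0 ∨ ∃ l, b = Pi.single l m} (fun b => sqNorm b u) sqRank (b := b)
    (fun b hb hT => by
      simp only [Finset.mem_biUnion, Finset.mem_range, Finset.mem_piAntidiag, mem_ofPred_eq,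
        not_or, not_exists] at hb hT
      obtain ⟨k, hk, hbk, -⟩ := hb
      rcases eq_or_ne k m with rfl | hkm
      · obtain ⟨p, hp, q, hq, h⟩ := mixed_step hu hbk hT.2
        exact ⟨p, by simpa using hp.le, q, by simpa using hq.le, h⟩
      -- For an order strictly between `0` and `m` the neighbours lower or raise one entry by one;
      -- raising it increases the rank.
      · obtain ⟨i, hi⟩ := Function.ne_iff.1 hT.1
        obtain ⟨d, rfl⟩ := exists_eq_add_single hi
        refine ⟨d + Pi.single i 1 + Pi.single i 1, ?_, d, ?_, ?_, sqNorm_midpoint hu d i⟩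
        · have hd : ∑ x, d x = Finset.univ.sum d := rfl
          simp [Finset.sum_add_distrib] at hbk ⊢
          omega
        · have hd : ∑ x, d x = Finset.univ.sum d := rfl
          simp [Finset.sum_add_distrib] at hbk ⊢
          omega
        · unfold sqRank
          fin_cases i <;> simp [Fin.sum_univ_three, Pi.single_apply] <;>
            exact Nat.pow_lt_pow_left (by omega) (by norm_num))
    (by simpa using hb)
  rcases hc with rfl | ⟨l, rfl⟩
  · exact hle.trans (le_add_of_nonneg_right (pureNorm_nonneg m u))
  · exact hle.trans ((sqNorm_single_le m l u).trans (le_add_of_nonneg_left (sqNorm_nonneg 0 u)))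

end MaximumPrinciple

section Decay

/-! ### Fields along which the weight decays -/

/-- The divergence of a vector field. -/
def diverg (ν : E3 → E3) (x : E3) : ℝ := ∑ l, pd l ν x l

/-- `ν` is a field of directions of rays in `Ω`, with non-negative divergence, along which `φ`
decays exponentially with rate `lam`. -/
structure DecayField (Ω : Set E3) (φ : E3 → ℝ) (lam : ℝ) (ν : E3 → E3) : Prop where
  contDiffOn : ContDiffOn ℝ 1 ν Ω
  norm_eq : ∀ x ∈ Ω, ‖ν x‖ = 1
  ray_mem : ∀ x ∈ Ω, ∀ t : ℝ, 0 ≤ t → x + t • ν x ∈ Ω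
  ray_eq : ∀ x ∈ Ω, ∀ t : ℝ, 0 ≤ t → ν (x + t • ν x) = ν x
  diverg_nonneg : ∀ x ∈ Ω, 0 ≤ diverg ν x
  decay : ∀ x ∈ Ω, fderiv ℝ φ x (ν x) + diverg ν x * φ x ≤ -lam * φ x

lemma DecayField.of_ridge {Ω : Set E3} {φ : E3 → ℝ} {lam : ℝ} (h : RidgeDecay Ω φ lam) :
    ∃ ν, DecayField Ω φ lam ν := by
  obtain ⟨Q, v, hv, -, hray, hdec⟩ := h
  have h0 : ∀ x, diverg (fun _ => v) x = 0 := fun x => by simp [diverg, pd]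
  refine ⟨fun _ => v, contDiffOn_const, fun _ _ => hv, hray, fun _ _ _ _ => rfl,
    fun x _ => (h0 x).ge, fun x hx => ?_⟩
  rw [h0]
  simpa using hdec x hx

lemma fderiv_norm_sub {P x : E3} (hx : x ≠ P) (v : E3) :
    DifferentiableAt ℝ (fun y => ‖y - P‖) x ∧
      fderiv ℝ (fun y => ‖y - P‖) x v = ‖x - P‖⁻¹ * inner ℝ (x - P) v := by
  have hn : ‖x - P‖ ≠ 0 := by simpa [sub_eq_zero] using hx
  have hd : DifferentiableAt ℝ (fun y => ‖y - P‖) x :=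
    DifferentiableAt.norm ℝ (by fun_prop) (sub_ne_zero.2 hx)
  refine ⟨hd, ?_⟩
  -- The derivative of the norm is read off by differentiating its square in two ways.
  have h1 : HasFDerivAt (fun y => ‖y - P‖ ^ 2)
      (2 • (innerSL ℝ (x - P)).comp (ContinuousLinearMap.id ℝ E3)) x :=
    ((hasFDerivAt_id x).sub_const P).norm_sq
  have h2 := (hd.hasFDerivAt.pow 2).unique h1
  have h3 := congrArg (fun L => L v) h2
  simp at h3
  rw [← inner_sub_left] at h3
  field_simp
  linarith

lemma pd_normalize {P x : E3} (hx : x ≠ P) (l : Fin 3) :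
    pd l (fun y => ‖y - P‖⁻¹ • (y - P)) x l =
      ‖x - P‖⁻¹ - ‖x - P‖⁻¹ ^ 3 * (x - P) l ^ 2 := by
  have hn : ‖x - P‖ ≠ 0 := by simpa [sub_eq_zero] using hx
  have hd := (fderiv_norm_sub hx (EuclideanSpace.single l 1)).1
  have hi : DifferentiableAt ℝ (fun y => ‖y - P‖⁻¹) x := hd.fun_inv hn
  rw [pd_smul l hi (by fun_prop)]
  have h1 : pd l (fun y => ‖y - P‖⁻¹) x = - ‖x - P‖⁻¹ ^ 3 * (x - P) l := by
    have := (hasDerivAt_inv hn).comp_hasFDerivAt x hd.hasFDerivAt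
    simp only [pd]
    erw [this.fderiv]
    have e := (fderiv_norm_sub hx (EuclideanSpace.single l 1)).2
    simp only [smul_apply, e, EuclideanSpace.inner_single_right]
    simp
    field_simp
  have h2 : pd l (fun y => y - P) x = EuclideanSpace.single l 1 := by
    simp only [pd, fderiv_sub_const, fderiv_fun_id]
    rfl
  rw [h1, h2]
  simp
  ring

lemma diverg_normalize {P x : E3} (hx : x ≠ P) :
    diverg (fun y => ‖y - P‖⁻¹ • (y - P)) x = 2 * ‖x - P‖⁻¹ := by
  have hn : ‖x - P‖ ≠ 0 := by simpa [sub_eq_zero] using hx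
  have hs : ‖x - P‖ ^ 2 = ∑ l, (x - P) l ^ 2 := by
    rw [EuclideanSpace.norm_sq_eq]; simp
  unfold diverg
  simp_rw [pd_normalize hx]
  rw [Finset.sum_sub_distrib, ← Finset.mul_sum, ← hs]
  simp
  field_simp
  ring

/-- The field is the radial unit field from `P`, with divergence `2/r`. Since `r⁻² d/dr (r² φ) = ∂_ν
φ + (2/r) φ`, the factor `r²` in the hill condition is exactly the divergence term of `decay`. -/
lemma DecayField.of_hill {Ω : Set E3} (hΩ : IsOpen Ω) {φ : E3 → ℝ} {lam : ℝ} {P : E3}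
    (hφ : ContDiffOn ℝ 1 φ Ω) (hP : PropertyRAt Ω P) (h : RadialDecay Ω P φ lam) :
    ∃ ν, DecayField Ω φ lam ν := by
  have hne : ∀ x ∈ Ω, x ≠ P := fun x hx hxP => hP.1 (hxP ▸ subset_closure hx)
  have hn : ∀ x ∈ Ω, 0 < ‖x - P‖ := fun x hx => norm_pos_iff.2 (sub_ne_zero.2 (hne x hx))
  have hun : ∀ x ∈ Ω, ‖‖x - P‖⁻¹ • (x - P)‖ = 1 := fun x hx => by
    rw [norm_smul, norm_inv, norm_norm, inv_mul_cancel₀ (hn x hx).ne']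
  have hx_eq : ∀ x ∈ Ω, ∀ t : ℝ, x + t • (‖x - P‖⁻¹ • (x - P)) =
      P + (‖x - P‖ + t) • (‖x - P‖⁻¹ • (x - P)) := fun x hx t => by
    rw [add_smul, smul_smul ‖x - P‖, mul_inv_cancel₀ (hn x hx).ne']
    simp
    abel
  refine ⟨fun y => ‖y - P‖⁻¹ • (y - P), ?_, hun, ?_, ?_, ?_, ?_⟩
  · intro x hx
    have : ContDiffAt ℝ 1 (fun y => ‖y - P‖⁻¹ • (y - P)) x := by
      have h1 : ContDiffAt ℝ 1 (fun y : E3 => y - P) x := by fun_prop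
      exact ((h1.norm ℝ (sub_ne_zero.2 (hne x hx))).inv (hn x hx).ne').smul h1
    exact this.contDiffWithinAt
  · intro x hx t ht
    -- Property `(R)` concerns radii strictly beyond the infimum, and the infimum is at most `‖x -
    -- P‖`; so `t = 0` is separate.
    rcases ht.eq_or_lt with rfl | ht
    · simpa using hx
    have hxm : P + ‖x - P‖ • (‖x - P‖⁻¹ • (x - P)) ∈ Ω := by
      have := hx_eq x hx 0
      simp only [zero_smul, add_zero] at this
      rwa [← this]
    show x + t • (‖x - P‖⁻¹ • (x - P)) ∈ Ω
    rw [hx_eq x hx t]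
    refine hP.2 _ (hun x hx) ⟨_, norm_nonneg _, hxm⟩ _ ?_
    have hbdd : BddBelow {r : ℝ | 0 ≤ r ∧ P + r • (‖x - P‖⁻¹ • (x - P)) ∈ Ω} :=
      ⟨0, fun r hr => hr.1⟩
    exact (csInf_le hbdd ⟨norm_nonneg _, hxm⟩).trans_lt (by linarith)
  · intro x hx t ht
    show ‖x + t • (‖x - P‖⁻¹ • (x - P)) - P‖⁻¹ • (x + t • (‖x - P‖⁻¹ • (x - P)) - P) = _
    rw [hx_eq x hx t, add_sub_cancel_left, norm_smul, hun x hx, mul_one, Real.norm_eq_abs,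
      abs_of_pos (by linarith [hn x hx]), smul_smul,
      inv_mul_cancel₀ (by linarith [hn x hx]), one_smul]
  · intro x hx
    rw [diverg_normalize (hne x hx)]
    have := hn x hx
    positivity
  · intro x hx
    rw [diverg_normalize (hne x hx)]
    set r := ‖x - P‖ with hr
    set ω := r⁻¹ • (x - P) with hω
    have hr0 : 0 < r := hn x hx
    have hxr : P + r • ω = x := by
      have := hx_eq x hx 0
      simp only [zero_smul, add_zero] at this
      exact this.symm
    have h1 := h ω (hun x hx) r hr0 (by rwa [hxr])
    have hd : DifferentiableAt ℝ φ (P + r • ω) := by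
      rw [hxr]
      exact (hφ.contDiffAt (hΩ.mem_nhds hx)).differentiableAt (by simp)
    have h2 : HasDerivAt (fun ρ : ℝ => P + ρ • ω) ω r := by
      simpa using ((hasDerivAt_id r).smul_const ω).const_add P
    have h3 := ((hasDerivAt_pow 2 r).mul (hd.hasFDerivAt.comp_hasDerivAt r h2)).deriv
    have h4 : deriv (fun ρ : ℝ => ρ ^ 2 * φ (P + ρ • ω)) r =
        2 * r * φ x + r ^ 2 * fderiv ℝ φ x ω := by
      erw [h3]
      simp [hxr]
    rw [h4, hxr] at h1
    have h5 : r ^ 2 * (fderiv ℝ φ x ω + 2 * r⁻¹ * φ x) ≤ r ^ 2 * (-lam * φ x) := by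
      have : r ^ 2 * (fderiv ℝ φ x ω + 2 * r⁻¹ * φ x) =
        2 * r * φ x + r ^ 2 * fderiv ℝ φ x ω := by field_simp; ring
      rw [this]; linarith
    exact le_of_mul_le_mul_left h5 (by positivity)

lemma IsBoundedWeight.contDiffOn {Ω : Set E3} {φ : E3 → ℝ} {lam : ℝ}
    (h : IsBoundedWeight Ω φ lam) : ContDiffOn ℝ 1 φ Ω := by
  simpa using h.2.1.1

lemma IsBoundedWeight.exists_decayField {Ω : Set E3} (hΩ : IsOpen Ω) {φ : E3 → ℝ} {lam : ℝ}
    (h : IsBoundedWeight Ω φ lam) : ∃ ν, DecayField Ω φ lam ν := by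
  rcases h.2.2.2.2 with ⟨P, hP, hd⟩ | hr
  · exact DecayField.of_hill hΩ h.contDiffOn hP hd
  · exact DecayField.of_ridge hr

variable {Ω : Set E3} {φ : E3 → ℝ} {lam : ℝ} {ν : E3 → E3}

lemma hasDerivAt_ray (x v : E3) (t : ℝ) : HasDerivAt (fun s : ℝ => x + s • v) v t := by
  simpa using ((hasDerivAt_id t).smul_const v).const_add x

/-- The function `e^{λt} φ(x + t ν)` does not increase along a ray: the divergence term in `decay`
is non-negative and may be dropped, and `ν` is constant on the ray. -/
lemma DecayField.le_exp (h : DecayField Ω φ lam ν) (hΩ : IsOpen Ω) (hφ : ContDiffOn ℝ 1 φ Ω)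
    (hpos : ∀ x ∈ Ω, 0 < φ x) {x : E3} (hx : x ∈ Ω) {t : ℝ} (ht : 0 ≤ t) :
    φ (x + t • ν x) ≤ Real.exp (-lam * t) * φ x := by
  have hd : ∀ t : ℝ, 0 ≤ t → HasDerivAt (fun s : ℝ => Real.exp (lam * s) * φ (x + s • ν x))
      (Real.exp (lam * t) * lam * φ (x + t • ν x) +
        Real.exp (lam * t) * fderiv ℝ φ (x + t • ν x) (ν x)) t := fun t ht => by
    have h1 : HasDerivAt (fun s : ℝ => Real.exp (lam * s)) (Real.exp (lam * t) * lam) t := by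
      simpa using ((hasDerivAt_id t).const_mul lam).exp
    have h2 : DifferentiableAt ℝ φ (x + t • ν x) :=
      (hφ.contDiffAt (hΩ.mem_nhds (h.ray_mem x hx t ht))).differentiableAt (by simp)
    exact h1.mul (h2.hasFDerivAt.comp_hasDerivAt t (hasDerivAt_ray x (ν x) t))
  have hanti : AntitoneOn (fun s : ℝ => Real.exp (lam * s) * φ (x + s • ν x)) (Ici 0) := by
    refine antitoneOn_of_deriv_nonpos (convex_Ici 0)
      (fun s hs => (hd s hs).continuousAt.continuousWithinAt) ?_ ?_
    · rw [interior_Ici]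
      exact fun s hs => (hd s (le_of_lt hs)).differentiableAt.differentiableWithinAt
    · rw [interior_Ici]
      intro s hs
      have hs : 0 ≤ s := le_of_lt hs
      rw [(hd s hs).deriv]
      have hm := h.ray_mem x hx s hs
      have h1 := h.decay _ hm
      rw [h.ray_eq x hx s hs] at h1
      have h2 := mul_nonneg (h.diverg_nonneg _ hm) (hpos _ hm).le
      have h3 := Real.exp_pos (lam * s)
      nlinarith
  have h1 := hanti (mem_Ici.2 le_rfl) (mem_Ici.2 ht) ht
  simp only [mul_zero, Real.exp_zero, zero_smul, add_zero, one_mul] at h1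
  have h2 : Real.exp (-lam * t) * (Real.exp (lam * t) * φ (x + t • ν x)) ≤
      Real.exp (-lam * t) * φ x := by gcongr
  rwa [← mul_assoc, ← Real.exp_add, show -lam * t + lam * t = 0 by ring, Real.exp_zero,
    one_mul] at h2

lemma norm_fderiv_le_of_pd {a : E3 → ℝ} {x : E3} {c : ℝ} (hc : ∀ l, |pd l a x| ≤ c) :
    ‖fderiv ℝ a x‖ ≤ 3 * c := by
  have hc0 : 0 ≤ c := (abs_nonneg _).trans (hc 0)
  refine ContinuousLinearMap.opNorm_le_bound _ (by positivity) fun v => ?_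
  have hv : v = ∑ l, v l • EuclideanSpace.single l (1 : ℝ) := by
    ext k; fin_cases k <;> simp [Fin.sum_univ_three]
  have h1 : fderiv ℝ a x v = ∑ l, v l * pd l a x := by
    conv_lhs => rw [hv]
    simp [pd]
  rw [h1]
  calc ‖∑ l, v l * pd l a x‖ ≤ ∑ l : Fin 3, ‖v l * pd l a x‖ := norm_sum_le _ _
    _ ≤ ∑ _l : Fin 3, c * ‖v‖ := by
        refine Finset.sum_le_sum fun l _ => ?_
        rw [norm_mul, mul_comm]
        exact mul_le_mul (hc l) (PiLp.norm_apply_le v l) (norm_nonneg _) hc0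
    _ = 3 * c * ‖v‖ := by simp; ring

/-! ### Bounded oscillation of coefficients whose gradient is dominated by the weight. -/

section Oscillation

variable {B C : ℝ} {a : E3 → ℝ}

/-- The squares of the partial derivatives are at most `C φ ≤ C B e^{-λt}` on the ray, and the
square root halves the rate. -/
lemma DecayField.norm_fderiv_ray_le (h : DecayField Ω φ lam ν) (hΩ : IsOpen Ω)
    (hφ : ContDiffOn ℝ 1 φ Ω) (hpos : ∀ x ∈ Ω, 0 < φ x) (hB : ∀ x ∈ Ω, φ x ≤ B) (hC : 0 < C)
    (hda : ∀ l, ∀ x ∈ Ω, |pd l a x| ^ 2 ≤ C * φ x) {x : E3} (hx : x ∈ Ω) {t : ℝ} (ht : 0 ≤ t) :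
    ‖fderiv ℝ a (x + t • ν x)‖ ≤ 3 * √(C * B) * Real.exp (-(lam / 2) * t) := by
  have hm := h.ray_mem x hx t ht
  rw [mul_assoc]
  refine norm_fderiv_le_of_pd fun l => ?_
  have hB0 : 0 < B := (hpos x hx).trans_le (hB x hx)
  refine abs_le_of_sq_le_sq ?_ (by positivity)
  have e : (√(C * B) * Real.exp (-(lam / 2) * t)) ^ 2 = C * (Real.exp (-lam * t) * B) := by
    rw [mul_pow, Real.sq_sqrt (by positivity), ← Real.exp_nat_mul]
    rw [show ((2 : ℕ) : ℝ) * (-(lam / 2) * t) = -lam * t by push_cast; ring]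
    ring
  rw [e, ← sq_abs]
  refine (hda l _ hm).trans ?_
  gcongr
  exact (h.le_exp hΩ hφ hpos hx ht).trans (by gcongr; exact hB x hx)

/-- The bound is the integral of `3 √(CB) e^{-λt/2}` over the half-line. It is obtained without
integration, from the monotonicity of `±a + κ e^{-λt/2}` along the ray. -/
lemma DecayField.abs_sub_ray_le (h : DecayField Ω φ lam ν) (hΩ : IsOpen Ω) (hlam : 0 < lam)
    (hφ : ContDiffOn ℝ 1 φ Ω) (hpos : ∀ x ∈ Ω, 0 < φ x) (hB : ∀ x ∈ Ω, φ x ≤ B) (hC : 0 < C)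
    (ha : ContDiffOn ℝ 1 a Ω) (hda : ∀ l, ∀ x ∈ Ω, |pd l a x| ^ 2 ≤ C * φ x)
    {x : E3} (hx : x ∈ Ω) {t : ℝ} (ht : 0 ≤ t) :
    |a (x + t • ν x) - a x| ≤ 6 * √(C * B) / lam := by
  have key : ∀ ε : ℝ, |ε| = 1 → ε * (a (x + t • ν x) - a x) ≤ 6 * √(C * B) / lam := by
    intro ε hε
    set κ := 6 * √(C * B) / lam with hκ
    have hκ0 : 0 ≤ κ := by positivity
    have hd : ∀ t : ℝ, 0 ≤ t → HasDerivAt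
        (fun s : ℝ => ε * a (x + s • ν x) + κ * Real.exp (-(lam / 2) * s))
        (ε * fderiv ℝ a (x + t • ν x) (ν x) +
          κ * (Real.exp (-(lam / 2) * t) * (-(lam / 2)))) t := fun t ht => by
      have h1 : HasDerivAt (fun s : ℝ => Real.exp (-(lam / 2) * s))
          (Real.exp (-(lam / 2) * t) * (-(lam / 2))) t := by
        simpa using ((hasDerivAt_id t).const_mul (-(lam / 2))).exp
      have h2 : DifferentiableAt ℝ a (x + t • ν x) :=
        (ha.contDiffAt (hΩ.mem_nhds (h.ray_mem x hx t ht))).differentiableAt (by simp)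
      exact ((h2.hasFDerivAt.comp_hasDerivAt t (hasDerivAt_ray x (ν x) t)).const_mul ε).add
        (h1.const_mul κ)
    have hanti : AntitoneOn
        (fun s : ℝ => ε * a (x + s • ν x) + κ * Real.exp (-(lam / 2) * s)) (Ici 0) := by
      refine antitoneOn_of_deriv_nonpos (convex_Ici 0)
        (fun s hs => (hd s hs).continuousAt.continuousWithinAt) ?_ ?_
      · rw [interior_Ici]
        exact fun s hs => (hd s (le_of_lt hs)).differentiableAt.differentiableWithinAt
      · rw [interior_Ici]
        intro s hs
        have hs : 0 ≤ s := le_of_lt hs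
        rw [(hd s hs).deriv]
        have h1 := h.norm_fderiv_ray_le hΩ hφ hpos hB hC hda hx hs
        have h2 : |ε * fderiv ℝ a (x + s • ν x) (ν x)| ≤
            3 * √(C * B) * Real.exp (-(lam / 2) * s) := by
          rw [abs_mul, hε, one_mul]
          have h3 := (fderiv ℝ a (x + s • ν x)).le_opNorm (ν x)
          rw [h.norm_eq x hx, mul_one] at h3
          exact h3.trans h1
        have h4 : κ * (Real.exp (-(lam / 2) * s) * (-(lam / 2))) =
            - (3 * √(C * B) * Real.exp (-(lam / 2) * s)) := by
          rw [hκ]; field_simp; ring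
        rw [h4]
        linarith [le_abs_self (ε * fderiv ℝ a (x + s • ν x) (ν x))]
    have h1 := hanti (mem_Ici.2 le_rfl) (mem_Ici.2 ht) ht
    simp only [mul_zero, Real.exp_zero, zero_smul, add_zero, mul_one] at h1
    have h2 : 0 ≤ κ * Real.exp (-(lam / 2) * t) := by positivity
    linarith
  rw [abs_le]
  constructor
  · linarith [key (-1) (by simp)]
  · linarith [key 1 (by simp)]

lemma tendsto_mul_exp_neg {c : ℝ} (hc : 0 < c) (p q : ℝ) :
    Filter.Tendsto (fun t : ℝ => p * Real.exp (-c * t) * (1 + t * q)) Filter.atTop (nhds 0) := by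
  have h0 : Filter.Tendsto (fun t : ℝ => Real.exp (-c * t)) Filter.atTop (nhds 0) := by
    refine Real.tendsto_exp_atBot.comp ?_
    exact Filter.tendsto_id.const_mul_atTop_of_neg (by linarith)
  have h1 : Filter.Tendsto (fun t : ℝ => t * Real.exp (-c * t)) Filter.atTop (nhds 0) := by
    have h2 := (Real.tendsto_pow_mul_exp_neg_atTop_nhds_zero 1).comp
      (Filter.tendsto_id.const_mul_atTop hc)
    have h3 := h2.const_mul c⁻¹
    rw [mul_zero] at h3
    refine h3.congr fun t => ?_
    simp
    field_simp
  have := (h0.const_mul p).add (h1.const_mul (p * q))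
  simp only [mul_zero, add_zero] at this
  exact this.congr fun t => by ring

/-- A function whose gradient is dominated by the weight oscillates by a bounded amount, with a
bound that depends only on the weight. -/
lemma DecayField.oscillation (h : DecayField Ω φ lam ν) (hΩ : IsOpen Ω) (hconn : IsConnected Ω)
    (hlam : 0 < lam) (hφ : ContDiffOn ℝ 1 φ Ω) (hpos : ∀ x ∈ Ω, 0 < φ x)
    (hB : ∀ x ∈ Ω, φ x ≤ B) (hC : 0 < C) (ha : ContDiffOn ℝ 1 a Ω)
    (hda : ∀ l, ∀ x ∈ Ω, |pd l a x| ^ 2 ≤ C * φ x) {x y : E3} (hx : x ∈ Ω) (hy : y ∈ Ω) :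
    |a x - a y| ≤ 12 * √(C * B) / lam := by
  have hlim : Filter.Tendsto (fun t : ℝ => a (x + t • ν x) - a (y + t • ν y)) Filter.atTop
      (nhds 0) := by
    -- Approaching each other along the rays is a symmetric and transitive relation, so by
    -- connectedness it suffices to check it for nearby points.
    refine hconn.isPreconnected.induction₂ (fun x y => Filter.Tendsto
      (fun t : ℝ => a (x + t • ν x) - a (y + t • ν y)) Filter.atTop (nhds 0)) ?_ ?_ ?_ hx hy
    · intro x hx
      have hcont : ContinuousAt (fun z => ‖fderiv ℝ ν z‖) x :=
        ((h.contDiffOn.continuousOn_fderiv_of_isOpen hΩ le_rfl).continuousAt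
          (hΩ.mem_nhds hx)).norm
      have hev := hcont.eventually (gt_mem_nhds (lt_add_one ‖fderiv ℝ ν x‖))
      obtain ⟨δ, hδ, hball⟩ := Metric.eventually_nhds_iff_ball.1
        (hev.and (hΩ.eventually_mem hx))
      refine mem_nhdsWithin_of_mem_nhds ?_
      filter_upwards [Metric.ball_mem_nhds x hδ] with y hy
      set L := ‖fderiv ℝ ν x‖ + 1
      -- Rays may spread, but at most linearly in `t`: the derivative of `z + t ν(z)` is at most `1
      -- + tL` near `x`, which loses against the exponential decay of the gradient of `a`.
      have hbd : ∀ t : ℝ, 0 ≤ t → ‖a (x + t • ν x) - a (y + t • ν y)‖ ≤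
          3 * √(C * B) * Real.exp (-(lam / 2) * t) * (1 + t * L) * ‖x - y‖ := by
        intro t ht
        refine (convex_ball x δ).norm_image_sub_le_of_norm_hasFDerivWithin_le
          (f := fun z => a (z + t • ν z))
          (f' := fun z => (fderiv ℝ a (z + t • ν z)).comp
            (ContinuousLinearMap.id ℝ E3 + t • fderiv ℝ ν z)) ?_ ?_ hy
            (Metric.mem_ball_self hδ)
        · intro z hz
          have hzΩ := (hball z hz).2
          have h1 : DifferentiableAt ℝ a (z + t • ν z) :=
            (ha.contDiffAt (hΩ.mem_nhds (h.ray_mem z hzΩ t ht))).differentiableAt (by simp)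
          have h2 : DifferentiableAt ℝ ν z :=
            (h.contDiffOn.contDiffAt (hΩ.mem_nhds hzΩ)).differentiableAt (by simp)
          have h3 : HasFDerivAt (fun z => z + t • ν z)
              (ContinuousLinearMap.id ℝ E3 + t • fderiv ℝ ν z) z :=
            (hasFDerivAt_id z).add (h2.hasFDerivAt.const_smul t)
          exact (h1.hasFDerivAt.comp z h3).hasFDerivWithinAt
        · intro z hz
          have hzΩ := (hball z hz).2
          refine (ContinuousLinearMap.opNorm_comp_le _ _).trans ?_
          refine mul_le_mul (h.norm_fderiv_ray_le hΩ hφ hpos hB hC hda hzΩ ht) ?_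
            (norm_nonneg _) (by positivity)
          refine (norm_add_le _ _).trans (add_le_add ContinuousLinearMap.norm_id_le ?_)
          rw [norm_smul, Real.norm_eq_abs, abs_of_nonneg ht]
          exact mul_le_mul_of_nonneg_left (hball z hz).1.le ht
      have hz := (tendsto_mul_exp_neg (half_pos hlam) (3 * √(C * B)) L).mul_const ‖x - y‖
      rw [zero_mul] at hz
      exact squeeze_zero_norm' ((Filter.eventually_ge_atTop 0).mono hbd) hz
    · intro x y z _ _ _ h1 h2
      simpa using h1.add h2
    · intro x y _ _ h1
      simpa using h1.neg
  -- Go out along one ray, across, and back along the other: `12 = 6 + 6`, and the crossing costs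
  -- nothing in the limit.
  have hle : ∀ t : ℝ, 0 ≤ t → |a x - a y| ≤
      12 * √(C * B) / lam + |a (x + t • ν x) - a (y + t • ν y)| := by
    intro t ht
    have h1 := h.abs_sub_ray_le hΩ hlam hφ hpos hB hC ha hda hx ht
    have h2 := h.abs_sub_ray_le hΩ hlam hφ hpos hB hC ha hda hy ht
    have e : 12 * √(C * B) / lam = 6 * √(C * B) / lam + 6 * √(C * B) / lam := by ring
    rw [e]
    rw [abs_le] at h1 h2 ⊢
    have h3 := neg_abs_le (a (x + t • ν x) - a (y + t • ν y))
    have h4 := le_abs_self (a (x + t • ν x) - a (y + t • ν y))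
    constructor <;> linarith [h1.1, h1.2, h2.1, h2.2]
  have := (hlim.abs).const_add (12 * √(C * B) / lam)
  rw [abs_zero, add_zero] at this
  exact ge_of_tendsto this ((Filter.eventually_ge_atTop 0).mono hle)

end Oscillation

end Decay

section WeightedPoincare

/-! ### Products with functions that are only controlled in `Ω` -/

/-- Weight and coefficients are arbitrary outside `Ω`. The product is still continuous on the whole
space, since it vanishes near every point off the support of `g`. -/
lemma continuous_smul_of_tsupport {F : Type*} [NormedAddCommGroup F] [NormedSpace ℝ F]
    {Ω : Set E3} (hΩ : IsOpen Ω) {f : E3 → ℝ} {g : E3 → F} (hf : ContinuousOn f Ω)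
    (hg : Continuous g) (hs : tsupport g ⊆ Ω) : Continuous fun x => f x • g x := by
  refine continuous_iff_continuousAt.2 fun x => ?_
  by_cases hx : x ∈ tsupport g
  · exact (hf.continuousAt (hΩ.mem_nhds (hs hx))).smul hg.continuousAt
  · have h0 : g =ᶠ[nhds x] 0 := notMem_tsupport_iff_eventuallyEq.1 hx
    refine (continuousAt_const (y := (0 : F))).congr ?_
    filter_upwards [h0] with y hy
    simp [hy]

lemma contDiff_smul_of_tsupport {F : Type*} [NormedAddCommGroup F] [NormedSpace ℝ F]
    {Ω : Set E3} (hΩ : IsOpen Ω) {n : WithTop ℕ∞} {f : E3 → ℝ} {g : E3 → F}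
    (hf : ContDiffOn ℝ n f Ω) (hg : ContDiff ℝ n g) (hs : tsupport g ⊆ Ω) :
    ContDiff ℝ n fun x => f x • g x := by
  refine contDiff_iff_contDiffAt.2 fun x => ?_
  by_cases hx : x ∈ tsupport g
  · exact (hf.contDiffAt (hΩ.mem_nhds (hs hx))).smul hg.contDiffAt
  · have h0 : g =ᶠ[nhds x] 0 := notMem_tsupport_iff_eventuallyEq.1 hx
    refine (contDiffAt_const (c := (0 : F))).congr_of_eventuallyEq ?_
    filter_upwards [h0] with y hy
    simp [hy]

lemma hasCompactSupport_smul {F : Type*} [NormedAddCommGroup F] [NormedSpace ℝ F]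
    (f : E3 → ℝ) {g : E3 → F} (hg : HasCompactSupport g) :
    HasCompactSupport fun x => f x • g x :=
  hg.mono fun x hx h => hx (by simp [h])

lemma integral_pd_eq_zero (l : Fin 3) {g : E3 → ℝ} (hg : ContDiff ℝ 1 g)
    (hgc : HasCompactSupport g) : ∫ x, pd l g x = 0 := by
  have := integral_bilin_pd (ContinuousLinearMap.mul ℝ ℝ) l (f := fun _ => (1 : ℝ))
    contDiff_const hg hgc
  simpa [pd] using this

/-! ### The weighted Poincaré inequality -/

variable {V : Type*} [NormedAddCommGroup V] [InnerProductSpace ℝ V]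
variable {Ω : Set E3} {φ : E3 → ℝ} {lam : ℝ} {ν : E3 → E3}

lemma integrable_weight (hΩ : IsOpen Ω) (hφ : ContinuousOn φ Ω) {w : E3 → V}
    (hw : IsTestFun Ω w) : Integrable fun x => φ x * ‖w x‖ ^ 2 := by
  have hs : Function.support (fun x => ‖w x‖ ^ 2) ⊆ Function.support w := fun x hx h =>
    hx (by simp [h])
  have hc : HasCompactSupport (fun x => ‖w x‖ ^ 2) := hw.2.1.mono hs
  exact (continuous_smul_of_tsupport hΩ hφ (hw.1.continuous.norm.pow 2)
    ((closure_mono hs).trans hw.2.2)).integrable_of_hasCompactSupport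
    (hasCompactSupport_smul φ hc)

/-- The divergence of `φ |w|² ν` is `(∂_ν φ + φ div ν)|w|² + 2φ⟨w, ∂_ν w⟩`. The first part is at
most `-λ φ |w|²`, half of which absorbs the second part by Young's inequality. -/
lemma DecayField.sum_pd_le (h : DecayField Ω φ lam ν) (hΩ : IsOpen Ω) (hlam : 0 < lam)
    (hφ : ContDiffOn ℝ 1 φ Ω) (hpos : ∀ x ∈ Ω, 0 < φ x) {w : E3 → V} (hw : IsTestFun Ω w)
    {x : E3} (hx : x ∈ Ω) :
    ∑ l, pd l (fun y => (φ y * ν y l) • ‖w y‖ ^ 2) x ≤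
      -(lam / 2) * (φ x * ‖w x‖ ^ 2) + 2 / lam * ∑ l, φ x * ‖pd l w x‖ ^ 2 := by
  have hdφ : DifferentiableAt ℝ φ x :=
    (hφ.contDiffAt (hΩ.mem_nhds hx)).differentiableAt (by simp)
  have hdν : DifferentiableAt ℝ ν x :=
    (h.contDiffOn.contDiffAt (hΩ.mem_nhds hx)).differentiableAt (by simp)
  have hdw : DifferentiableAt ℝ w x := hw.1.differentiable (by simp) x
  have hdl : ∀ l, DifferentiableAt ℝ (fun y => ν y l) x := fun l =>
    ((EuclideanSpace.proj l : E3 →L[ℝ] ℝ).differentiableAt).comp x hdν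
  have hpl : ∀ l, pd l (fun y => ν y l) x = pd l ν x l := fun l => by
    have := ((EuclideanSpace.proj l : E3 →L[ℝ] ℝ).hasFDerivAt).comp x hdν.hasFDerivAt
    simp only [pd]
    erw [this.fderiv]
    rfl
  have hpw : ∀ l, pd l (fun y => ‖w y‖ ^ 2) x = 2 * inner ℝ (w x) (pd l w x) := fun l => by
    simp only [pd]
    rw [hdw.hasFDerivAt.norm_sq.fderiv]
    simp
  have h1 : ∀ l, pd l (fun y => (φ y * ν y l) • ‖w y‖ ^ 2) x =
      (φ x * ν x l) * (2 * inner ℝ (w x) (pd l w x)) +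
        (φ x * pd l ν x l + pd l φ x * ν x l) * ‖w x‖ ^ 2 := fun l => by
    rw [pd_smul l (hdφ.fun_mul (hdl l)) (hdw.norm_sq ℝ), hpw]
    have := pd_smul l hdφ (hdl l)
    simp only [smul_eq_mul] at this
    rw [this, hpl, smul_eq_mul, smul_eq_mul]
  have hνs : ν x = ∑ l, ν x l • EuclideanSpace.single l (1 : ℝ) := by
    ext k; fin_cases k <;> simp [Fin.sum_univ_three]
  have h2 : fderiv ℝ φ x (ν x) = ∑ l, pd l φ x * ν x l := by
    conv_lhs => rw [hνs]
    simp [pd, mul_comm]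
  have h3 : ∑ l, pd l (fun y => (φ y * ν y l) • ‖w y‖ ^ 2) x =
      φ x * (2 * inner ℝ (w x) (∑ l, ν x l • pd l w x)) +
        (fderiv ℝ φ x (ν x) + diverg ν x * φ x) * ‖w x‖ ^ 2 := by
    simp_rw [h1]
    rw [h2, diverg, inner_sum, Finset.sum_add_distrib, Finset.mul_sum, Finset.mul_sum, add_mul,
      Finset.sum_mul, Finset.sum_mul, Finset.sum_mul, ← Finset.sum_add_distrib,
      ← Finset.sum_add_distrib, ← Finset.sum_add_distrib]
    refine Finset.sum_congr rfl fun l _ => ?_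
    rw [inner_smul_right]
    ring
  have h4 : ‖∑ l, ν x l • pd l w x‖ ^ 2 ≤ ∑ l, ‖pd l w x‖ ^ 2 := by
    have e1 : ‖∑ l, ν x l • pd l w x‖ ≤ ∑ l, |ν x l| * ‖pd l w x‖ :=
      (norm_sum_le _ _).trans (by simp [norm_smul])
    have e2 := Finset.sum_mul_sq_le_sq_mul_sq Finset.univ (fun l => |ν x l|)
      (fun l => ‖pd l w x‖)
    have e3 : ∑ l, |ν x l| ^ 2 = 1 := by
      have := EuclideanSpace.norm_sq_eq (ν x)
      rw [h.norm_eq x hx] at this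
      simpa using this.symm
    rw [e3, one_mul] at e2
    exact (pow_le_pow_left₀ (norm_nonneg _) e1 2).trans e2
  have h5 := h.decay x hx
  have h6 := abs_real_inner_le_norm (w x) (∑ l, ν x l • pd l w x)
  have h7 := le_abs_self (inner ℝ (w x) (∑ l, ν x l • pd l w x))
  rw [h3, ← Finset.mul_sum]
  set p := ‖w x‖
  set q := ‖∑ l, ν x l • pd l w x‖
  have h8 : 2 * (p * q) ≤ lam / 2 * p ^ 2 + 2 / lam * q ^ 2 := by
    have e : lam / 2 * p ^ 2 + 2 / lam * q ^ 2 - 2 * (p * q) =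
        (lam * p - 2 * q) ^ 2 / (2 * lam) := by field_simp; ring
    have : 0 ≤ (lam * p - 2 * q) ^ 2 / (2 * lam) := by positivity
    linarith
  have hφx := (hpos x hx).le
  have h9 : φ x * (2 * inner ℝ (w x) (∑ l, ν x l • pd l w x)) ≤
      φ x * (lam / 2 * p ^ 2 + 2 / lam * ∑ l, ‖pd l w x‖ ^ 2) := by
    refine mul_le_mul_of_nonneg_left ?_ hφx
    have : 2 / lam * q ^ 2 ≤ 2 / lam * ∑ l, ‖pd l w x‖ ^ 2 := by gcongr
    linarith
  have h10 := mul_le_mul_of_nonneg_right h5 (sq_nonneg p)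
  nlinarith

/-- The weighted Poincaré inequality. -/
lemma DecayField.poincare (h : DecayField Ω φ lam ν) (hΩ : IsOpen Ω) (hlam : 0 < lam)
    (hφ : ContDiffOn ℝ 1 φ Ω) (hpos : ∀ x ∈ Ω, 0 < φ x) {w : E3 → V} (hw : IsTestFun Ω w) :
    ∫ x, φ x * ‖w x‖ ^ 2 ≤ 4 / lam ^ 2 * ∑ l, ∫ x, φ x * ‖pd l w x‖ ^ 2 := by
  have hs : Function.support (fun x => ‖w x‖ ^ 2) ⊆ Function.support w := fun x hx h =>
    hx (by simp [h])
  have hc : HasCompactSupport (fun x => ‖w x‖ ^ 2) := hw.2.1.mono hs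
  have hts : tsupport (fun x => ‖w x‖ ^ 2) ⊆ Ω := (closure_mono hs).trans hw.2.2
  have hsm : ∀ l, ContDiff ℝ 1 (fun y => (φ y * ν y l) • ‖w y‖ ^ 2) := fun l =>
    contDiff_smul_of_tsupport hΩ (hφ.mul
      (((EuclideanSpace.proj l : E3 →L[ℝ] ℝ).contDiff).comp_contDiffOn h.contDiffOn))
      ((contDiff_nat_of_top (n := 1) hw.1).norm_sq ℝ) hts
  have hcs : ∀ l, HasCompactSupport (fun y => (φ y * ν y l) • ‖w y‖ ^ 2) := fun l =>
    hasCompactSupport_smul _ hc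
  have hdint : ∀ l, Integrable (pd l (fun y => (φ y * ν y l) • ‖w y‖ ^ 2)) := fun l =>
    (continuous_pd l (hsm l)).integrable_of_hasCompactSupport (hasCompactSupport_pd l (hcs l))
  -- Divergence theorem for a compactly supported field; the pointwise bound is then integrated.
  have h0 : ∫ x, ∑ l, pd l (fun y => (φ y * ν y l) • ‖w y‖ ^ 2) x = 0 := by
    rw [integral_finsetSum _ fun l _ => hdint l]
    exact Finset.sum_eq_zero fun l _ => integral_pd_eq_zero l (hsm l) (hcs l)
  have hi1 := integrable_weight hΩ hφ.continuousOn hw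
  have hi2 : ∀ l, Integrable fun x => φ x * ‖pd l w x‖ ^ 2 := fun l =>
    integrable_weight hΩ hφ.continuousOn (hw.pd l)
  have hle : ∀ x, ∑ l, pd l (fun y => (φ y * ν y l) • ‖w y‖ ^ 2) x ≤
      -(lam / 2) * (φ x * ‖w x‖ ^ 2) + 2 / lam * ∑ l, φ x * ‖pd l w x‖ ^ 2 := by
    intro x
    by_cases hx : x ∈ Ω
    · exact h.sum_pd_le hΩ hlam hφ hpos hw hx
    · have hw0 : w x = 0 := image_eq_zero_of_notMem_tsupport fun hx' => hx (hw.2.2 hx')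
      have hpw0 : ∀ l, pd l w x = 0 := fun l =>
        image_eq_zero_of_notMem_tsupport fun hx' => hx ((hw.pd l).2.2 hx')
      have hp0 : ∀ l, pd l (fun y => (φ y * ν y l) • ‖w y‖ ^ 2) x = 0 := fun l => by
        refine image_eq_zero_of_notMem_tsupport fun hx' => hx (hts ?_)
        exact tsupport_smul_subset_right (fun y => φ y * ν y l) (fun y => ‖w y‖ ^ 2)
          (tsupport_pd_subset l _ hx')
      rw [Finset.sum_eq_zero fun l _ => hp0 l]
      simp [hw0, hpw0]
  have hmono := integral_mono (integrable_finsetSum _ fun l _ => hdint l)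
    ((hi1.const_mul _).add ((integrable_finsetSum Finset.univ fun l _ => hi2 l).const_mul _)) hle
  rw [h0, integral_add' (hi1.const_mul _)
    ((integrable_finsetSum Finset.univ fun l _ => hi2 l).const_mul _), integral_const_mul,
    integral_const_mul, integral_finsetSum _ fun l _ => hi2 l] at hmono
  have e : 4 / lam ^ 2 * ∑ l, ∫ x, φ x * ‖pd l w x‖ ^ 2 =
      2 / lam * (2 / lam * ∑ l, ∫ x, φ x * ‖pd l w x‖ ^ 2) := by field_simp; ring
  rw [e]
  have h1 : lam / 2 * ∫ x, φ x * ‖w x‖ ^ 2 ≤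
      2 / lam * ∑ l, ∫ x, φ x * ‖pd l w x‖ ^ 2 := by linarith
  calc ∫ x, φ x * ‖w x‖ ^ 2 = 2 / lam * (lam / 2 * ∫ x, φ x * ‖w x‖ ^ 2) := by field_simp
    _ ≤ _ := by gcongr

/-- Weighted lower order derivatives are controlled by the pure derivatives of order `m`. -/
lemma DecayField.weighted_le (h : DecayField Ω φ lam ν) (hΩ : IsOpen Ω) (hlam : 0 < lam)
    (hφ : ContDiffOn ℝ 1 φ Ω) (hpos : ∀ x ∈ Ω, 0 < φ x) {B : ℝ} (hB0 : 0 ≤ B)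
    (hB : ∀ x ∈ Ω, φ x ≤ B) {u : E3 → V} (hu : IsTestFun Ω u) (n : ℕ) (b : Fin 3 → ℕ) :
    ∫ x, φ x * ‖multiPd b u x‖ ^ 2 ≤
      (12 / lam ^ 2) ^ n * (B * pureNorm (n + ∑ i, b i) u) := by
  induction n generalizing b with
  | zero =>
    rw [pow_zero, one_mul, zero_add]
    refine le_trans ?_ (mul_le_mul_of_nonneg_left (sqNorm_le_pureNorm hu rfl) hB0)
    rw [sqNorm, ← integral_const_mul]
    refine integral_mono (integrable_weight hΩ hφ.continuousOn (hu.multiPd b)) ?_ fun x => ?_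
    · refine Integrable.const_mul ?_ B
      simpa using ((hu.multiPd b).memLp 2 volume).integrable_norm_pow (by norm_num)
    · by_cases hx : x ∈ Ω
      · exact mul_le_mul_of_nonneg_right (hB x hx) (by positivity)
      · have hw0 : multiPd b u x = 0 :=
          image_eq_zero_of_notMem_tsupport fun hx' => hx ((hu.multiPd b).2.2 hx')
        simp [hw0]
  | succ n ih =>
    -- Each use of the inequality raises the order by one and sums over three directions, which
    -- turns `4/λ²` into `12/λ²`.
    refine (h.poincare hΩ hlam hφ hpos (hu.multiPd b)).trans ?_
    have h1 : ∀ l ∈ (Finset.univ : Finset (Fin 3)),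
        ∫ x, φ x * ‖pd l (multiPd b u) x‖ ^ 2 ≤
        (12 / lam ^ 2) ^ n * (B * pureNorm (n + 1 + ∑ i, b i) u) := fun l _ => by
      rw [pd_multiPd b l hu.1]
      have := ih (b + Pi.single l 1)
      simp only [Pi.add_apply, Finset.sum_add_distrib, Finset.sum_pi_single', Finset.mem_univ,
        if_true] at this
      rwa [show n + (∑ i, b i + 1) = n + 1 + ∑ i, b i by ring] at this
    have h2 := Finset.sum_le_sum h1
    rw [Finset.sum_const, Finset.card_univ, Fintype.card_fin, nsmul_eq_mul] at h2
    calc _ ≤ 4 / lam ^ 2 *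
          (((3 : ℕ) : ℝ) * ((12 / lam ^ 2) ^ n * (B * pureNorm (n + 1 + ∑ i, b i) u))) := by
          gcongr
      _ = _ := by push_cast; ring

end WeightedPoincare

section Algebra

/-! ### The algebra of `ℂ ⊗ ℍ` -/

/-- Through this identity all estimates, and Lax-Milgram, take place in a real Hilbert space. -/
lemma re_hInner (u v : CH) : (hInner u v).re = inner ℝ u v := by
  simp only [hInner, WithLp.prod_inner_apply, Quaternion.inner_def]
  simp

lemma hInner_add_left (u u' v : CH) : hInner (u + u') v = hInner u v + hInner u' v := by
  simp only [hInner, WithLp.add_fst, WithLp.add_snd, star_add, add_mul]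
  abel

lemma hInner_add_right (u v v' : CH) : hInner u (v + v') = hInner u v + hInner u v' := by
  simp only [hInner, WithLp.add_fst, WithLp.add_snd, mul_add]
  abel

lemma hInner_smul_left (c : ℝ) (u v : CH) : hInner (c • u) v = c • hInner u v := by
  simp [hInner, WithLp.smul_fst, WithLp.smul_snd]

lemma hInner_smul_right (c : ℝ) (u v : CH) : hInner u (c • v) = c • hInner u v := by
  simp [hInner, WithLp.smul_fst, WithLp.smul_snd]

lemma norm_sq_eq (u : CH) : ‖u‖ ^ 2 = ‖u.fst‖ ^ 2 + ‖u.snd‖ ^ 2 :=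
  WithLp.prod_norm_sq_eq_of_L2 u

lemma norm_fst_le (u : CH) : ‖u.fst‖ ≤ ‖u‖ := by
  refine (pow_le_pow_iff_left₀ (norm_nonneg _) (norm_nonneg _) two_ne_zero).1 ?_
  rw [norm_sq_eq u]
  exact le_add_of_nonneg_right (by positivity)

lemma norm_snd_le (u : CH) : ‖u.snd‖ ≤ ‖u‖ := by
  refine (pow_le_pow_iff_left₀ (norm_nonneg _) (norm_nonneg _) two_ne_zero).1 ?_
  rw [norm_sq_eq u]
  exact le_add_of_nonneg_left (by positivity)

lemma norm_hInner_le (u v : CH) : ‖hInner u v‖ ≤ 2 * ‖u‖ * ‖v‖ := by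
  have h1 : ‖star u.fst * v.fst‖ ≤ ‖u‖ * ‖v‖ := by
    rw [norm_mul, norm_star]
    exact mul_le_mul (norm_fst_le u) (norm_fst_le v) (norm_nonneg _) (norm_nonneg _)
  have h2 : ‖star u.snd * v.snd‖ ≤ ‖u‖ * ‖v‖ := by
    rw [norm_mul, norm_star]
    exact mul_le_mul (norm_snd_le u) (norm_snd_le v) (norm_nonneg _) (norm_nonneg _)
  exact (norm_add_le _ _).trans (by linarith)

/-- The `ℍ`-valued scalar product as a continuous real bilinear map. -/
def hInnerL : CH →L[ℝ] CH →L[ℝ] ℍ[ℝ] :=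
  (LinearMap.mk₂ ℝ hInner hInner_add_left hInner_smul_left hInner_add_right
    hInner_smul_right).mkContinuous₂ 2 norm_hInner_le

lemma norm_qmul (q : ℍ[ℝ]) (u : CH) : ‖qmul q u‖ = ‖q‖ * ‖u‖ := by
  have : ‖qmul q u‖ ^ 2 = (‖q‖ * ‖u‖) ^ 2 := by
    rw [norm_sq_eq, mul_pow, norm_sq_eq u]
    change ‖q * u.fst‖ ^ 2 + ‖q * u.snd‖ ^ 2 = _
    simp only [norm_mul]
    ring
  exact (pow_left_inj₀ (norm_nonneg _) (by positivity) two_ne_zero).1 this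

/-- Left multiplication by a quaternion as a continuous linear map. -/
def qmulL (q : ℍ[ℝ]) : CH →L[ℝ] CH :=
  LinearMap.mkContinuous
    { toFun := qmul q
      map_add' := fun u v => by
        apply (WithLp.equiv 2 _).injective
        ext1 <;> simp [qmul, mul_add]
      map_smul' := fun c u => by
        apply (WithLp.equiv 2 _).injective
        ext1 <;> simp [qmul] } ‖q‖ fun u => (norm_qmul q u).le

@[simp] lemma qmulL_apply (q : ℍ[ℝ]) (u : CH) : qmulL q u = qmul q u := rfl

/-- Right multiplication by a quaternion. -/
def rmul (q : ℍ[ℝ]) (u : CH) : CH := WithLp.toLp 2 (u.fst * q, u.snd * q)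

lemma norm_rmul (q : ℍ[ℝ]) (u : CH) : ‖rmul q u‖ = ‖u‖ * ‖q‖ := by
  have : ‖rmul q u‖ ^ 2 = (‖u‖ * ‖q‖) ^ 2 := by
    rw [norm_sq_eq, mul_pow, norm_sq_eq u]
    change ‖u.fst * q‖ ^ 2 + ‖u.snd * q‖ ^ 2 = _
    simp only [norm_mul]
    ring
  exact (pow_left_inj₀ (norm_nonneg _) (by positivity) two_ne_zero).1 this

/-- Right multiplication by a quaternion as a continuous linear map. -/
def rmulL (q : ℍ[ℝ]) : CH →L[ℝ] CH :=
  LinearMap.mkContinuous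
    { toFun := rmul q
      map_add' := fun u v => by
        apply (WithLp.equiv 2 _).injective
        ext1 <;> simp [rmul, add_mul]
      map_smul' := fun c u => by
        apply (WithLp.equiv 2 _).injective
        ext1 <;> simp [rmul] } ‖q‖ fun u => by rw [mul_comm]; exact (norm_rmul q u).le

@[simp] lemma rmulL_apply (q : ℍ[ℝ]) (u : CH) : rmulL q u = rmul q u := rfl

lemma hInner_rmul (u v : CH) (q : ℍ[ℝ]) : hInner u (rmul q v) = hInner u v * q := by
  simp [hInner, rmul, add_mul, mul_assoc]

lemma norm_mulI (u : CH) : ‖mulI u‖ = ‖u‖ := by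
  have : ‖mulI u‖ ^ 2 = ‖u‖ ^ 2 := by
    rw [norm_sq_eq, norm_sq_eq u]
    change ‖-u.snd‖ ^ 2 + ‖u.fst‖ ^ 2 = _
    simp only [norm_neg]
    ring
  exact (pow_left_inj₀ (norm_nonneg _) (norm_nonneg _) two_ne_zero).1 this

lemma norm_mulI_iterate (n : ℕ) (u : CH) : ‖mulI^[n] u‖ = ‖u‖ := by
  induction n with
  | zero => rfl
  | succ n ih => rw [Function.iterate_succ_apply', norm_mulI, ih]

lemma continuous_mulI : Continuous mulI := by
  refine (WithLp.prod_continuous_toLp 2 _ _).comp ?_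
  exact (WithLp.sndL 2 ℝ _ _).continuous.neg.prodMk (WithLp.fstL 2 ℝ _ _).continuous

lemma continuous_mulI_iterate (n : ℕ) : Continuous (mulI^[n]) := continuous_mulI.iterate n

lemma norm_unitE (l : Fin 3) : ‖unitE l‖ = 1 := by
  have : ‖unitE l‖ ^ 2 = 1 ^ 2 := by
    rw [sq, ← Quaternion.normSq_eq_norm_mul_self, Quaternion.normSq_def']
    fin_cases l <;> simp [unitE]
  exact (pow_left_inj₀ (norm_nonneg _) zero_le_one two_ne_zero).1 this

lemma norm_qmul_unitE (l : Fin 3) (u : CH) : ‖qmul (unitE l) u‖ = ‖u‖ := by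
  rw [norm_qmul, norm_unitE, one_mul]

lemma re_unitE (l : Fin 3) : (unitE l).re = 0 := by fin_cases l <;> rfl

lemma imI_unitE (l : Fin 3) : (unitE l).imI = if l = 0 then 1 else 0 := by fin_cases l <;> rfl

lemma imJ_unitE (l : Fin 3) : (unitE l).imJ = if l = 1 then 1 else 0 := by fin_cases l <;> rfl

lemma imK_unitE (l : Fin 3) : (unitE l).imK = if l = 2 then 1 else 0 := by fin_cases l <;> rfl

lemma star_unitE (l : Fin 3) : star (unitE l) = - unitE l := by
  ext <;> simp [re_unitE]

lemma unitE_anticomm {l j : Fin 3} (h : l ≠ j) : unitE l * unitE j = - (unitE j * unitE l) := by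
  ext
  all_goals simp [re_unitE, imI_unitE, imJ_unitE, imK_unitE]
  all_goals fin_cases l <;> fin_cases j <;> simp at h ⊢

/-- The anticommutation of the imaginary units. -/
lemma inner_unitE_swap {l j : Fin 3} (h : l ≠ j) (u v : CH) :
    inner ℝ (qmul (unitE l) u) (qmul (unitE j) v) =
      - inner ℝ (qmul (unitE j) u) (qmul (unitE l) v) := by
  have key : ∀ p r : ℍ[ℝ], star (unitE l * p) * (unitE j * r) =
      - (star (unitE j * p) * (unitE l * r)) := fun p r => by
    rw [star_mul, star_mul, star_unitE, star_unitE]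
    simp only [mul_neg, neg_mul, mul_assoc]
    rw [← mul_assoc (unitE l), unitE_anticomm h]
    simp only [neg_mul, mul_neg, mul_assoc]
  simp only [← re_hInner]
  change (star (unitE l * u.fst) * (unitE j * v.fst) + star (unitE l * u.snd) *
    (unitE j * v.snd)).re = -(star (unitE j * u.fst) * (unitE l * v.fst) +
      star (unitE j * u.snd) * (unitE l * v.snd)).re
  rw [key, key, ← neg_add, Quaternion.re_neg]

lemma qmul_smul (q : ℍ[ℝ]) (c : ℝ) (u : CH) : qmul q (c • u) = c • qmul q u :=
  (qmulL q).map_smul c u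

/-- Choosing `r` as the conjugate of `p - q` produces `|p - q|² = 0`. This recovers quaternionic
equations from real ones. -/
lemma Quaternion.eq_of_re_mul_eq {p q : ℍ[ℝ]} (h : ∀ r : ℍ[ℝ], (p * r).re = (q * r).re) :
    p = q := by
  have h1 := h (star (p - q))
  rw [← sub_eq_zero, ← _root_.Quaternion.re_sub, ← sub_mul] at h1
  rw [_root_.Quaternion.self_mul_star] at h1
  simpa [sub_eq_zero] using h1

end Algebra

section Estimates

/-! ### Estimates for test functions -/

/-- Coefficients that differ by a bounded amount from constants, with derivatives dominated by the
weight, together with the weighted estimate for test functions. -/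
structure Admissible (m : ℕ) (Ω : Set E3) (φ : E3 → ℝ) (κ : ℝ) (a : Fin 3 → E3 → ℝ)
    (c : Fin 3 → ℝ) : Prop where
  isOpen : IsOpen Ω
  one_le : 1 ≤ κ
  weight_cont : ContinuousOn φ Ω
  weight_pos : ∀ x ∈ Ω, 0 < φ x
  contDiffOn : ∀ l, ContDiffOn ℝ m (a l) Ω
  osc : ∀ l, ∀ x ∈ Ω, |a l x - c l| ≤ κ
  deriv_le : ∀ j l t, 1 ≤ t → t ≤ m → ∀ x ∈ Ω, |pdIter l t (a j) x| ≤ κ * √(φ x)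
  deriv_le' : ∀ j l t, 1 ≤ t → t ≤ m → ∀ x ∈ Ω, |pdIter l t (a j) x| ≤ κ
  weighted : ∀ u : E3 → CH, IsTestFun Ω u → ∀ l t, t ≤ m →
    ∫ x, φ x * ‖pdIter l t u x‖ ^ 2 ≤ κ ^ 2 * pureNorm m u

/-- The sum `∑_l ‖a_l ∂_l^m u‖²`. -/
def coefNorm (m : ℕ) (Ω : Set E3) (a : Fin 3 → E3 → ℝ) (u : E3 → CH) : ℝ :=
  ∑ l, ∫ x in Ω, (a l x) ^ 2 * ‖pdIter l m u x‖ ^ 2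

lemma coefNorm_nonneg (m : ℕ) (Ω : Set E3) (a : Fin 3 → E3 → ℝ) (u : E3 → CH) :
    0 ≤ coefNorm m Ω a u :=
  Finset.sum_nonneg fun _ _ => integral_nonneg fun _ => by positivity

/-- The quantity that controls the lower order terms. -/
def errNorm (m : ℕ) (Ω : Set E3) (a : Fin 3 → E3 → ℝ) (u : E3 → CH) : ℝ :=
  √(coefNorm m Ω a u) * √(pureNorm m u) + pureNorm m u

lemma errNorm_nonneg (m : ℕ) (Ω : Set E3) (a : Fin 3 → E3 → ℝ) (u : E3 → CH) :
    0 ≤ errNorm m Ω a u :=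
  add_nonneg (by positivity) (pureNorm_nonneg m u)

/-- The weight that accompanies a derivative of order `t`. -/
def wt (φ : E3 → ℝ) (m t : ℕ) (x : E3) : ℝ := if t = m then 1 else √(φ x)

/-- The functions that dominate the integrands of the lower order terms. -/
def majorant (m : ℕ) (φ : E3 → ℝ) (κ : ℝ) (a : Fin 3 → E3 → ℝ) (u : E3 → CH) (l j : Fin 3) (t : ℕ)
    (x : E3) : ℝ :=
  (|a l x| + κ) * ‖pdIter l m u x‖ * (κ * wt φ m t x * ‖pdIter j t u x‖)

lemma integral_mul_le_sqrt {α : Type*} [MeasurableSpace α] {μ : Measure α} {f g : α → ℝ}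
    (hf : MemLp f 2 μ) (hg : MemLp g 2 μ) (hf0 : 0 ≤ᵐ[μ] f) (hg0 : 0 ≤ᵐ[μ] g) :
    ∫ x, f x * g x ∂μ ≤ √(∫ x, f x ^ 2 ∂μ) * √(∫ x, g x ^ 2 ∂μ) := by
  have h2 : ENNReal.ofReal 2 = 2 := by simp
  have := integral_mul_le_Lp_mul_Lq_of_nonneg Real.HolderConjugate.two_two hf0 hg0
    (h2 ▸ hf) (h2 ▸ hg)
  simpa [Real.sqrt_eq_rpow] using this

variable {m : ℕ} {Ω : Set E3} {φ : E3 → ℝ} {κ : ℝ} {a : Fin 3 → E3 → ℝ} {c : Fin 3 → ℝ}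
  {u : E3 → CH}

lemma IsTestFun.pdIter_eq_zero (hu : IsTestFun Ω u) (l : Fin 3) (t : ℕ) {x : E3} (hx : x ∉ Ω) :
    QuatOp.pdIter l t u x = 0 :=
  image_eq_zero_of_notMem_tsupport fun hx' => hx ((hu.pdIter l t).2.2 hx')

lemma continuous_mul_norm (hΩ : IsOpen Ω) {f : E3 → ℝ} (hf : ContinuousOn f Ω) {w : E3 → CH}
    (hw : IsTestFun Ω w) : Continuous (fun x => f x * ‖w x‖) ∧
      HasCompactSupport (fun x => f x * ‖w x‖) := by
  have hs : Function.support (fun x => ‖w x‖) ⊆ Function.support w := fun x hx h =>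
    hx (by simp [h])
  exact ⟨continuous_smul_of_tsupport hΩ hf hw.1.continuous.norm ((closure_mono hs).trans hw.2.2),
    hasCompactSupport_smul f (hw.2.1.mono hs)⟩

lemma Admissible.continuousOn_wt (H : Admissible m Ω φ κ a c) (t : ℕ) :
    ContinuousOn (wt φ m t) Ω := by
  unfold wt
  split_ifs
  · exact continuousOn_const
  · exact H.weight_cont.sqrt

lemma wt_nonneg (φ : E3 → ℝ) (m t : ℕ) (x : E3) : 0 ≤ wt φ m t x := by
  unfold wt; split_ifs <;> positivity

/-- At top order there is no weight and `κ ≥ 1` suffices; below it the bound is the iterated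
weighted Poincaré inequality. -/
lemma Admissible.integral_wt_le (H : Admissible m Ω φ κ a c) (hu : IsTestFun Ω u) (j : Fin 3)
    {t : ℕ} (ht : t ≤ m) :
    ∫ x in Ω, (wt φ m t x * ‖pdIter j t u x‖) ^ 2 ≤ κ ^ 2 * pureNorm m u := by
  by_cases htm : t = m
  · subst htm
    have h1 : ∫ x in Ω, (wt φ t t x * ‖pdIter j t u x‖) ^ 2 = ∫ x, ‖pdIter j t u x‖ ^ 2 := by
      simp only [wt, if_true, one_mul]
      exact setIntegral_eq_integral_of_forall_compl_eq_zero fun x hx => by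
        simp [hu.pdIter_eq_zero j t hx]
    rw [h1]
    refine (integral_pdIter_le_pureNorm t j u).trans ?_
    exact le_mul_of_one_le_left (pureNorm_nonneg t u) (one_le_pow₀ H.one_le)
  · have h1 : ∫ x in Ω, (wt φ m t x * ‖pdIter j t u x‖) ^ 2 =
        ∫ x in Ω, φ x * ‖pdIter j t u x‖ ^ 2 := by
      refine setIntegral_congr_fun H.isOpen.measurableSet fun x hx => ?_
      simp only [wt, if_neg htm]
      rw [mul_pow, Real.sq_sqrt (H.weight_pos x hx).le]
    rw [h1, setIntegral_eq_integral_of_forall_compl_eq_zero fun x hx => by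
        simp [hu.pdIter_eq_zero j t hx]]
    exact H.weighted u hu j t ht

lemma Admissible.integral_coef_le (H : Admissible m Ω φ κ a c) (hu : IsTestFun Ω u)
    (l : Fin 3) :
    ∫ x in Ω, ((|a l x| + κ) * ‖pdIter l m u x‖) ^ 2 ≤
      2 * coefNorm m Ω a u + 2 * κ ^ 2 * pureNorm m u := by
  have hw := hu.pdIter l m
  have hcont : ContinuousOn (a l) Ω := (H.contDiffOn l).continuousOn
  obtain ⟨hc1, hs1⟩ := continuous_mul_norm H.isOpen hcont.abs hw
  have hi1 : Integrable (fun x => (a l x) ^ 2 * ‖pdIter l m u x‖ ^ 2) := by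
    have := (hc1.memLp_of_hasCompactSupport (p := 2) (μ := volume) hs1).integrable_sq
    refine this.congr (Filter.Eventually.of_forall fun x => ?_)
    simp only [mul_pow, sq_abs]
  have hi2 : Integrable (fun x => ‖pdIter l m u x‖ ^ 2) := by
    simpa using (hw.memLp 2 volume).integrable_norm_pow (by norm_num)
  have h1 : ∫ x in Ω, ((|a l x| + κ) * ‖pdIter l m u x‖) ^ 2 ≤
      ∫ x in Ω, (2 * ((a l x) ^ 2 * ‖pdIter l m u x‖ ^ 2) +
        2 * κ ^ 2 * ‖pdIter l m u x‖ ^ 2) := by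
    refine integral_mono_of_nonneg (Filter.Eventually.of_forall fun x => by positivity)
      ((hi1.const_mul 2).add (hi2.const_mul (2 * κ ^ 2))).integrableOn
      (Filter.Eventually.of_forall fun x => ?_)
    have h2 : (|a l x| + κ) ^ 2 ≤ 2 * (a l x) ^ 2 + 2 * κ ^ 2 := by
      rw [← sq_abs (a l x)]; nlinarith [sq_nonneg (|a l x| - κ)]
    simp only [mul_pow]
    nlinarith [mul_le_mul_of_nonneg_right h2 (sq_nonneg ‖pdIter l m u x‖)]
  rw [integral_add (hi1.const_mul 2).integrableOn (hi2.const_mul (2 * κ ^ 2)).integrableOn,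
    integral_const_mul, integral_const_mul] at h1
  have h3 : ∫ x in Ω, (a l x) ^ 2 * ‖pdIter l m u x‖ ^ 2 ≤ coefNorm m Ω a u :=
    Finset.single_le_sum (f := fun l => ∫ x in Ω, (a l x) ^ 2 * ‖pdIter l m u x‖ ^ 2)
      (fun _ _ => integral_nonneg fun _ => by positivity) (Finset.mem_univ l)
  have h4 : ∫ x in Ω, ‖pdIter l m u x‖ ^ 2 ≤ pureNorm m u :=
    (setIntegral_le_integral hi2 (Filter.Eventually.of_forall fun x => by positivity)).trans
      (integral_pdIter_le_pureNorm m l u)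
  refine h1.trans (add_le_add ?_ ?_)
  · linarith
  · exact mul_le_mul_of_nonneg_left h4 (by positivity)

/-- Cauchy-Schwarz: the factor with `|a_l| + κ` has norm at most `2(√A + κ√D)`, the weighted factor
at most `κ²√D`. The coefficient must carry the index of its own top derivative, otherwise `A` could
not enter. -/
lemma Admissible.majorant_bound (H : Admissible m Ω φ κ a c) (hu : IsTestFun Ω u)
    (l j : Fin 3) {t : ℕ} (ht : t ≤ m) :
    IntegrableOn (majorant m φ κ a u l j t) Ω ∧
      ∫ x in Ω, majorant m φ κ a u l j t x ≤ 2 * κ ^ 3 * errNorm m Ω a u := by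
  have hκ := H.one_le
  have hcont : ContinuousOn (a l) Ω := (H.contDiffOn l).continuousOn
  obtain ⟨hc1, hs1⟩ := continuous_mul_norm H.isOpen (hcont.abs.add continuousOn_const)
    (hu.pdIter l m) (f := fun x => |a l x| + κ)
  obtain ⟨hc2, hs2⟩ := continuous_mul_norm H.isOpen
    (continuousOn_const.mul (H.continuousOn_wt t)) (hu.pdIter j t)
    (f := fun x => κ * wt φ m t x)
  have hL1 := (hc1.memLp_of_hasCompactSupport (p := 2) (μ := volume) hs1).restrict Ω
  have hL2 := (hc2.memLp_of_hasCompactSupport (p := 2) (μ := volume) hs2).restrict Ω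
  refine ⟨hL1.integrable_mul hL2, ?_⟩
  refine (integral_mul_le_sqrt hL1 hL2 (Filter.Eventually.of_forall fun x => by
    simp only [Pi.zero_apply]; positivity) (Filter.Eventually.of_forall fun x => by
    have := wt_nonneg φ m t x
    simp only [Pi.zero_apply]; positivity)).trans ?_
  set A := coefNorm m Ω a u with hA
  set D := pureNorm m u with hD
  have hA0 : 0 ≤ A := coefNorm_nonneg m Ω a u
  have hD0 : 0 ≤ D := pureNorm_nonneg m u
  have e1 : √(∫ x in Ω, ((|a l x| + κ) * ‖pdIter l m u x‖) ^ 2) ≤ 2 * (√A + κ * √D) := by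
    rw [Real.sqrt_le_left (by positivity)]
    refine (H.integral_coef_le hu l).trans ?_
    have s1 := Real.sq_sqrt hA0
    have s2 := Real.sq_sqrt hD0
    have s3 : 0 ≤ √A * (κ * √D) := by positivity
    have s4 : (κ * √D) ^ 2 = κ ^ 2 * D := by rw [mul_pow, s2]
    have s5 : 0 ≤ κ ^ 2 * D := by positivity
    nlinarith
  have e2 : √(∫ x in Ω, (κ * wt φ m t x * ‖pdIter j t u x‖) ^ 2) ≤ κ ^ 2 * √D := by
    rw [Real.sqrt_le_left (by positivity)]
    have : ∫ x in Ω, (κ * wt φ m t x * ‖pdIter j t u x‖) ^ 2 =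
        κ ^ 2 * ∫ x in Ω, (wt φ m t x * ‖pdIter j t u x‖) ^ 2 := by
      rw [← integral_const_mul]
      congr 1
      ext x
      ring
    rw [this, mul_pow, Real.sq_sqrt hD0]
    nlinarith [mul_le_mul_of_nonneg_left (H.integral_wt_le hu j ht) (sq_nonneg κ)]
  refine (mul_le_mul e1 e2 (Real.sqrt_nonneg _) (by positivity)).trans ?_
  have s2 := Real.mul_self_sqrt hD0
  have e3 : 2 * (√A + κ * √D) * (κ ^ 2 * √D) =
      2 * κ ^ 2 * (√A * √D) + 2 * κ ^ 3 * (√D * √D) := by ring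
  rw [e3, s2, errNorm, mul_add]
  have h23 : κ ^ 2 ≤ κ ^ 3 := pow_le_pow_right₀ hκ (by norm_num)
  have : 0 ≤ √A * √D := by positivity
  nlinarith

/-- Integrals of functions dominated by majorants. -/
lemma Admissible.abs_integral_le (H : Admissible m Ω φ κ a c) (hu : IsTestFun Ω u)
    {ι : Type*} (s : Finset ι) (N : ι → ℝ) (l j : ι → Fin 3) (t : ι → ℕ)
    (hN : ∀ i ∈ s, 0 ≤ N i) (ht : ∀ i ∈ s, t i ≤ m) {h : E3 → ℝ}
    (hh : ∀ x ∈ Ω, |h x| ≤ ∑ i ∈ s, N i * majorant m φ κ a u (l i) (j i) (t i) x) :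
    |∫ x in Ω, h x| ≤ (∑ i ∈ s, N i * (2 * κ ^ 3)) * errNorm m Ω a u := by
  have hi : ∀ i ∈ s, IntegrableOn
      (fun x => N i * majorant m φ κ a u (l i) (j i) (t i) x) Ω := fun i hi =>
    (H.majorant_bound hu (l i) (j i) (ht i hi)).1.const_mul _
  rw [← Real.norm_eq_abs]
  refine (norm_integral_le_of_norm_le (integrable_finsetSum s hi)
    (ae_restrict_of_forall_mem H.isOpen.measurableSet hh)).trans ?_
  rw [integral_finsetSum s hi, Finset.sum_mul]
  refine Finset.sum_le_sum fun i hi => ?_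
  rw [integral_const_mul, mul_assoc]
  exact mul_le_mul_of_nonneg_left (H.majorant_bound hu (l i) (j i) (ht i hi)).2 (hN i hi)

lemma Admissible.abs_integral_le_single (H : Admissible m Ω φ κ a c) (hu : IsTestFun Ω u)
    {N : ℝ} (hN : 0 ≤ N) (l j : Fin 3) {t : ℕ} (ht : t ≤ m) {h : E3 → ℝ}
    (hh : ∀ x ∈ Ω, |h x| ≤ N * majorant m φ κ a u l j t x) :
    |∫ x in Ω, h x| ≤ N * (2 * κ ^ 3) * errNorm m Ω a u := by
  simpa using H.abs_integral_le hu {()} (fun _ => N) (fun _ => l) (fun _ => j) (fun _ => t)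
    (fun _ _ => hN) (fun _ _ => ht) (h := h) (by simpa using hh)

lemma majorant_of_coef {N p : ℝ} {l j : Fin 3} {t : ℕ} {x : E3} {y z : CH}
    (hy : ‖y‖ ≤ ‖pdIter l m u x‖) (hz : ‖z‖ ≤ ‖pdIter j t u x‖)
    (hp : |p| ≤ N * ((|a l x| + κ) * (κ * wt φ m t x))) :
    |p| * ‖y‖ * ‖z‖ ≤ N * majorant m φ κ a u l j t x := by
  have hN : 0 ≤ N * ((|a l x| + κ) * (κ * wt φ m t x)) := (abs_nonneg _).trans hp
  calc |p| * ‖y‖ * ‖z‖ ≤ N * ((|a l x| + κ) * (κ * wt φ m t x)) * ‖pdIter l m u x‖ *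
        ‖pdIter j t u x‖ := by gcongr
    _ = _ := by unfold majorant; ring

lemma Admissible.abs_pdIter_le (H : Admissible m Ω φ κ a c) (j l : Fin 3) {t : ℕ} (ht : t ≤ m)
    {x : E3} (hx : x ∈ Ω) : |pdIter l t (a j) x| ≤ |a j x| + κ := by
  have hκ := H.one_le
  rcases Nat.eq_zero_or_pos t with rfl | h
  · simpa using by linarith
  · linarith [H.deriv_le' j l t h ht x hx, abs_nonneg (a j x)]

/-- The second coefficient is differentiated and supplies the `√φ` that a derivative of `u` of order
below `m` requires. -/
lemma Admissible.abs_mul_le (H : Admissible m Ω φ κ a c) (j l k n : Fin 3) {s t r : ℕ}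
    (hs : s ≤ m) (ht1 : 1 ≤ t) (ht : t ≤ m) (hr : r < m) {x : E3} (hx : x ∈ Ω) :
    |pdIter l s (a j) x * pdIter k t (a n) x| ≤ (|a j x| + κ) * (κ * wt φ m r x) := by
  rw [abs_mul, wt, if_neg hr.ne]
  have h1 := H.abs_pdIter_le j l hs hx
  have h2 := H.deriv_le n k t ht1 ht x hx
  exact mul_le_mul h1 h2 (abs_nonneg _) ((abs_nonneg _).trans h1)

lemma abs_sum_le_mul {ι : Type*} (s : Finset ι) {f k : ι → ℝ} {E : ℝ}
    (h : ∀ i ∈ s, |f i| ≤ k i * E) : |∑ i ∈ s, f i| ≤ (∑ i ∈ s, k i) * E := by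
  rw [Finset.sum_mul]
  exact (Finset.abs_sum_le_sum_abs _ _).trans (Finset.sum_le_sum h)

lemma abs_inner_smul_le (p : ℝ) (y z : CH) : |inner ℝ (p • y) z| ≤ |p| * ‖y‖ * ‖z‖ := by
  have := abs_real_inner_le_norm (p • y) z
  rwa [norm_smul, Real.norm_eq_abs] at this

/-- The derivatives of `a²` are dominated by the weight. -/
lemma Admissible.abs_pdIter_sq_le (H : Admissible m Ω φ κ a c) (l : Fin 3) {t r : ℕ}
    (ht1 : 1 ≤ t) (ht : t ≤ m) (hr : r < m) {x : E3} (hx : x ∈ Ω) :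
    |pdIter l t (fun y => (a l y) ^ 2) x| ≤
      2 ^ t * ((|a l x| + κ) * (κ * wt φ m r x)) := by
  have ht' : ((t : ℕ) : WithTop ℕ∞) ≤ (m : ℕ) := by exact_mod_cast ht
  have h1 := pdIter_smul H.isOpen l t ((H.contDiffOn l).of_le ht') ((H.contDiffOn l).of_le ht') hx
  simp only [smul_eq_mul, nsmul_eq_mul] at h1
  simp only [sq]
  rw [h1]
  refine (abs_sum_le_mul _ (k := fun p => (t.choose p.1 : ℝ))
    (E := (|a l x| + κ) * (κ * wt φ m r x)) fun p hp => ?_).trans (le_of_eq ?_)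
  · rw [Finset.HasAntidiagonal.mem_antidiagonal] at hp
    rw [abs_mul, Nat.abs_cast]
    refine mul_le_mul_of_nonneg_left ?_ (Nat.cast_nonneg _)
    -- In each Leibniz term at least one of the two factors is differentiated; that factor supplies
    -- the weight.
    rcases Nat.eq_zero_or_pos p.2 with h0 | h0
    · rw [mul_comm (pdIter l p.1 (a l) x)]
      exact H.abs_mul_le l l l l (by omega) (by omega) (by omega) hr hx
    · exact H.abs_mul_le l l l l (by omega) h0 (by omega) hr hx
  · congr 1
    have := Finset.Nat.sum_antidiagonal_eq_sum_range_succ (fun i _ => (t.choose i : ℝ)) t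
    rw [this, ← Nat.cast_sum, Nat.sum_range_choose]
    push_cast
    rfl

end Estimates

/-! ### The form and the norm of the operator on test functions. -/

section FormEstimates

open Finset in
/-- The real part of the form, for `Re s = 0`, as a function of `u`, `v` and their pure
derivatives. -/
def realForm (σ : ℝ) (m : ℕ) (Ω : Set E3) (a : Fin 3 → E3 → ℝ) (s : ℍ[ℝ]) (u v : E3 → CH)
    (f g : Fin 3 → ℕ → E3 → CH) : ℝ :=
  (∑ l, (∫ x in Ω, inner ℝ ((a l x) ^ 2 • f l m x) (g l m x)))
  + ‖s‖ ^ 2 * (∫ x in Ω, inner ℝ (u x) (v x))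
  + (∑ l, ∑ t ∈ (Finset.HasAntidiagonal.antidiagonal m).filter (fun t => t.2 ≤ m - 1),
      (m.choose t.1 : ℝ) *
        (∫ x in Ω, inner ℝ (pdIter l t.1 (fun y => (a l y) ^ 2) x • f l m x) (g l t.2 x)))
  + (∑ l, ∑ k ∈ Finset.Icc 1 m,
      ∑ t ∈ piAntidiag (univ : Finset (Fin 3)) (m - k),
        ((-1) ^ k * (m.choose k : ℝ) * (Nat.multinomial univ t : ℝ)) *
          (∫ x in Ω, inner ℝ ((pdIter l (t 0) (a l) x * pdIter l (t 1 + k) (a l) x) • f l m x)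
              (g l (t 2) x)))
  + σ * (∑ l, ∑ j ∈ Finset.Ioi l, ∑ k ∈ Finset.Icc 1 m,
      ∑ t ∈ piAntidiag (univ : Finset (Fin 3)) (m - k),
        ((-1) ^ k * (m.choose k : ℝ) * (Nat.multinomial univ t : ℝ)) *
          ((∫ x in Ω, inner ℝ (qmul (unitE l * unitE j)
                ((pdIter l (t 0) (a l) x * pdIter l (t 1 + k) (a j) x) • f j m x))
              (g l (t 2) x))
            - (∫ x in Ω, inner ℝ (qmul (unitE l * unitE j)
                ((pdIter j (t 0) (a j) x * pdIter j (t 1 + k) (a l) x) • f l m x))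
              (g j (t 2) x))))

variable {m : ℕ} {Ω : Set E3} {φ : E3 → ℝ} {κ : ℝ} {a : Fin 3 → E3 → ℝ} {c : Fin 3 → ℝ}
  {u : E3 → CH}

/-- The constant for the terms that contain derivatives of `a_l²`. -/
def constSq (m : ℕ) (κ : ℝ) : ℝ :=
  ∑ _l : Fin 3, ∑ t ∈ (Finset.HasAntidiagonal.antidiagonal m).filter (fun t => t.2 ≤ m - 1),
    (m.choose t.1 : ℝ) * (2 ^ t.1 * (2 * κ ^ 3))

lemma Admissible.term_sq_le (H : Admissible m Ω φ κ a c) (hm : 1 ≤ m) (hu : IsTestFun Ω u) :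
    |∑ l, ∑ t ∈ (Finset.HasAntidiagonal.antidiagonal m).filter (fun t => t.2 ≤ m - 1),
      (m.choose t.1 : ℝ) * (∫ x in Ω, inner ℝ (pdIter l t.1 (fun y => (a l y) ^ 2) x •
        pdIter l m u x) (pdIter l t.2 u x))| ≤ constSq m κ * errNorm m Ω a u := by
  refine abs_sum_le_mul _ fun l _ => abs_sum_le_mul _ fun t ht => ?_
  -- As `m ≥ 1`, the condition `t.2 ≤ m - 1` forces `t.1 ≥ 1`, so that `a_l²` is really
  -- differentiated.
  rw [Finset.mem_filter, Finset.HasAntidiagonal.mem_antidiagonal] at ht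
  rw [abs_mul, Nat.abs_cast, mul_assoc]
  refine mul_le_mul_of_nonneg_left ?_ (Nat.cast_nonneg _)
  refine H.abs_integral_le_single hu (by positivity) l l (t := t.2) (by omega) fun x hx => ?_
  exact (abs_inner_smul_le _ _ _).trans (majorant_of_coef le_rfl le_rfl
    (H.abs_pdIter_sq_le l (by omega) (by omega) (by omega) hx))

/-- The constant for the commutator terms in a single direction. -/
def constComm (m : ℕ) (κ : ℝ) : ℝ :=
  ∑ _l : Fin 3, ∑ k ∈ Finset.Icc 1 m,
    ∑ t ∈ Finset.piAntidiag (Finset.univ : Finset (Fin 3)) (m - k),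
      |(-1) ^ k * (m.choose k : ℝ) * (Nat.multinomial Finset.univ t : ℝ)| * (1 * (2 * κ ^ 3))

/-- Coefficient and top derivative belong to the same direction here, so the terms can be estimated
one by one. -/
lemma Admissible.term_comm_le (H : Admissible m Ω φ κ a c) (hu : IsTestFun Ω u) :
    |∑ l, ∑ k ∈ Finset.Icc 1 m, ∑ t ∈ Finset.piAntidiag (Finset.univ : Finset (Fin 3)) (m - k),
        ((-1) ^ k * (m.choose k : ℝ) * (Nat.multinomial Finset.univ t : ℝ)) *
          (∫ x in Ω, inner ℝ ((pdIter l (t 0) (a l) x * pdIter l (t 1 + k) (a l) x) •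
            pdIter l m u x) (pdIter l (t 2) u x))| ≤ constComm m κ * errNorm m Ω a u := by
  refine abs_sum_le_mul _ fun l _ => abs_sum_le_mul _ fun k hk => abs_sum_le_mul _ fun t ht => ?_
  rw [Finset.mem_Icc] at hk
  simp only [Finset.mem_piAntidiag, Fin.sum_univ_three] at ht
  rw [abs_mul]
  refine (mul_le_mul_of_nonneg_left ?_ (abs_nonneg _)).trans_eq (mul_assoc _ _ _).symm
  refine H.abs_integral_le_single hu zero_le_one l l (t := t 2) (by omega) fun x hx => ?_
  refine (abs_inner_smul_le _ _ _).trans (majorant_of_coef le_rfl le_rfl ?_)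
  rw [one_mul]
  exact H.abs_mul_le l l l l (by omega) (by omega) (by omega) (by omega) hx

lemma IsTestFun.contDiff_smul (hΩ : IsOpen Ω) (hu : IsTestFun Ω u) {n : ℕ} {f : E3 → ℝ}
    (hf : ContDiffOn ℝ n f Ω) : ContDiff ℝ n (fun x => f x • u x) ∧
      HasCompactSupport (fun x => f x • u x) ∧ tsupport (fun x => f x • u x) ⊆ Ω :=
  ⟨contDiff_smul_of_tsupport hΩ hf (contDiff_nat_of_top hu.1) hu.2.2,
    hasCompactSupport_smul f hu.2.1, (tsupport_smul_subset_right f u).trans hu.2.2⟩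

lemma continuous_pdIter {F : Type*} [NormedAddCommGroup F] [NormedSpace ℝ F] (l : Fin 3) {n : ℕ}
    {f : E3 → F} (hf : ContDiff ℝ n f) : Continuous (pdIter l n f) := by
  rw [← contDiffOn_univ] at hf
  rw [← continuousOn_univ]
  exact continuousOn_pdIter isOpen_univ l le_rfl hf

lemma integrable_inner_of_continuous {y z : E3 → CH} (hy : Continuous y) (hz : Continuous z)
    (hc : HasCompactSupport y) : Integrable (fun x => inner ℝ (y x) (z x)) :=
  (hy.inner hz).integrable_of_hasCompactSupport (hc.mono fun x hx h => hx (by simp [h]))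

/-- The constant for the commutator terms in two directions. -/
def constCross (m : ℕ) (κ : ℝ) : ℝ :=
  (∑ p ∈ Finset.HasAntidiagonal.antidiagonal m, (m.choose p.1 : ℝ) * (2 * κ ^ 3)) +
    ∑ t ∈ Finset.piAntidiag (Finset.univ : Finset (Fin 3)) m,
      (Nat.multinomial Finset.univ t : ℝ) * (2 * κ ^ 3)

lemma Admissible.osc_contDiffOn (H : Admissible m Ω φ κ a c) (j : Fin 3) :
    ContDiffOn ℝ m (fun y => a j y - c j) Ω := (H.contDiffOn j).sub contDiffOn_const

lemma Admissible.abs_pdIter_osc_le (H : Admissible m Ω φ κ a c) (j l : Fin 3) {t : ℕ}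
    (ht : t ≤ m) {x : E3} (hx : x ∈ Ω) : |pdIter l t (fun y => a j y - c j) x| ≤ κ := by
  rcases Nat.eq_zero_or_pos t with rfl | h
  · exact H.osc j x hx
  · rw [pdIter_sub_const l h]
    exact H.deriv_le' j l t h ht x hx

/-- If no derivative falls on the coefficients, then `r = m`, no weight is needed, and the
oscillation bound replaces a derivative bound. Otherwise a differentiated coefficient supplies the
weight. -/
lemma Admissible.abs_mul_osc_le (H : Admissible m Ω φ κ a c) (l j k : Fin 3) {s t r : ℕ}
    (hst : s + t + r = m) {x : E3} (hx : x ∈ Ω) :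
    |pdIter k s (a l) x * pdIter k t (fun y => a j y - c j) x| ≤
      1 * ((|a l x| + κ) * (κ * wt φ m r x)) := by
  have hκ := H.one_le
  rw [one_mul]
  rcases Nat.eq_zero_or_pos t with rfl | ht
  · rcases Nat.eq_zero_or_pos s with rfl | hs
    · have hr : r = m := by omega
      rw [wt, if_pos hr, mul_one, abs_mul]
      exact mul_le_mul (H.abs_pdIter_le l k (by omega) hx)
        (H.abs_pdIter_osc_le j k (by omega) hx) (abs_nonneg _)
        ((abs_nonneg _).trans (H.abs_pdIter_le l k (Nat.zero_le m) hx))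
    · have hr : r ≠ m := by omega
      rw [wt, if_neg hr, abs_mul, mul_comm]
      refine mul_le_mul ((H.abs_pdIter_osc_le j k (by omega) hx).trans ?_)
        (H.deriv_le l k s hs (by omega) x hx) (abs_nonneg _) (by positivity)
      linarith [abs_nonneg (a l x)]
  · rw [pdIter_sub_const k ht]
    exact H.abs_mul_le l k k j (by omega) ht (by omega) (by omega) hx

/-- In the Leibniz expansion of `∂_l^m(a_l u)`, an undifferentiated `a_l` meets `∂_l^m u`, its own
top derivative. In the other terms `a_l` is differentiated, hence small, and `∂_j^m u` can serve as
the top factor. The indices of the majorant are chosen accordingly. -/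
lemma Admissible.cross_first_le (H : Admissible m Ω φ κ a c) (hu : IsTestFun Ω u) {q : ℍ[ℝ]}
    (hq : ‖q‖ = 1) (l j : Fin 3) :
    |∫ x in Ω, inner ℝ (qmul q (pdIter j m u x))
      ((a j x - c j) • pdIter l m (fun y => a l y • u y) x)| ≤
      (∑ p ∈ Finset.HasAntidiagonal.antidiagonal m, (m.choose p.1 : ℝ) * (2 * κ ^ 3)) *
        errNorm m Ω a u := by
  have hκ := H.one_le
  refine H.abs_integral_le hu _ _ (fun p => if p.1 = 0 then l else j)
    (fun p => if p.1 = 0 then j else l) (fun p => p.2) (fun _ _ => Nat.cast_nonneg _)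
    (fun p hp => by rw [Finset.HasAntidiagonal.mem_antidiagonal] at hp; omega) fun x hx => ?_
  rw [pdIter_smul H.isOpen l m (H.contDiffOn l)
    (contDiff_nat_of_top hu.1).contDiffOn hx, Finset.smul_sum, inner_sum]
  refine (Finset.abs_sum_le_sum_abs _ _).trans (Finset.sum_le_sum fun p hp => ?_)
  rw [Finset.HasAntidiagonal.mem_antidiagonal] at hp
  have e : (a j x - c j) • m.choose p.1 • pdIter l p.1 (a l) x • pdIter l p.2 u x =
      (m.choose p.1 : ℝ) • ((pdIter l p.1 (a l) x * (a j x - c j)) • pdIter l p.2 u x) := by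
    rw [← Nat.cast_smul_eq_nsmul ℝ]
    module
  rw [e, inner_smul_right, abs_mul, Nat.abs_cast]
  refine mul_le_mul_of_nonneg_left ?_ (Nat.cast_nonneg _)
  rw [real_inner_comm]
  refine (abs_inner_smul_le _ _ _).trans ?_
  have hqn : ‖qmul q (pdIter j m u x)‖ = ‖pdIter j m u x‖ := by rw [norm_qmul, hq, one_mul]
  rw [hqn]
  have h1 := H.osc j x hx
  by_cases hp0 : p.1 = 0
  · have hp2 : p.2 = m := by omega
    rw [if_pos hp0, if_pos hp0, hp0, hp2, pdIter_zero]
    refine (majorant_of_coef (N := 1) le_rfl le_rfl ?_).trans (one_mul _).le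
    rw [wt, if_pos rfl, one_mul, mul_one, abs_mul]
    exact mul_le_mul (by linarith) h1 (abs_nonneg _) (by positivity)
  · have hp2 : p.2 ≠ m := by omega
    rw [if_neg hp0, if_neg hp0, mul_right_comm]
    refine (majorant_of_coef (N := 1) le_rfl le_rfl ?_).trans (one_mul _).le
    rw [wt, if_neg hp2, one_mul, abs_mul, mul_comm]
    exact mul_le_mul (h1.trans (by linarith [abs_nonneg (a j x)]))
      (H.deriv_le l l p.1 (by omega) (by omega) x hx) (abs_nonneg _) (by positivity)

/-- Estimated directly, this would pair `a_l` with `∂_j^m u`. Exchanging the two pure derivatives by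
parts pairs it with `∂_l^m u`. -/
lemma Admissible.cross_second_le (H : Admissible m Ω φ κ a c) (hu : IsTestFun Ω u) {q : ℍ[ℝ]}
    (hq : ‖q‖ = 1) (l j : Fin 3) :
    |∫ x in Ω, inner ℝ (qmul q (pdIter j m u x))
      (pdIter l m (fun y => (a l y * (a j y - c j)) • u y) x)| ≤
      (∑ t ∈ Finset.piAntidiag (Finset.univ : Finset (Fin 3)) m,
        (Nat.multinomial Finset.univ t : ℝ) * (2 * κ ^ 3)) * errNorm m Ω a u := by
  obtain ⟨hw1, hw2, -⟩ := hu.contDiff_smul H.isOpen ((H.contDiffOn l).mul (H.osc_contDiffOn j))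
  have hz : ∀ i k : Fin 3, ∀ x ∉ Ω, inner ℝ (qmul q (pdIter i m u x))
      (pdIter k m (fun y => (a l y * (a j y - c j)) • u y) x) = 0 := fun i k x hx => by
    rw [hu.pdIter_eq_zero i m hx, ← qmulL_apply, map_zero, inner_zero_left]
  have hswap := integral_bilin_pdIter_swap ((innerBilin CH).comp (qmulL q)) l j m hu.1 hw1 hw2
  simp only [ContinuousLinearMap.comp_apply, qmulL_apply, innerBilin_apply] at hswap
  rw [setIntegral_eq_integral_of_forall_compl_eq_zero fun x hx => hz j l x hx, hswap,
    ← setIntegral_eq_integral_of_forall_compl_eq_zero fun x hx => hz l j x hx]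
  refine H.abs_integral_le hu _ _ (fun _ => l) (fun _ => j) (fun t => t 2)
    (fun _ _ => Nat.cast_nonneg _) (fun t ht => by
      simp only [Finset.mem_piAntidiag, Fin.sum_univ_three] at ht; omega) fun x hx => ?_
  rw [pdIter_mul_smul H.isOpen j m (H.contDiffOn l) (H.osc_contDiffOn j)
    (contDiff_nat_of_top hu.1).contDiffOn hx, inner_sum]
  refine (Finset.abs_sum_le_sum_abs _ _).trans (Finset.sum_le_sum fun t ht => ?_)
  simp only [Finset.mem_piAntidiag, Fin.sum_univ_three] at ht
  rw [← Nat.cast_smul_eq_nsmul ℝ, inner_smul_right, abs_mul, Nat.abs_cast]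
  refine mul_le_mul_of_nonneg_left ?_ (Nat.cast_nonneg _)
  rw [inner_smul_right, ← real_inner_smul_left]
  refine (abs_inner_smul_le _ _ _).trans ((majorant_of_coef (N := 1) ?_ le_rfl
    (H.abs_mul_osc_le l j j (by omega) hx)).trans (one_mul _).le)
  rw [norm_qmul, hq, one_mul]

-- The terms are not estimated one by one but resummed by `commutator_sum`. The constant `c j` may
-- be subtracted because `k ≥ 1` derivatives always fall on `a j`.
open Finset in
lemma Admissible.cross_eq (H : Admissible m Ω φ κ a c) (hu : IsTestFun Ω u) (q : ℍ[ℝ])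
    (l j : Fin 3) :
    ∑ k ∈ Finset.Icc 1 m, ∑ t ∈ piAntidiag (univ : Finset (Fin 3)) (m - k),
      ((-1) ^ k * (m.choose k : ℝ) * (Nat.multinomial univ t : ℝ)) *
        (∫ x in Ω, inner ℝ (qmul q
          ((pdIter l (t 0) (a l) x * pdIter l (t 1 + k) (a j) x) • pdIter j m u x))
            (pdIter l (t 2) u x)) =
      (∫ x in Ω, inner ℝ (qmul q (pdIter j m u x))
        ((a j x - c j) • pdIter l m (fun y => a l y • u y) x)) -
      ∫ x in Ω, inner ℝ (qmul q (pdIter j m u x))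
        (pdIter l m (fun y => (a l y * (a j y - c j)) • u y) x) := by
  have hq : Continuous (fun x => qmul q (pdIter j m u x)) :=
    (qmulL q).continuous.comp (hu.pdIter j m).1.continuous
  have hqc : HasCompactSupport (fun x => qmul q (pdIter j m u x)) :=
    ((hu.pdIter j m).clm_comp (qmulL q)).2.1
  obtain ⟨hv1, hv2, hv3⟩ := hu.contDiff_smul H.isOpen (H.contDiffOn l)
  obtain ⟨hw1, hw2, -⟩ := hu.contDiff_smul H.isOpen ((H.contDiffOn l).mul (H.osc_contDiffOn j))
  have hi1 : Integrable (fun x => inner ℝ (qmul q (pdIter j m u x))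
      ((a j x - c j) • pdIter l m (fun y => a l y • u y) x)) :=
    integrable_inner_of_continuous hq (continuous_smul_of_tsupport H.isOpen
      (H.osc_contDiffOn j).continuousOn (continuous_pdIter l hv1)
      ((tsupport_pdIter_subset l m _).trans hv3)) hqc
  have hi2 : Integrable (fun x => inner ℝ (qmul q (pdIter j m u x))
      (pdIter l m (fun y => (a l y * (a j y - c j)) • u y) x)) :=
    integrable_inner_of_continuous hq (continuous_pdIter l hw1) hqc
  have hi : ∀ k ∈ Finset.Icc 1 m, ∀ t ∈ piAntidiag (univ : Finset (Fin 3)) (m - k),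
      IntegrableOn (fun x => ((-1) ^ k * (m.choose k : ℝ) * (Nat.multinomial univ t : ℝ)) *
        inner ℝ (qmul q
          ((pdIter l (t 0) (a l) x * pdIter l (t 1 + k) (a j) x) • pdIter j m u x))
            (pdIter l (t 2) u x)) Ω := by
    intro k hk t ht
    rw [Finset.mem_Icc] at hk
    simp only [Finset.mem_piAntidiag, Fin.sum_univ_three] at ht
    refine (Integrable.const_mul ?_ _).integrableOn
    have hc : ContinuousOn (fun x => pdIter l (t 0) (a l) x * pdIter l (t 1 + k) (a j) x) Ω :=
      (continuousOn_pdIter H.isOpen l (by omega) (H.contDiffOn l)).mul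
        (continuousOn_pdIter H.isOpen l (by omega) (H.contDiffOn j))
    refine integrable_inner_of_continuous ((qmulL q).continuous.comp
      (continuous_smul_of_tsupport H.isOpen hc (hu.pdIter j m).1.continuous
        (hu.pdIter j m).2.2)) (hu.pdIter l (t 2)).1.continuous ?_
    exact (hasCompactSupport_smul _ (hu.pdIter j m).2.1).comp_left (map_zero (qmulL q))
  rw [← integral_sub hi1.integrableOn hi2.integrableOn]
  simp_rw [← integral_const_mul]
  rw [Finset.sum_congr rfl fun k hk => (integral_finsetSum _ (hi k hk)).symm,
    ← integral_finsetSum _ fun k hk => integrable_finsetSum _ (hi k hk)]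
  refine setIntegral_congr_fun H.isOpen.measurableSet fun x hx => ?_
  rw [← inner_sub_right, ← commutator_sum H.isOpen l m (H.contDiffOn l) (H.osc_contDiffOn j)
    (contDiff_nat_of_top hu.1).contDiffOn hx, inner_sum]
  refine Finset.sum_congr rfl fun k hk => ?_
  rw [inner_sum]
  refine Finset.sum_congr rfl fun t _ => ?_
  rw [Finset.mem_Icc] at hk
  rw [pdIter_sub_const l (by omega), qmul_smul, inner_smul_right, inner_smul_right,
    real_inner_smul_left]

open Finset in
lemma Admissible.cross_le (H : Admissible m Ω φ κ a c) (hu : IsTestFun Ω u) {q : ℍ[ℝ]}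
    (hq : ‖q‖ = 1) (l j : Fin 3) :
    |∑ k ∈ Finset.Icc 1 m, ∑ t ∈ piAntidiag (univ : Finset (Fin 3)) (m - k),
      ((-1) ^ k * (m.choose k : ℝ) * (Nat.multinomial univ t : ℝ)) *
        (∫ x in Ω, inner ℝ (qmul q
          ((pdIter l (t 0) (a l) x * pdIter l (t 1 + k) (a j) x) • pdIter j m u x))
            (pdIter l (t 2) u x))| ≤ constCross m κ * errNorm m Ω a u := by
  rw [H.cross_eq hu q l j, constCross, add_mul]
  exact (abs_sub _ _).trans (add_le_add (H.cross_first_le hu hq l j) (H.cross_second_le hu hq l j))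

/-- The constant that bounds all lower order terms of the form. -/
def constForm (m : ℕ) (κ : ℝ) : ℝ :=
  constSq m κ + constComm m κ +
    ∑ l : Fin 3, ∑ _j ∈ Finset.Ioi l, (constCross m κ + constCross m κ)

lemma abs_sub_add_le_of_abs_le {A S X Y Z σ x y z : ℝ} (hσ : |σ| = 1) (hX : |X| ≤ x)
    (hY : |Y| ≤ y) (hZ : |Z| ≤ z) : |A + S + X + Y + σ * Z - (A + S)| ≤ x + y + z := by
  have hZ' : |σ * Z| ≤ z := by rwa [abs_mul, hσ, one_mul]
  rw [show A + S + X + Y + σ * Z - (A + S) = X + Y + σ * Z by ring]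
  exact (abs_add_three _ _ _).trans (by linarith)

lemma Admissible.realForm_le (H : Admissible m Ω φ κ a c) (hm : 1 ≤ m) (hu : IsTestFun Ω u)
    {σ : ℝ} (hσ : |σ| = 1) (s : ℍ[ℝ]) :
    |realForm σ m Ω a s u u (fun l t => pdIter l t u) (fun l t => pdIter l t u) -
      (coefNorm m Ω a u + ‖s‖ ^ 2 * ∫ x in Ω, ‖u x‖ ^ 2)| ≤
        constForm m κ * errNorm m Ω a u := by
  have h1 := H.term_sq_le hm hu
  have h2 := H.term_comm_le hu
  have hq : ∀ l j : Fin 3, ‖unitE l * unitE j‖ = 1 := fun l j => by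
    rw [norm_mul, norm_unitE, norm_unitE, one_mul]
  have h3 : |∑ l : Fin 3, ∑ j ∈ Finset.Ioi l, ∑ k ∈ Finset.Icc 1 m,
      ∑ t ∈ Finset.piAntidiag (Finset.univ : Finset (Fin 3)) (m - k),
        ((-1) ^ k * (m.choose k : ℝ) * (Nat.multinomial Finset.univ t : ℝ)) *
          ((∫ x in Ω, inner ℝ (qmul (unitE l * unitE j)
                ((pdIter l (t 0) (a l) x * pdIter l (t 1 + k) (a j) x) • pdIter j m u x))
              (pdIter l (t 2) u x))
            - (∫ x in Ω, inner ℝ (qmul (unitE l * unitE j)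
                ((pdIter j (t 0) (a j) x * pdIter j (t 1 + k) (a l) x) • pdIter l m u x))
              (pdIter j (t 2) u x)))| ≤
      (∑ l : Fin 3, ∑ _j ∈ Finset.Ioi l, (constCross m κ + constCross m κ)) *
        errNorm m Ω a u := by
    refine abs_sum_le_mul _ fun l _ => abs_sum_le_mul _ fun j _ => ?_
    simp_rw [mul_sub, Finset.sum_sub_distrib]
    rw [add_mul]
    -- The second integral is the first with `l` and `j` exchanged, except for the unit quaternion,
    -- whose value does not matter for the bound.
    exact (abs_sub _ _).trans (add_le_add (H.cross_le hu (hq l j) l j)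
      (H.cross_le hu (hq l j) j l))
  have e1 : ∑ l, (∫ x in Ω, inner ℝ ((a l x) ^ 2 • pdIter l m u x) (pdIter l m u x)) =
      coefNorm m Ω a u := by
    simp only [real_inner_smul_left, real_inner_self_eq_norm_sq, coefNorm]
  have e2 : ∫ x in Ω, inner ℝ (u x) (u x) = ∫ x in Ω, ‖u x‖ ^ 2 := by
    simp only [real_inner_self_eq_norm_sq]
  unfold realForm
  rw [e1, e2]
  rw [constForm, add_mul, add_mul]
  exact abs_sub_add_le_of_abs_le hσ h1 h2 h3

/-! ### The norm of the operator -/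

/-- Exchanging `∂_l^m` and `∂_j^m` by parts preserves the integral, whereas anticommutation of the
units reverses its sign. -/
lemma Admissible.integral_cross_eq_zero (hu : IsTestFun Ω u) {l j : Fin 3}
    (hlj : l ≠ j) : ∫ x in Ω, inner ℝ (qmul (unitE l) (pdIter l m u x))
      (qmul (unitE j) (pdIter j m u x)) = 0 := by
  rw [setIntegral_eq_integral_of_forall_compl_eq_zero fun x hx => by
    rw [hu.pdIter_eq_zero l m hx, ← qmulL_apply, map_zero, inner_zero_left]]
  have h := integral_bilin_pdIter_swap
    ((innerBilin CH).bilinearComp (qmulL (unitE l)) (qmulL (unitE j))) j l m hu.1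
    (contDiff_nat_of_top hu.1) hu.2.1
  simp only [ContinuousLinearMap.bilinearComp_apply, qmulL_apply, innerBilin_apply] at h
  have h2 : ∫ x, inner ℝ (qmul (unitE l) (pdIter j m u x)) (qmul (unitE j) (pdIter l m u x)) =
      - ∫ x, inner ℝ (qmul (unitE l) (pdIter l m u x)) (qmul (unitE j) (pdIter j m u x)) := by
    rw [← integral_neg]
    congr 1
    ext x
    rw [inner_unitE_swap hlj, real_inner_comm]
  linarith

/-- The integral with the constants `c_l c_j` in place of `a_l a_j` vanishes, so only the difference
`a_l a_j - c_l c_j` counts. -/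
lemma Admissible.integral_op_cross_le (H : Admissible m Ω φ κ a c) (hu : IsTestFun Ω u)
    {l j : Fin 3} (hlj : l ≠ j) :
    |∫ x in Ω, inner ℝ (a l x • qmul (unitE l) (pdIter l m u x))
      (a j x • qmul (unitE j) (pdIter j m u x))| ≤ (4 * κ ^ 3) * errNorm m Ω a u := by
  have hκ := H.one_le
  set y : Fin 3 → E3 → CH := fun l x => qmul (unitE l) (pdIter l m u x) with hy
  have hyc : ∀ l, Continuous (y l) := fun l =>
    (qmulL (unitE l)).continuous.comp (hu.pdIter l m).1.continuous
  have hyt : ∀ l, IsTestFun Ω (y l) := fun l => (hu.pdIter l m).clm_comp (qmulL (unitE l))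
  have hyn : ∀ l x, ‖y l x‖ = ‖pdIter l m u x‖ := fun l x => norm_qmul_unitE l _
  have hi0 : Integrable (fun x => inner ℝ (y l x) (y j x)) :=
    integrable_inner_of_continuous (hyc l) (hyc j) (hyt l).2.1
  have hi1 : Integrable (fun x => inner ℝ (a l x • y l x) (a j x • y j x)) :=
    integrable_inner_of_continuous
      (continuous_smul_of_tsupport H.isOpen (H.contDiffOn l).continuousOn (hyc l) (hyt l).2.2)
      (continuous_smul_of_tsupport H.isOpen (H.contDiffOn j).continuousOn (hyc j) (hyt j).2.2)
      (hasCompactSupport_smul _ (hyt l).2.1)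
  have e : ∫ x in Ω, inner ℝ (a l x • y l x) (a j x • y j x) =
      ∫ x in Ω, (inner ℝ (a l x • y l x) (a j x • y j x) -
        c l * c j * inner ℝ (y l x) (y j x)) := by
    rw [integral_sub hi1.integrableOn (hi0.const_mul _).integrableOn, integral_const_mul,
      Admissible.integral_cross_eq_zero hu hlj, mul_zero, sub_zero]
  rw [e]
  have key := H.abs_integral_le hu (Finset.univ : Finset (Fin 2)) (fun _ => (1 : ℝ)) ![l, j]
    ![j, l] (fun _ => m) (fun _ _ => zero_le_one) (fun _ _ => le_rfl)
    (h := fun x => inner ℝ (a l x • y l x) (a j x • y j x) -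
        c l * c j * inner ℝ (y l x) (y j x)) ?_
  · refine key.trans (le_of_eq ?_)
    simp only [Finset.sum_const, Finset.card_univ, Fintype.card_fin, nsmul_eq_mul]
    push_cast
    ring
  · intro x hx
    have hl := H.osc l x hx
    have hj := H.osc j x hx
    rw [real_inner_smul_left, inner_smul_right]
    -- This is `c_l (a_j - c_j) + a_j (a_l - c_l)`; writing `c_l = a_l - (a_l - c_l)` shows `|c_l| ≤
    -- |a_l| + κ`.
    have e2 : a l x * (a j x * inner ℝ (y l x) (y j x)) - c l * c j * inner ℝ (y l x) (y j x) =
        (a l x - (a l x - c l)) * (a j x - c j) * inner ℝ (y l x) (y j x) +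
          a j x * (a l x - c l) * inner ℝ (y l x) (y j x) := by ring
    rw [e2, Fin.sum_univ_two]
    refine (abs_add_le _ _).trans (add_le_add ?_ ?_)
    · rw [← real_inner_smul_left]
      refine (abs_inner_smul_le _ _ _).trans (majorant_of_coef (hyn l x).le (hyn j x).le ?_)
      simp only [wt, if_true, mul_one, one_mul, Matrix.cons_val_zero]
      rw [abs_mul]
      refine mul_le_mul ((abs_sub _ _).trans (by linarith)) hj (abs_nonneg _) (by positivity)
    · rw [real_inner_comm, ← real_inner_smul_left]
      refine (abs_inner_smul_le _ _ _).trans (majorant_of_coef (hyn j x).le (hyn l x).le ?_)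
      simp only [wt, if_true, mul_one, one_mul, Matrix.cons_val_one]
      rw [abs_mul]
      exact mul_le_mul (by simp; linarith) hl (abs_nonneg _) (by positivity)

/-- The integral of `|∑_l a_l e_l ∂_l^m u|²` is `∑_l ‖a_l ∂_l^m u‖²` up to lower order terms. -/
lemma Admissible.integral_op_le (H : Admissible m Ω φ κ a c) (hu : IsTestFun Ω u) :
    |(∫ x in Ω, ‖∑ l, a l x • qmul (unitE l) (pdIter l m u x)‖ ^ 2) - coefNorm m Ω a u| ≤
      (24 * κ ^ 3) * errNorm m Ω a u := by
  set y : Fin 3 → E3 → CH := fun l x => a l x • qmul (unitE l) (pdIter l m u x) with hy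
  have hyc : ∀ l, Continuous (y l) := fun l =>
    continuous_smul_of_tsupport H.isOpen (H.contDiffOn l).continuousOn
      ((qmulL (unitE l)).continuous.comp (hu.pdIter l m).1.continuous)
      ((hu.pdIter l m).clm_comp (qmulL (unitE l))).2.2
  have hys : ∀ l, HasCompactSupport (y l) := fun l =>
    hasCompactSupport_smul _ ((hu.pdIter l m).clm_comp (qmulL (unitE l))).2.1
  have hi : ∀ l j, IntegrableOn (fun x => inner ℝ (y l x) (y j x)) Ω := fun l j =>
    (integrable_inner_of_continuous (hyc l) (hyc j) (hys l)).integrableOn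
  have e1 : ∫ x in Ω, ‖∑ l, y l x‖ ^ 2 = ∑ l, ∑ j, ∫ x in Ω, inner ℝ (y l x) (y j x) := by
    rw [Finset.sum_congr rfl fun l _ => (integral_finsetSum _ fun j _ => hi l j).symm,
      ← integral_finsetSum _ fun l _ => integrable_finsetSum _ fun j _ => hi l j]
    congr 1
    ext x
    rw [← real_inner_self_eq_norm_sq, sum_inner]
    simp_rw [inner_sum]
  have e2 : coefNorm m Ω a u = ∑ l, ∫ x in Ω, inner ℝ (y l x) (y l x) := by
    unfold coefNorm
    refine Finset.sum_congr rfl fun l _ => ?_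
    congr 1
    ext x
    rw [real_inner_self_eq_norm_sq, hy]
    simp only [norm_smul, norm_qmul_unitE, mul_pow, Real.norm_eq_abs, sq_abs]
  have hc : ∀ l j, l ≠ j → |∫ x in Ω, inner ℝ (y l x) (y j x)| ≤ (4 * κ ^ 3) * errNorm m Ω a u :=
    fun l j hlj => H.integral_op_cross_le hu hlj
  have e3 : (∑ l, ∑ j, ∫ x in Ω, inner ℝ (y l x) (y j x)) -
      ∑ l, ∫ x in Ω, inner ℝ (y l x) (y l x) =
      ∑ l, ∑ j ∈ Finset.univ.erase l, ∫ x in Ω, inner ℝ (y l x) (y j x) := by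
    rw [← Finset.sum_sub_distrib]
    refine Finset.sum_congr rfl fun l _ => ?_
    rw [← Finset.add_sum_erase _ _ (Finset.mem_univ l)]
    ring
  rw [e1, e2, e3]
  -- There are six ordered pairs of distinct directions, hence `24 κ³`.
  refine (abs_sum_le_mul _ (k := fun l => ∑ _j ∈ Finset.univ.erase l, 4 * κ ^ 3) fun l _ =>
    abs_sum_le_mul _ fun j hj => hc l j (Finset.ne_of_mem_erase hj).symm).trans (le_of_eq ?_)
  simp
  left
  ring

end FormEstimates

section Sobolev

/-! ### Weak derivatives -/

variable {Ω : Set E3} {m : ℕ}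

lemma IsTestFun.integral_eq {F G : Type*} [NormedAddCommGroup F] [NormedSpace ℝ F]
    [NormedAddCommGroup G] [NormedSpace ℝ G] {ψ : E3 → F} (hψ : IsTestFun Ω ψ) {h : E3 → G}
    (hh : ∀ x, ψ x = 0 → h x = 0) : ∫ x in Ω, h x = ∫ x, h x :=
  setIntegral_eq_integral_of_forall_compl_eq_zero fun x hx =>
    hh x (image_eq_zero_of_notMem_tsupport fun h => hx (hψ.2.2 h))

/-- Integration against a real test function, as a continuous linear map on `L²`. -/
def testPairing (Ω : Set E3) {ψ : E3 → ℝ} (hψ : IsTestFun Ω ψ) : L2 Ω →L[ℝ] CH :=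
  (ContinuousLinearMap.lsmul ℝ ℝ).lpPairing (volume.restrict Ω) 2 2
    ((hψ.memLp 2 (volume.restrict Ω)).toLp ψ)

lemma testPairing_apply {ψ : E3 → ℝ} (hψ : IsTestFun Ω ψ) (u : L2 Ω) :
    testPairing Ω hψ u = ∫ x in Ω, ψ x • u x := by
  rw [testPairing, ContinuousLinearMap.lpPairing_eq_integral]
  refine integral_congr_ae ?_
  filter_upwards [(hψ.memLp 2 (volume.restrict Ω)).coeFn_toLp] with x hx
  simp [hx]

lemma isWeakDeriv_iff {b : Fin 3 → ℕ} {u w : L2 Ω} : IsWeakDeriv Ω b u w ↔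
    ∀ (ψ : E3 → ℝ) (hψ : IsTestFun Ω ψ), testPairing Ω (hψ.multiPd b) u =
      (-1 : ℝ) ^ (∑ i, b i) • testPairing Ω hψ w := by
  simp only [testPairing_apply]
  rfl

lemma IsWeakDeriv.sub {b : Fin 3 → ℕ} {u w u' w' : L2 Ω} (h : IsWeakDeriv Ω b u w)
    (h' : IsWeakDeriv Ω b u' w') : IsWeakDeriv Ω b (u - u') (w - w') := by
  rw [isWeakDeriv_iff] at *
  intro ψ hψ
  rw [map_sub, map_sub, h ψ hψ, h' ψ hψ, smul_sub]

lemma IsWeakDeriv.unique (hΩ : IsOpen Ω) {b : Fin 3 → ℕ} {u w w' : L2 Ω}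
    (h : IsWeakDeriv Ω b u w) (h' : IsWeakDeriv Ω b u w') : w = w' := by
  have h0 := h.sub h'
  rw [sub_self] at h0
  rw [← sub_eq_zero]
  have hloc : LocallyIntegrableOn (w - w' : L2 Ω) Ω volume := by
    have h1 : LocallyIntegrable (w - w' : L2 Ω) (volume.restrict Ω) :=
      (Lp.memLp (w - w')).locallyIntegrable (by norm_num)
    exact locallyIntegrableOn_of_locallyIntegrable_restrict h1
  have hae := hΩ.ae_eq_zero_of_integral_contDiff_smul_eq_zero hloc fun ψ h1 h2 h3 => by
    have hψ : IsTestFun Ω ψ := ⟨h1, h2, h3⟩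
    have h4 := h0 ψ hψ
    rw [← testPairing_apply (hψ.multiPd b), map_zero, eq_comm, smul_eq_zero] at h4
    have h5 := h4.resolve_left (pow_ne_zero _ (by norm_num))
    rwa [hψ.integral_eq fun x hx => by simp [hx]] at h5
  rw [Lp.eq_zero_iff_ae_eq_zero]
  exact (ae_restrict_iff' hΩ.measurableSet).2 hae

lemma weakDeriv_eq (hΩ : IsOpen Ω) {b : Fin 3 → ℕ} {u w : L2 Ω} (h : IsWeakDeriv Ω b u w) :
    weakDeriv Ω b u = w := by
  have hex : ∃ w : L2 Ω, IsWeakDeriv Ω b u w := ⟨w, h⟩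
  rw [weakDeriv, dif_pos hex]
  exact hex.choose_spec.unique hΩ h

/-- The class in `L²` of a test function. -/
def testLp (Ω : Set E3) {ψ : E3 → CH} (hψ : IsTestFun Ω ψ) : L2 Ω :=
  (hψ.memLp 2 (volume.restrict Ω)).toLp ψ

lemma coeFn_testLp {ψ : E3 → CH} (hψ : IsTestFun Ω ψ) :
    testLp Ω hψ =ᵐ[volume.restrict Ω] ψ := MemLp.coeFn_toLp _

lemma isWeakDeriv_testLp {ψ : E3 → CH} (hψ : IsTestFun Ω ψ) (b : Fin 3 → ℕ) :
    IsWeakDeriv Ω b (testLp Ω hψ) (testLp Ω (hψ.multiPd b)) := by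
  intro η hη
  have e1 : ∫ x in Ω, multiPd b η x • testLp Ω hψ x = ∫ x in Ω, multiPd b η x • ψ x := by
    refine integral_congr_ae ?_
    filter_upwards [coeFn_testLp hψ] with x hx
    rw [hx]
  have e2 : ∫ x in Ω, η x • testLp Ω (hψ.multiPd b) x = ∫ x in Ω, η x • multiPd b ψ x := by
    refine integral_congr_ae ?_
    filter_upwards [coeFn_testLp (hψ.multiPd b)] with x hx
    rw [hx]
  rw [e1, e2, (hη.multiPd b).integral_eq fun x hx => by simp [hx],
    hη.integral_eq fun x hx => by simp [hx]]
  exact integral_multiPd_smul b hη.1 hψ.1 hη.2.1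

/-! ### The space of jets -/

/-- The multi-indices of order at most `m`. -/
def multiIdx (m : ℕ) : Finset (Fin 3 → ℕ) :=
  (Finset.range (m + 1)).biUnion (Finset.piAntidiag (Finset.univ : Finset (Fin 3)))

lemma mem_multiIdx {b : Fin 3 → ℕ} : b ∈ multiIdx m ↔ ∑ i, b i ≤ m := by
  simp [multiIdx]

lemma zero_mem_multiIdx : (0 : Fin 3 → ℕ) ∈ multiIdx m := by simp [mem_multiIdx]

lemma single_mem_multiIdx {l : Fin 3} {t : ℕ} (ht : t ≤ m) :
    (Pi.single l t : Fin 3 → ℕ) ∈ multiIdx m := by simpa [mem_multiIdx] using ht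

/-- Families of `L²` functions indexed by the multi-indices of order at most `m`. -/
abbrev Jets (m : ℕ) (Ω : Set E3) : Type := PiLp 2 (fun _ : multiIdx m => L2 Ω)

/-- The component of a family at a multi-index, zero if its order exceeds `m`. -/
def comp (m : ℕ) (Ω : Set E3) (b : Fin 3 → ℕ) : Jets m Ω →L[ℝ] L2 Ω :=
  if h : b ∈ multiIdx m then PiLp.proj 2 (fun _ : multiIdx m => L2 Ω) ⟨b, h⟩ else 0

lemma comp_apply {b : Fin 3 → ℕ} (h : b ∈ multiIdx m) (U : Jets m Ω) :
    comp m Ω b U = U ⟨b, h⟩ := by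
  simp [comp, h]

lemma norm_jets_sq (U : Jets m Ω) : ‖U‖ ^ 2 = ∑ b ∈ multiIdx m, ‖comp m Ω b U‖ ^ 2 := by
  rw [PiLp.norm_sq_eq_of_L2, ← Finset.sum_coe_sort (multiIdx m)]
  exact Finset.sum_congr rfl fun b _ => by rw [comp_apply b.2]

/-- The jets of test functions. -/
def testJets (m : ℕ) (Ω : Set E3) : Submodule ℝ (Jets m Ω) where
  carrier := {U | ∃ (ψ : E3 → CH) (hψ : IsTestFun Ω ψ), ∀ b ∈ multiIdx m,
    comp m Ω b U = testLp Ω (hψ.multiPd b)}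
  zero_mem' := by
    have h0 : IsTestFun Ω (fun _ : E3 => (0 : CH)) :=
      ⟨contDiff_const, HasCompactSupport.zero, by simp [tsupport]⟩
    refine ⟨_, h0, fun b _ => ?_⟩
    rw [map_zero, eq_comm, Lp.eq_zero_iff_ae_eq_zero]
    filter_upwards [coeFn_testLp (h0.multiPd b)] with x hx
    have := congrFun (multiPd_clm_comp (0 : CH →L[ℝ] CH) b (f := fun _ => (0 : CH))
      contDiff_const) x
    simp only [zero_apply] at this
    rw [hx, this]
    rfl
  add_mem' := by
    rintro U W ⟨ψ, hψ, hU⟩ ⟨η, hη, hW⟩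
    refine ⟨_, hψ.add hη, fun b hb => ?_⟩
    rw [map_add, hU b hb, hW b hb]
    apply Lp.ext
    filter_upwards [coeFn_testLp ((hψ.add hη).multiPd b), coeFn_testLp (hψ.multiPd b),
      coeFn_testLp (hη.multiPd b),
      Lp.coeFn_add (testLp Ω (hψ.multiPd b)) (testLp Ω (hη.multiPd b))] with x h1 h2 h3 h4
    rw [h1, h4, Pi.add_apply, h2, h3, multiPd_add b hψ.1 hη.1]
    rfl
  smul_mem' := by
    rintro c U ⟨ψ, hψ, hU⟩
    refine ⟨_, hψ.clm_comp (c • ContinuousLinearMap.id ℝ CH), fun b hb => ?_⟩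
    rw [map_smul, hU b hb]
    apply Lp.ext
    filter_upwards [coeFn_testLp ((hψ.clm_comp (c • ContinuousLinearMap.id ℝ CH)).multiPd b),
      coeFn_testLp (hψ.multiPd b), Lp.coeFn_smul c (testLp Ω (hψ.multiPd b))] with x h1 h2 h3
    rw [h1, h3, Pi.smul_apply, h2, multiPd_clm_comp _ b hψ.1]
    rfl

/-- The jet of a test function. -/
def jet (m : ℕ) (Ω : Set E3) {ψ : E3 → CH} (hψ : IsTestFun Ω ψ) : Jets m Ω :=
  WithLp.toLp 2 fun b => testLp Ω (hψ.multiPd b)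

lemma comp_jet {ψ : E3 → CH} (hψ : IsTestFun Ω ψ) {b : Fin 3 → ℕ} (hb : b ∈ multiIdx m) :
    comp m Ω b (jet m Ω hψ) = testLp Ω (hψ.multiPd b) := by
  rw [comp_apply hb]; rfl

lemma jet_mem_testJets {ψ : E3 → CH} (hψ : IsTestFun Ω ψ) : jet m Ω hψ ∈ testJets m Ω :=
  ⟨ψ, hψ, fun _ hb => comp_jet hψ hb⟩

lemma mem_testJets {U : Jets m Ω} :
    U ∈ testJets m Ω ↔ ∃ (ψ : E3 → CH) (hψ : IsTestFun Ω ψ), U = jet m Ω hψ := by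
  constructor
  · rintro ⟨ψ, hψ, h⟩
    refine ⟨ψ, hψ, ?_⟩
    ext1 b
    have h1 := h b b.2
    rw [← comp_jet hψ b.2, comp_apply b.2, comp_apply b.2] at h1
    exact h1
  · rintro ⟨ψ, hψ, rfl⟩
    exact jet_mem_testJets hψ

/-- The jets of the functions in `H^m_0`. -/
def sobolevJets (m : ℕ) (Ω : Set E3) : Submodule ℝ (Jets m Ω) := (testJets m Ω).topologicalClosure

/-- A closed property of jets holds on `sobolevJets` if it holds for test functions. -/
lemma sobolevJets_induction {p : Jets m Ω → Prop} (hp : IsClosed {U | p U})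
    (h : ∀ (ψ : E3 → CH) (hψ : IsTestFun Ω ψ), p (jet m Ω hψ)) {U : Jets m Ω}
    (hU : U ∈ sobolevJets m Ω) : p U := by
  have hsub : (testJets m Ω : Set (Jets m Ω)) ⊆ {U | p U} := fun W hW => by
    obtain ⟨ψ, hψ, rfl⟩ := mem_testJets.1 hW
    exact h ψ hψ
  exact closure_minimal hsub hp hU

/-- Being a weak derivative is tested by continuous functionals, so it passes from test functions to
the closure. -/
lemma isWeakDeriv_of_mem {U : Jets m Ω} (hU : U ∈ sobolevJets m Ω) {b : Fin 3 → ℕ}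
    (hb : b ∈ multiIdx m) : IsWeakDeriv Ω b (comp m Ω 0 U) (comp m Ω b U) := by
  refine sobolevJets_induction (p := fun U => IsWeakDeriv Ω b (comp m Ω 0 U) (comp m Ω b U))
    ?_ ?_ hU
  · simp only [isWeakDeriv_iff, ofPred_forall]
    refine isClosed_iInter fun ψ => isClosed_iInter fun hψ => isClosed_eq ?_ ?_
    · fun_prop
    · fun_prop
  · intro ψ hψ
    rw [comp_jet hψ hb, comp_jet hψ zero_mem_multiIdx]
    exact isWeakDeriv_testLp hψ b

lemma weakDeriv_of_mem (hΩ : IsOpen Ω) {U : Jets m Ω} (hU : U ∈ sobolevJets m Ω)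
    {b : Fin 3 → ℕ} (hb : b ∈ multiIdx m) : weakDeriv Ω b (comp m Ω 0 U) = comp m Ω b U :=
  weakDeriv_eq hΩ (isWeakDeriv_of_mem hU hb)

lemma hNorm_eq (u : L2 Ω) : hNorm m Ω u = √(∑ b ∈ multiIdx m, ‖weakDeriv Ω b u‖ ^ 2) := by
  rw [hNorm, multiIdx, Finset.sum_biUnion]
  intro i _ j _ hij
  refine Finset.disjoint_left.2 fun b hi hj => hij ?_
  rw [← (Finset.mem_piAntidiag.1 hi).1, (Finset.mem_piAntidiag.1 hj).1]

lemma hNorm_of_mem (hΩ : IsOpen Ω) {U : Jets m Ω} (hU : U ∈ sobolevJets m Ω) :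
    hNorm m Ω (comp m Ω 0 U) = ‖U‖ := by
  rw [hNorm_eq, Finset.sum_congr rfl fun b hb => by rw [weakDeriv_of_mem hΩ hU hb],
    ← norm_jets_sq, Real.sqrt_sq (norm_nonneg _)]

lemma testJets_le : testJets m Ω ≤ sobolevJets m Ω := Submodule.le_topologicalClosure _

/-- The family of the weak derivatives of a function. -/
def weakJet (m : ℕ) (Ω : Set E3) (u : L2 Ω) : Jets m Ω :=
  WithLp.toLp 2 fun b => weakDeriv Ω b u

lemma comp_weakJet (u : L2 Ω) {b : Fin 3 → ℕ} (hb : b ∈ multiIdx m) :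
    comp m Ω b (weakJet m Ω u) = weakDeriv Ω b u := by
  rw [comp_apply hb]; rfl

/-- The choice in `weakDeriv` is compatible with differences only where weak derivatives exist, by
their uniqueness; this is where `MemH` enters. -/
lemma hNorm_sub_testLp (hΩ : IsOpen Ω) {u : L2 Ω} (hu : MemH m Ω u) {ψ : E3 → CH}
    (hψ : IsTestFun Ω ψ) : hNorm m Ω (u - testLp Ω hψ) = ‖weakJet m Ω u - jet m Ω hψ‖ := by
  rw [hNorm_eq, ← Real.sqrt_sq (norm_nonneg (weakJet m Ω u - jet m Ω hψ)), norm_jets_sq]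
  refine congrArg Real.sqrt (Finset.sum_congr rfl fun b hb => ?_)
  obtain ⟨w, hw⟩ := hu b (mem_multiIdx.1 hb)
  rw [map_sub, comp_weakJet u hb, comp_jet hψ hb, weakDeriv_eq hΩ hw,
    weakDeriv_eq hΩ (hw.sub (isWeakDeriv_testLp hψ b))]

lemma MemH0.weakJet_mem (hΩ : IsOpen Ω) {u : L2 Ω} (hu : MemH0 m Ω u) :
    weakJet m Ω u ∈ sobolevJets m Ω := by
  refine Metric.mem_closure_iff.2 fun ε hε => ?_
  obtain ⟨v, ⟨ψ, hψ, hv⟩, hlt⟩ := hu.2 ε hε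
  have hvt : v = testLp Ω hψ := Lp.ext (hv.trans (coeFn_testLp hψ).symm)
  refine ⟨jet m Ω hψ, jet_mem_testJets hψ, ?_⟩
  rwa [dist_eq_norm, ← hNorm_sub_testLp hΩ hu.1 hψ, ← hvt]

lemma weakDeriv_zero (hΩ : IsOpen Ω) (u : L2 Ω) : weakDeriv Ω 0 u = u :=
  weakDeriv_eq hΩ fun ψ _ => by
    have h : multiPd (0 : Fin 3 → ℕ) ψ = ψ := rfl
    simp [h]

lemma memH0_of_mem (hΩ : IsOpen Ω) {U : Jets m Ω} (hU : U ∈ sobolevJets m Ω) :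
    MemH0 m Ω (comp m Ω 0 U) := by
  refine ⟨fun b hb => ⟨_, isWeakDeriv_of_mem hU (mem_multiIdx.2 hb)⟩, fun ε hε => ?_⟩
  obtain ⟨W, hW, hlt⟩ := Metric.mem_closure_iff.1 hU ε hε
  obtain ⟨ψ, hψ, rfl⟩ := mem_testJets.1 hW
  refine ⟨testLp Ω hψ, ⟨ψ, hψ, coeFn_testLp hψ⟩, ?_⟩
  have h0 : testLp Ω hψ = comp m Ω 0 (jet m Ω hψ) := (comp_jet hψ zero_mem_multiIdx).symm
  rw [h0, ← map_sub, hNorm_of_mem hΩ (Submodule.sub_mem _ hU (testJets_le hW)), ← dist_eq_norm]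
  exact hlt

/-- The space `H^m_0` is the space of jets. -/
lemma memH0_iff (hΩ : IsOpen Ω) {u : L2 Ω} :
    MemH0 m Ω u ↔ ∃ U ∈ sobolevJets m Ω, comp m Ω 0 U = u := by
  constructor
  · intro hu
    exact ⟨weakJet m Ω u, hu.weakJet_mem hΩ, by
      rw [comp_weakJet u zero_mem_multiIdx, weakDeriv_zero hΩ]⟩
  · rintro ⟨U, hU, rfl⟩
    exact memH0_of_mem hΩ hU

lemma wd_of_mem (hΩ : IsOpen Ω) {U : Jets m Ω} (hU : U ∈ sobolevJets m Ω) (l : Fin 3) {t : ℕ}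
    (ht : t ≤ m) : wd Ω l t (comp m Ω 0 U) = comp m Ω (Pi.single l t) U :=
  weakDeriv_of_mem hΩ hU (single_mem_multiIdx ht)

/-! ### Right multiplication by quaternions -/

/-- Right multiplication by a quaternion on jets. -/
def rmulJets (m : ℕ) (Ω : Set E3) (q : ℍ[ℝ]) (U : Jets m Ω) : Jets m Ω :=
  WithLp.toLp 2 fun b => (rmulL q).compLpL 2 (volume.restrict Ω) (U b)

lemma comp_rmulJets (q : ℍ[ℝ]) (U : Jets m Ω) (b : Fin 3 → ℕ) :
    comp m Ω b (rmulJets m Ω q U) = (rmulL q).compLpL 2 (volume.restrict Ω) (comp m Ω b U) := by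
  by_cases hb : b ∈ multiIdx m
  · rw [comp_apply hb, comp_apply hb]; rfl
  · simp [comp, hb]

lemma continuous_rmulJets (q : ℍ[ℝ]) : Continuous (rmulJets m Ω q) := by
  unfold rmulJets
  refine (PiLp.continuous_toLp 2 _).comp (continuous_pi fun b => ?_)
  fun_prop

lemma rmulJets_mem (q : ℍ[ℝ]) {U : Jets m Ω} (hU : U ∈ sobolevJets m Ω) :
    rmulJets m Ω q U ∈ sobolevJets m Ω := by
  refine sobolevJets_induction (p := fun U => rmulJets m Ω q U ∈ sobolevJets m Ω)
    (IsClosed.preimage (continuous_rmulJets q) (Submodule.isClosed_topologicalClosure _)) ?_ hU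
  intro ψ hψ
  refine testJets_le ⟨_, hψ.clm_comp (rmulL q), fun b hb => ?_⟩
  rw [comp_rmulJets, comp_jet hψ hb]
  apply Lp.ext
  filter_upwards [coeFn_testLp ((hψ.clm_comp (rmulL q)).multiPd b), coeFn_testLp (hψ.multiPd b),
    (rmulL q).coeFn_compLpL (testLp Ω (hψ.multiPd b))] with x h1 h2 h3
  rw [h1, h3, h2, multiPd_clm_comp _ b hψ.1]

end Sobolev

section Operators

/-! ### Multiplication operators and pairings -/

variable {Ω : Set E3} {m : ℕ}

/-- Functions that are continuous and bounded on `Ω`. -/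
def IsCoef (Ω : Set E3) (c : E3 → ℝ) : Prop :=
  ContinuousOn c Ω ∧ ∃ B : ℝ, ∀ x ∈ Ω, |c x| ≤ B

lemma isCoef_const (k : ℝ) : IsCoef Ω fun _ => k := ⟨continuousOn_const, |k|, fun _ _ => le_rfl⟩

lemma IsCoef.mul {c d : E3 → ℝ} (hc : IsCoef Ω c) (hd : IsCoef Ω d) :
    IsCoef Ω fun x => c x * d x := by
  obtain ⟨hc, B, hB⟩ := hc
  obtain ⟨hd, D, hD⟩ := hd
  refine ⟨hc.mul hd, B * D, fun x hx => ?_⟩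
  rw [abs_mul]
  exact mul_le_mul (hB x hx) (hD x hx) (abs_nonneg _) ((abs_nonneg _).trans (hB x hx))

lemma IsCoef.add {c d : E3 → ℝ} (hc : IsCoef Ω c) (hd : IsCoef Ω d) :
    IsCoef Ω fun x => c x + d x := by
  obtain ⟨hc, B, hB⟩ := hc
  obtain ⟨hd, D, hD⟩ := hd
  exact ⟨hc.add hd, B + D, fun x hx =>
    (abs_add_le _ _).trans (add_le_add (hB x hx) (hD x hx))⟩

lemma IsCoef.sum {ι : Type*} {c : ι → E3 → ℝ} (s : Finset ι) (h : ∀ i ∈ s, IsCoef Ω (c i)) :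
    IsCoef Ω fun x => ∑ i ∈ s, c i x := by
  classical
  induction s using Finset.induction_on with
  | empty => simpa using isCoef_const 0
  | insert i s hi ih =>
    simp only [Finset.sum_insert hi]
    exact (h i (Finset.mem_insert_self i s)).add
      (ih fun j hj => h j (Finset.mem_insert_of_mem hj))

lemma IsCoef.congr {c d : E3 → ℝ} (hc : IsCoef Ω c) (h : EqOn d c Ω) : IsCoef Ω d :=
  ⟨hc.1.congr h, hc.2.imp fun B hB x hx => by rw [h hx]; exact hB x hx⟩

lemma IsCoef.memLp (hΩ : IsOpen Ω) {c : E3 → ℝ} (hc : IsCoef Ω c) :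
    MemLp c ⊤ (volume.restrict Ω) := by
  obtain ⟨hc, B, hB⟩ := hc
  refine memLp_top_of_bound (hc.aestronglyMeasurable hΩ.measurableSet) B ?_
  exact (ae_restrict_iff' hΩ.measurableSet).2 (Filter.Eventually.of_forall hB)

open Classical in
/-- Multiplication by a bounded function on `L²`, zero if the function is not bounded. -/
def mulOp (Ω : Set E3) (c : E3 → ℝ) : L2 Ω →L[ℝ] L2 Ω :=
  if h : MemLp c ⊤ (volume.restrict Ω) then
    (ContinuousLinearMap.lsmul ℝ ℝ).holderL (volume.restrict Ω) ⊤ 2 2 (h.toLp c)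
  else 0

lemma coeFn_mulOp (hΩ : IsOpen Ω) {c : E3 → ℝ} (hc : IsCoef Ω c) (u : L2 Ω) :
    mulOp Ω c u =ᵐ[volume.restrict Ω] fun x => c x • u x := by
  have h := hc.memLp hΩ
  rw [mulOp, dif_pos h, ContinuousLinearMap.holderL_apply_apply]
  filter_upwards [(ContinuousLinearMap.lsmul ℝ ℝ).coeFn_holder (r := 2) (h.toLp c) u,
    h.coeFn_toLp] with x h1 h2
  rw [h1, h2]
  rfl

/-- Left multiplication by a quaternion on `L²`. -/
def qmulOp (Ω : Set E3) (q : ℍ[ℝ]) : L2 Ω →L[ℝ] L2 Ω := (qmulL q).compLpL 2 (volume.restrict Ω)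

lemma coeFn_qmulOp (q : ℍ[ℝ]) (u : L2 Ω) :
    qmulOp Ω q u =ᵐ[volume.restrict Ω] fun x => qmul q (u x) :=
  (qmulL q).coeFn_compLpL u

/-- The `ℍ`-valued scalar product of `L²`. -/
def pairing (Ω : Set E3) : L2 Ω →L[ℝ] L2 Ω →L[ℝ] ℍ[ℝ] :=
  hInnerL.lpPairing (volume.restrict Ω) 2 2

lemma pairing_apply (u v : L2 Ω) : pairing Ω u v = ∫ x in Ω, hInner (u x) (v x) :=
  ContinuousLinearMap.lpPairing_eq_integral _ _ _

lemma integrable_hInner (u v : L2 Ω) :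
    Integrable (fun x => hInner (u x) (v x)) (volume.restrict Ω) :=
  memLp_one_iff_integrable.1 (hInnerL.memLp_of_bilin 1 (Lp.memLp u) (Lp.memLp v))

lemma pairing_rmul (u v : L2 Ω) (q : ℍ[ℝ]) :
    pairing Ω u ((rmulL q).compLpL 2 (volume.restrict Ω) v) = pairing Ω u v * q := by
  rw [pairing_apply, pairing_apply, ← integral_mul_const_of_integrable (integrable_hInner u v)]
  refine integral_congr_ae ?_
  filter_upwards [(rmulL q).coeFn_compLpL v] with x hx
  rw [hx, rmulL_apply, hInner_rmul]

/-- The real part, as a continuous linear map. -/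
def reL : ℍ[ℝ] →L[ℝ] ℝ := innerBilin ℍ[ℝ] 1

lemma reL_apply (q : ℍ[ℝ]) : reL q = q.re := by
  rw [reL, innerBilin_apply, Quaternion.inner_def]
  simp

lemma re_integral_hInner {f g : E3 → CH}
    (h : Integrable (fun x => hInner (f x) (g x)) (volume.restrict Ω)) :
    (∫ x in Ω, hInner (f x) (g x)).re = ∫ x in Ω, inner ℝ (f x) (g x) := by
  rw [← reL_apply, ← ContinuousLinearMap.integral_comp_comm _ h]
  simp only [reL_apply, re_hInner]

lemma re_pairing (u v : L2 Ω) : (pairing Ω u v).re = inner ℝ u v := by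
  rw [pairing_apply, re_integral_hInner (integrable_hInner u v), L2.inner_def]

/-! ### The form on jets -/

/-- The term `∫ ⟨q c ∂^b u, ∂^{b'} v⟩` of the form, on jets. -/
def formTerm (m : ℕ) (Ω : Set E3) (q : ℍ[ℝ]) (c : E3 → ℝ) (b b' : Fin 3 → ℕ) :
    Jets m Ω →L[ℝ] Jets m Ω →L[ℝ] ℍ[ℝ] :=
  (pairing Ω).bilinearComp (qmulOp Ω q ∘L mulOp Ω c ∘L comp m Ω b) (comp m Ω b')

lemma formTerm_eq_pairing (q : ℍ[ℝ]) (c : E3 → ℝ) (b b' : Fin 3 → ℕ) (U W : Jets m Ω) :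
    formTerm m Ω q c b b' U W =
      pairing Ω (qmulOp Ω q (mulOp Ω c (comp m Ω b U))) (comp m Ω b' W) := rfl

lemma formTerm_apply (hΩ : IsOpen Ω) {c : E3 → ℝ} (hc : IsCoef Ω c) (q : ℍ[ℝ])
    (b b' : Fin 3 → ℕ) (U W : Jets m Ω) : formTerm m Ω q c b b' U W =
      ∫ x in Ω, hInner (qmul q (c x • comp m Ω b U x)) (comp m Ω b' W x) := by
  rw [formTerm_eq_pairing, pairing_apply]
  refine integral_congr_ae ?_
  filter_upwards [coeFn_qmulOp q (mulOp Ω c (comp m Ω b U)), coeFn_mulOp hΩ hc (comp m Ω b U)]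
    with x h1 h2
  rw [h1, h2]

lemma formTerm_rmulJets (q : ℍ[ℝ]) (c : E3 → ℝ) (b b' : Fin 3 → ℕ) (U W : Jets m Ω) (p : ℍ[ℝ]) :
    formTerm m Ω q c b b' U (rmulJets m Ω p W) = formTerm m Ω q c b b' U W * p := by
  rw [formTerm_eq_pairing, formTerm_eq_pairing, comp_rmulJets, pairing_rmul]

/-- The sum with the structure of the form `b_s`, for a purely imaginary `s`, and arbitrary
terms in a vector space. -/
def formSum {X : Type*} [AddCommGroup X] [Module ℝ X] (σ : ℝ) (m : ℕ) (a : Fin 3 → E3 → ℝ)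
    (s : ℍ[ℝ]) (τ : ℍ[ℝ] → (E3 → ℝ) → (Fin 3 → ℕ) → (Fin 3 → ℕ) → X) : X :=
  (∑ l, τ 1 (fun x => (a l x) ^ 2) (Pi.single l m) (Pi.single l m))
  + ‖s‖ ^ 2 • τ 1 (fun _ => 1) 0 0
  + (∑ l, ∑ t ∈ (Finset.HasAntidiagonal.antidiagonal m).filter (fun t => t.2 ≤ m - 1),
      (m.choose t.1 : ℝ) •
        τ 1 (pdIter l t.1 (fun y => (a l y) ^ 2)) (Pi.single l m) (Pi.single l t.2))
  + (∑ l, ∑ k ∈ Finset.Icc 1 m,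
      ∑ t ∈ Finset.piAntidiag (Finset.univ : Finset (Fin 3)) (m - k),
        ((-1) ^ k * (m.choose k : ℝ) * (Nat.multinomial Finset.univ t : ℝ)) •
          τ 1 (fun x => pdIter l (t 0) (a l) x * pdIter l (t 1 + k) (a l) x)
            (Pi.single l m) (Pi.single l (t 2)))
  + σ • (∑ l, ∑ j ∈ Finset.Ioi l, ∑ k ∈ Finset.Icc 1 m,
      ∑ t ∈ Finset.piAntidiag (Finset.univ : Finset (Fin 3)) (m - k),
        ((-1) ^ k * (m.choose k : ℝ) * (Nat.multinomial Finset.univ t : ℝ)) •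
          (τ (unitE l * unitE j)
              (fun x => pdIter l (t 0) (a l) x * pdIter l (t 1 + k) (a j) x)
              (Pi.single j m) (Pi.single l (t 2))
            - τ (unitE l * unitE j)
              (fun x => pdIter j (t 0) (a j) x * pdIter j (t 1 + k) (a l) x)
              (Pi.single l m) (Pi.single j (t 2))))

variable {σ : ℝ} {a : Fin 3 → E3 → ℝ} {s : ℍ[ℝ]}

/-- Applied to evaluation, right multiplication and the real part, this carries the long sum between
its incarnations without expanding it. -/
lemma map_formSum {X Y : Type*} [AddCommGroup X] [Module ℝ X] [AddCommGroup Y] [Module ℝ Y]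
    (f : X →ₗ[ℝ] Y) (τ : ℍ[ℝ] → (E3 → ℝ) → (Fin 3 → ℕ) → (Fin 3 → ℕ) → X) :
    f (formSum σ m a s τ) = formSum σ m a s fun q c b b' => f (τ q c b b') := by
  simp only [formSum, map_add, map_sum, map_smul, map_sub]

/-- The derivatives up to order `m` of the coefficients of the operator and of their squares are
continuous and bounded. -/
structure BoundedCoefs (m : ℕ) (Ω : Set E3) (a : Fin 3 → E3 → ℝ) : Prop where
  deriv : ∀ j l t, t ≤ m → IsCoef Ω (pdIter l t (a j))
  deriv_sq : ∀ l t, t ≤ m → IsCoef Ω (pdIter l t fun y => (a l y) ^ 2)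

lemma BoundedCoefs.of_contDiffOn (hΩ : IsOpen Ω) (ha : ∀ l, ContDiffOn ℝ m (a l) Ω)
    (h : ∀ j l t, t ≤ m → ∃ B : ℝ, ∀ x ∈ Ω, |pdIter l t (a j) x| ≤ B) : BoundedCoefs m Ω a := by
  have hd : ∀ j l t, t ≤ m → IsCoef Ω (pdIter l t (a j)) := fun j l t ht =>
    ⟨continuousOn_pdIter hΩ l ht (ha j), h j l t ht⟩
  refine ⟨hd, fun l t ht => ?_⟩
  have hat : ContDiffOn ℝ t (a l) Ω := (ha l).of_le (by exact_mod_cast ht)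
  have hs : IsCoef Ω fun x => ∑ p ∈ Finset.HasAntidiagonal.antidiagonal t,
      (t.choose p.1 : ℝ) * (pdIter l p.1 (a l) x * pdIter l p.2 (a l) x) := by
    refine IsCoef.sum _ fun p hp => ?_
    rw [Finset.HasAntidiagonal.mem_antidiagonal] at hp
    exact (isCoef_const _).mul ((hd l l p.1 (by omega)).mul (hd l l p.2 (by omega)))
  refine hs.congr fun x hx => ?_
  have := pdIter_smul hΩ l t hat hat hx
  simp only [smul_eq_mul, nsmul_eq_mul] at this
  simp only [sq]
  exact this

lemma BoundedCoefs.coef (H : BoundedCoefs m Ω a) (l : Fin 3) : IsCoef Ω (a l) :=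
  H.deriv l l 0 (Nat.zero_le _)

/-- Only bounded coefficients and multi-indices of order at most `m` occur in the sum, so the
default values of `mulOp` and `comp` never matter. -/
lemma formSum_congr (H : BoundedCoefs m Ω a) {X : Type*} [AddCommGroup X] [Module ℝ X]
    {τ τ' : ℍ[ℝ] → (E3 → ℝ) → (Fin 3 → ℕ) → (Fin 3 → ℕ) → X}
    (h : ∀ q c b b', IsCoef Ω c → b ∈ multiIdx m → b' ∈ multiIdx m →
      τ q c b b' = τ' q c b b') : formSum σ m a s τ = formSum σ m a s τ' := by
  have hi : ∀ (l : Fin 3) {t : ℕ}, t ≤ m → (Pi.single l t : Fin 3 → ℕ) ∈ multiIdx m :=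
    fun l _ ht => single_mem_multiIdx ht
  have ht : ∀ {k : ℕ} {t : Fin 3 → ℕ}, k ∈ Finset.Icc 1 m →
      t ∈ Finset.piAntidiag (Finset.univ : Finset (Fin 3)) (m - k) →
      t 0 ≤ m ∧ t 1 + k ≤ m ∧ t 2 ≤ m := by
    intro k t hk ht
    rw [Finset.mem_Icc] at hk
    have := (Finset.mem_piAntidiag.1 ht).1
    rw [Fin.sum_univ_three] at this
    omega
  unfold formSum
  congr 1
  · congr 1
    · congr 1
      · congr 1
        · refine Finset.sum_congr rfl fun l _ => h _ _ _ _ (H.deriv_sq l 0 (Nat.zero_le _))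
            (hi l le_rfl) (hi l le_rfl)
        · rw [h _ _ _ _ (isCoef_const 1) zero_mem_multiIdx zero_mem_multiIdx]
      · refine Finset.sum_congr rfl fun l _ => Finset.sum_congr rfl fun t ht => ?_
        rw [Finset.mem_filter, Finset.HasAntidiagonal.mem_antidiagonal] at ht
        rw [h _ _ _ _ (H.deriv_sq l t.1 (by omega)) (hi l le_rfl) (hi l (by omega))]
    · refine Finset.sum_congr rfl fun l _ => Finset.sum_congr rfl fun k hk =>
        Finset.sum_congr rfl fun t htk => ?_
      obtain ⟨h0, h1, h2⟩ := ht hk htk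
      rw [h _ _ _ _ ((H.deriv l l _ h0).mul (H.deriv l l _ h1)) (hi l le_rfl) (hi l h2)]
  · congr 1
    refine Finset.sum_congr rfl fun l _ => Finset.sum_congr rfl fun j _ =>
      Finset.sum_congr rfl fun k hk => Finset.sum_congr rfl fun t htk => ?_
    obtain ⟨h0, h1, h2⟩ := ht hk htk
    rw [h _ _ _ _ ((H.deriv l l _ h0).mul (H.deriv j l _ h1)) (hi j le_rfl) (hi l h2),
      h _ _ _ _ ((H.deriv j j _ h0).mul (H.deriv l j _ h1)) (hi l le_rfl) (hi j h2)]

lemma qmul_one (u : CH) : qmul 1 u = u := by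
  apply (WithLp.equiv 2 _).injective
  ext1 <;> simp [qmul]

lemma bForm_eq_formSum (hΩ : IsOpen Ω) (hs : s.re = 0) (u v : L2 Ω) :
    bForm σ m Ω a s u v = formSum σ m a s fun q c b b' =>
      ∫ x in Ω, hInner (qmul q (c x • weakDeriv Ω b u x)) (weakDeriv Ω b' v x) := by
  simp only [bForm, formSum, hs, qmul_one, weakDeriv_zero hΩ, one_smul, mul_zero, zero_smul,
    sub_zero, wd]

lemma realForm_eq_formSum (u : E3 → CH) :
    realForm σ m Ω a s u u (fun l t => pdIter l t u) (fun l t => pdIter l t u) =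
      formSum σ m a s fun q c b b' =>
        ∫ x in Ω, inner ℝ (qmul q (c x • multiPd b u x)) (multiPd b' u x) := by
  simp only [realForm, formSum, qmul_one, multiPd_zero, multiPd_single, one_smul, smul_eq_mul]

/-- The form `b_s` on jets, for a purely imaginary `s`. -/
def jetForm (σ : ℝ) (m : ℕ) (Ω : Set E3) (a : Fin 3 → E3 → ℝ) (s : ℍ[ℝ]) :
    Jets m Ω →L[ℝ] Jets m Ω →L[ℝ] ℍ[ℝ] :=
  formSum σ m a s (formTerm m Ω)

lemma jetForm_apply (U W : Jets m Ω) : jetForm σ m Ω a s U W =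
    formSum σ m a s fun q c b b' => formTerm m Ω q c b b' U W :=
  map_formSum ({ toFun := fun B => B U W, map_add' := fun _ _ => rfl, map_smul' := fun _ _ => rfl } :
    (Jets m Ω →L[ℝ] Jets m Ω →L[ℝ] ℍ[ℝ]) →ₗ[ℝ] ℍ[ℝ]) (formTerm m Ω)

lemma jetForm_rmulJets (U W : Jets m Ω) (q : ℍ[ℝ]) :
    jetForm σ m Ω a s U (rmulJets m Ω q W) = jetForm σ m Ω a s U W * q := by
  rw [jetForm_apply, jetForm_apply]
  have := map_formSum (σ := σ) (m := m) (a := a) (s := s) (LinearMap.mulRight ℝ q)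
    fun p c b b' => formTerm m Ω p c b b' U W
  rw [LinearMap.mulRight_apply] at this
  rw [this]
  simp only [formTerm_rmulJets, LinearMap.mulRight_apply]

lemma bForm_eq_jetForm (hΩ : IsOpen Ω) (H : BoundedCoefs m Ω a) (hs : s.re = 0) {U W : Jets m Ω}
    (hU : U ∈ sobolevJets m Ω) (hW : W ∈ sobolevJets m Ω) :
    bForm σ m Ω a s (comp m Ω 0 U) (comp m Ω 0 W) = jetForm σ m Ω a s U W := by
  rw [bForm_eq_formSum hΩ hs, jetForm_apply]
  refine formSum_congr H fun q c b b' hc hb hb' => ?_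
  rw [formTerm_apply hΩ hc, weakDeriv_of_mem hΩ hU hb, weakDeriv_of_mem hΩ hW hb']

lemma re_jetForm_jet (hΩ : IsOpen Ω) (H : BoundedCoefs m Ω a) {ψ : E3 → CH}
    (hψ : IsTestFun Ω ψ) : (jetForm σ m Ω a s (jet m Ω hψ) (jet m Ω hψ)).re =
      realForm σ m Ω a s ψ ψ (fun l t => pdIter l t ψ) (fun l t => pdIter l t ψ) := by
  rw [realForm_eq_formSum, jetForm_apply, ← reL_apply]
  refine (map_formSum reL.toLinearMap _).trans (formSum_congr H fun q c b b' hc hb hb' => ?_)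
  change reL _ = _
  rw [reL_apply, formTerm_eq_pairing, re_pairing, L2.inner_def]
  refine integral_congr_ae ?_
  filter_upwards [coeFn_qmulOp q (mulOp Ω c (comp m Ω b (jet m Ω hψ))),
    coeFn_mulOp hΩ hc (comp m Ω b (jet m Ω hψ)), coeFn_testLp (hψ.multiPd b),
    coeFn_testLp (hψ.multiPd b')] with x h1 h2 h3 h4
  rw [h1, h2, comp_jet hψ hb, comp_jet hψ hb', h3, h4]

end Operators

section Solvability

/-! ### Coercivity -/

variable {Ω : Set E3} {m : ℕ} {φ : E3 → ℝ} {κ : ℝ} {a : Fin 3 → E3 → ℝ} {c : Fin 3 → ℝ}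
  {u : E3 → CH} {σ : ℝ} {s : ℍ[ℝ]}

/-- From `256 K² D ≤ A` one gets `K√D ≤ √A/16`, hence `K E ≤ A/16 + A/256`. This leaves room in `A`
for half of `T` and for `D`. -/
lemma le_of_error_le {A D E K R S T : ℝ} (hA : 0 ≤ A) (hD : 0 ≤ D) (hK : 1 ≤ K)
    (hE : E = √A * √D + D) (hAD : 256 * K ^ 2 * D ≤ A) (hR : |R - (A + S)| ≤ K * E)
    (hT : |T - A| ≤ K * E) : 1 / 2 * T + D + S ≤ R := by
  have h1 : 16 * K * √D ≤ √A := by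
    refine Real.le_sqrt_of_sq_le ?_
    rw [mul_pow, Real.sq_sqrt hD]
    linarith
  have h2 : K * (√A * √D) ≤ A / 16 := by
    have := mul_le_mul_of_nonneg_left h1 (Real.sqrt_nonneg A)
    rw [Real.mul_self_sqrt hA] at this
    linarith
  have hK2 : K ≤ K ^ 2 := by nlinarith
  have h4 : K * D ≤ A / 256 := by
    have := mul_le_mul_of_nonneg_right hK2 hD
    linarith
  have h3 : 256 * D ≤ A := by
    have := mul_le_mul_of_nonneg_right hK hD
    linarith
  have h5 : K * E ≤ A / 16 + A / 256 := by
    rw [hE, mul_add]; linarith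
  have h6 := (abs_le.1 hR).1
  have h7 := (abs_le.1 hT).2
  linarith

lemma Admissible.pureNorm_le (H : Admissible m Ω φ κ a c) (hu : IsTestFun Ω u) {k : ℝ}
    (hk : ∀ l, ∀ x ∈ Ω, k ≤ (a l x) ^ 2) : k * pureNorm m u ≤ coefNorm m Ω a u := by
  rw [pureNorm, coefNorm, Finset.mul_sum]
  refine Finset.sum_le_sum fun l _ => ?_
  have hl := hu.pdIter l m
  have hi : Integrable (fun x => ‖pdIter l m u x‖ ^ 2) (volume.restrict Ω) :=
    (hl.memLp 2 _).integrable_norm_pow (by norm_num)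
  have hc : Continuous fun x => a l x • pdIter l m u x :=
    continuous_smul_of_tsupport H.isOpen (H.contDiffOn l).continuousOn hl.1.continuous hl.2.2
  have hi' : Integrable (fun x => (a l x) ^ 2 * ‖pdIter l m u x‖ ^ 2) (volume.restrict Ω) := by
    have h2 : MemLp (fun x => a l x • pdIter l m u x) 2 (volume.restrict Ω) :=
      hc.memLp_of_hasCompactSupport (hasCompactSupport_smul _ hl.2.1)
    refine (h2.integrable_norm_pow (by norm_num)).congr (Filter.Eventually.of_forall fun x => ?_)
    simp only [norm_smul, mul_pow, Real.norm_eq_abs, sq_abs]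
  rw [← hl.integral_eq fun x hx => by simp [hx], ← integral_const_mul]
  refine setIntegral_mono_on (hi.const_mul k) hi' H.isOpen.measurableSet fun x hx => ?_
  exact mul_le_mul_of_nonneg_right (hk l x hx) (by positivity)

lemma Admissible.le_realForm (H : Admissible m Ω φ κ a c) (hm : 1 ≤ m) (hu : IsTestFun Ω u)
    (hσ : |σ| = 1) (s : ℍ[ℝ]) {K : ℝ} (hK : 1 ≤ K) (hK' : constForm m κ ≤ K)
    (hK'' : 24 * κ ^ 3 ≤ K) (ha : ∀ l, ∀ x ∈ Ω, 256 * K ^ 2 ≤ (a l x) ^ 2) :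
    1 / 2 * (∫ x in Ω, ‖∑ l, a l x • qmul (unitE l) (pdIter l m u x)‖ ^ 2) + pureNorm m u +
      ‖s‖ ^ 2 * ∫ x in Ω, ‖u x‖ ^ 2 ≤
        realForm σ m Ω a s u u (fun l t => pdIter l t u) (fun l t => pdIter l t u) :=
  le_of_error_le (coefNorm_nonneg m Ω a u) (pureNorm_nonneg m u) hK rfl (H.pureNorm_le hu ha)
    ((H.realForm_le hm hu hσ s).trans
      (mul_le_mul_of_nonneg_right hK' (errNorm_nonneg m Ω a u)))
    ((H.integral_op_le hu).trans (mul_le_mul_of_nonneg_right hK'' (errNorm_nonneg m Ω a u)))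

/-- The operator `∑_l a_l e_l ∂_l^m` on jets. -/
def opJet (m : ℕ) (Ω : Set E3) (a : Fin 3 → E3 → ℝ) : Jets m Ω →L[ℝ] L2 Ω :=
  ∑ l, mulOp Ω (a l) ∘L qmulOp Ω (unitE l) ∘L comp m Ω (Pi.single l m)

lemma coeFn_opJet (hΩ : IsOpen Ω) (H : BoundedCoefs m Ω a) (U : Jets m Ω) :
    opJet m Ω a U =ᵐ[volume.restrict Ω]
      fun x => ∑ l, a l x • qmul (unitE l) (comp m Ω (Pi.single l m) U x) := by
  have h1 : opJet m Ω a U =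
      ∑ l, mulOp Ω (a l) (qmulOp Ω (unitE l) (comp m Ω (Pi.single l m) U)) := by
    simp [opJet]
  rw [h1]
  filter_upwards [Lp.coeFn_finsetSum Finset.univ
      fun l => mulOp Ω (a l) (qmulOp Ω (unitE l) (comp m Ω (Pi.single l m) U)),
    Filter.eventually_all.2 fun l =>
      coeFn_mulOp hΩ (H.coef l) (qmulOp Ω (unitE l) (comp m Ω (Pi.single l m) U)),
    Filter.eventually_all.2 fun l => coeFn_qmulOp (unitE l) (comp m Ω (Pi.single l m) U)]
    with x h2 h3 h4
  rw [h2, Finset.sum_apply]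
  exact Finset.sum_congr rfl fun l _ => by rw [h3, h4]

lemma L2_norm_sq (u : L2 Ω) : ‖u‖ ^ 2 = ∫ x in Ω, ‖u x‖ ^ 2 := by
  rw [← real_inner_self_eq_norm_sq, L2.inner_def]
  simp only [real_inner_self_eq_norm_sq]

lemma norm_testLp_sq {ψ : E3 → CH} (hψ : IsTestFun Ω ψ) :
    ‖testLp Ω hψ‖ ^ 2 = ∫ x in Ω, ‖ψ x‖ ^ 2 := by
  rw [L2_norm_sq]
  refine integral_congr_ae ?_
  filter_upwards [coeFn_testLp hψ] with x hx
  rw [hx]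

lemma norm_comp_jet_sq {ψ : E3 → CH} (hψ : IsTestFun Ω ψ) {b : Fin 3 → ℕ} (hb : b ∈ multiIdx m) :
    ‖comp m Ω b (jet m Ω hψ)‖ ^ 2 = sqNorm b ψ := by
  rw [comp_jet hψ hb, norm_testLp_sq, (hψ.multiPd b).integral_eq fun x hx => by simp [hx]]
  rfl

/-- The pure derivatives of order `m` of a jet. -/
def pureJet (m : ℕ) (Ω : Set E3) (U : Jets m Ω) : ℝ := ∑ l, ‖comp m Ω (Pi.single l m) U‖ ^ 2

lemma pureJet_nonneg (U : Jets m Ω) : 0 ≤ pureJet m Ω U :=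
  Finset.sum_nonneg fun _ _ => by positivity

lemma continuous_pureJet : Continuous (pureJet m Ω) := by
  unfold pureJet
  fun_prop

lemma pureJet_jet {ψ : E3 → CH} (hψ : IsTestFun Ω ψ) :
    pureJet m Ω (jet m Ω hψ) = pureNorm m ψ := by
  refine Finset.sum_congr rfl fun l _ => ?_
  rw [norm_comp_jet_sq hψ (single_mem_multiIdx le_rfl), sqNorm, multiPd_single]

lemma norm_sq_le_pureJet {U : Jets m Ω} (hU : U ∈ sobolevJets m Ω) :
    ‖U‖ ^ 2 ≤ (multiIdx m).card * (‖comp m Ω 0 U‖ ^ 2 + pureJet m Ω U) := by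
  refine sobolevJets_induction
    (p := fun U => ‖U‖ ^ 2 ≤ (multiIdx m).card * (‖comp m Ω 0 U‖ ^ 2 + pureJet m Ω U)) ?_ ?_ hU
  · refine isClosed_le (by fun_prop) ?_
    have := continuous_pureJet (m := m) (Ω := Ω)
    fun_prop
  · intro ψ hψ
    rw [norm_jets_sq, ← nsmul_eq_mul]
    refine Finset.sum_le_card_nsmul _ _ _ fun b hb => ?_
    rw [norm_comp_jet_sq hψ hb, norm_comp_jet_sq hψ zero_mem_multiIdx, pureJet_jet]
    exact sqNorm_le_add hψ (mem_multiIdx.1 hb)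

/-- The lower bound for the form from which everything else follows. -/
def IsElliptic (σ : ℝ) (m : ℕ) (Ω : Set E3) (a : Fin 3 → E3 → ℝ) (s : ℍ[ℝ]) : Prop :=
  ∀ U ∈ sobolevJets m Ω, 1 / 2 * ‖opJet m Ω a U‖ ^ 2 + pureJet m Ω U +
    ‖s‖ ^ 2 * ‖comp m Ω 0 U‖ ^ 2 ≤ (jetForm σ m Ω a s U U).re

lemma Admissible.isElliptic (H : Admissible m Ω φ κ a c) (H' : BoundedCoefs m Ω a) (hm : 1 ≤ m)
    (hσ : |σ| = 1) (s : ℍ[ℝ]) {K : ℝ} (hK : 1 ≤ K) (hK' : constForm m κ ≤ K)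
    (hK'' : 24 * κ ^ 3 ≤ K) (ha : ∀ l, ∀ x ∈ Ω, 256 * K ^ 2 ≤ (a l x) ^ 2) :
    IsElliptic σ m Ω a s := by
  intro U hU
  rw [← reL_apply]
  refine sobolevJets_induction (p := fun U => 1 / 2 * ‖opJet m Ω a U‖ ^ 2 + pureJet m Ω U +
    ‖s‖ ^ 2 * ‖comp m Ω 0 U‖ ^ 2 ≤ reL (jetForm σ m Ω a s U U)) ?_ ?_ hU
  · refine isClosed_le ?_ (by fun_prop)
    have := continuous_pureJet (m := m) (Ω := Ω)
    fun_prop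
  · intro ψ hψ
    have h1 : ‖opJet m Ω a (jet m Ω hψ)‖ ^ 2 =
        ∫ x in Ω, ‖∑ l, a l x • qmul (unitE l) (pdIter l m ψ x)‖ ^ 2 := by
      rw [L2_norm_sq]
      refine integral_congr_ae ?_
      filter_upwards [coeFn_opJet H.isOpen H' (jet m Ω hψ),
        Filter.eventually_all.2 fun l => coeFn_testLp (hψ.multiPd (Pi.single l m))] with x h2 h3
      rw [h2]
      congr 2
      refine Finset.sum_congr rfl fun l _ => ?_
      rw [comp_jet hψ (single_mem_multiIdx le_rfl), h3, multiPd_single]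
    have h2 : ‖comp m Ω 0 (jet m Ω hψ)‖ ^ 2 = ∫ x in Ω, ‖ψ x‖ ^ 2 := by
      rw [comp_jet hψ zero_mem_multiIdx]
      exact norm_testLp_sq hψ
    rw [reL_apply, re_jetForm_jet H.isOpen H' hψ, h1, h2, pureJet_jet]
    exact H.le_realForm hm hψ hσ s hK hK' hK'' ha

lemma IsElliptic.norm_sq_le (h : IsElliptic σ m Ω a s) {U : Jets m Ω}
    (hU : U ∈ sobolevJets m Ω) :
    ‖s‖ ^ 2 * ‖comp m Ω 0 U‖ ^ 2 ≤ (jetForm σ m Ω a s U U).re := by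
  have h1 := h U hU
  have h2 := pureJet_nonneg U
  have h3 : 0 ≤ ‖opJet m Ω a U‖ ^ 2 := sq_nonneg _
  linarith

lemma IsElliptic.norm_opJet_sq_le (h : IsElliptic σ m Ω a s) {U : Jets m Ω}
    (hU : U ∈ sobolevJets m Ω) :
    1 / 2 * ‖opJet m Ω a U‖ ^ 2 ≤ (jetForm σ m Ω a s U U).re := by
  have h1 := h U hU
  have h2 := pureJet_nonneg U
  have h3 : 0 ≤ ‖s‖ ^ 2 * ‖comp m Ω 0 U‖ ^ 2 := by positivity
  linarith

/-- Together `‖u‖` and the pure derivatives of order `m` control the full norm of `H^m`. The control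
of `‖u‖` comes from `|s|²` alone, so the constant depends on `s`. -/
lemma IsElliptic.coercive (h : IsElliptic σ m Ω a s) (hs : s ≠ 0) :
    ∃ k : ℝ, 0 < k ∧ ∀ U ∈ sobolevJets m Ω, k * ‖U‖ * ‖U‖ ≤ (jetForm σ m Ω a s U U).re := by
  have hs' : 0 < ‖s‖ ^ 2 := by positivity
  have hc : (0 : ℝ) < (multiIdx m).card := by
    exact_mod_cast Finset.card_pos.2 ⟨0, zero_mem_multiIdx⟩
  have hmin : 0 < min 1 (‖s‖ ^ 2) := lt_min one_pos hs'
  refine ⟨min 1 (‖s‖ ^ 2) / (multiIdx m).card, div_pos hmin hc, fun U hU => ?_⟩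
  have h1 := h U hU
  have h2 := pureJet_nonneg U
  have h3 : 0 ≤ ‖opJet m Ω a U‖ ^ 2 := sq_nonneg _
  have h4 := norm_sq_le_pureJet hU
  have h5 : 0 ≤ ‖comp m Ω 0 U‖ ^ 2 := sq_nonneg _
  have h6 := mul_le_mul_of_nonneg_left h4 (div_pos hmin hc).le
  have h7 := mul_le_mul_of_nonneg_right (min_le_right 1 (‖s‖ ^ 2)) h5
  have h8 := mul_le_mul_of_nonneg_right (min_le_left 1 (‖s‖ ^ 2)) h2
  rw [← mul_assoc, div_mul_cancel₀ _ hc.ne', mul_add] at h6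
  rw [mul_assoc, ← sq]
  linarith

/-! ### Weak solutions -/

/-- The Lax-Milgram theorem on `sobolevJets`. -/
lemma IsElliptic.exists_jet (h : IsElliptic σ m Ω a s) (hs : s ≠ 0) (F : L2 Ω) :
    ∃ U ∈ sobolevJets m Ω, ∀ W ∈ sobolevJets m Ω,
      jetForm σ m Ω a s U W = pairing Ω F (comp m Ω 0 W) := by
  obtain ⟨k, hk, hco⟩ := h.coercive hs
  have : CompleteSpace (sobolevJets m Ω) :=
    (Submodule.isClosed_topologicalClosure (testJets m Ω)).completeSpace_coe
  let ι : sobolevJets m Ω →L[ℝ] Jets m Ω := (sobolevJets m Ω).subtypeL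
  let B : sobolevJets m Ω →L[ℝ] sobolevJets m Ω →L[ℝ] ℝ :=
    -- Lax-Milgram is applied to the real part of the form, on the closed real subspace of jets.
    reL.postcomp (sobolevJets m Ω) ∘L (jetForm σ m Ω a s).bilinearComp ι ι
  have hB : ∀ U W, B U W = (jetForm σ m Ω a s (U : Jets m Ω) W).re := fun U W => reL_apply _
  have hcoer : IsCoercive B := ⟨k, hk, fun U => by rw [hB]; exact hco U U.2⟩
  let f : sobolevJets m Ω →L[ℝ] ℝ := reL ∘L pairing Ω F ∘L comp m Ω 0 ∘L ι
  let R := (InnerProductSpace.toDual ℝ (sobolevJets m Ω)).symm f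
  let U := hcoer.continuousLinearEquivOfBilin.symm R
  have hU : ∀ W, B U W = f W := fun W => by
    rw [← hcoer.continuousLinearEquivOfBilin_apply, ContinuousLinearEquiv.apply_symm_apply]
    exact InnerProductSpace.toDual_symm_apply
  -- The real equation is tested with all right multiples `W q`. Both sides are right `ℍ`-linear in
  -- the second argument and the space is stable under such multiples, so the quaternionic equation
  -- follows.
  refine ⟨U, U.2, fun W hW => Quaternion.eq_of_re_mul_eq fun q => ?_⟩
  have h1 := hU ⟨rmulJets m Ω q W, rmulJets_mem q hW⟩
  rw [hB] at h1
  have h2 : f ⟨rmulJets m Ω q W, rmulJets_mem q hW⟩ =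
      (pairing Ω F (comp m Ω 0 (rmulJets m Ω q W))).re := reL_apply _
  rw [h2, comp_rmulJets, pairing_rmul] at h1
  rw [← h1]
  change _ = (jetForm σ m Ω a s (U : Jets m Ω) (rmulJets m Ω q W)).re
  rw [jetForm_rmulJets]

lemma IsElliptic.existsUnique (h : IsElliptic σ m Ω a s) (hΩ : IsOpen Ω)
    (H : BoundedCoefs m Ω a) (hs : s ≠ 0) (hre : s.re = 0) (F : L2 Ω) :
    ∃! u : L2 Ω, IsWeakSolution σ m Ω a s F u := by
  obtain ⟨U, hU, hUF⟩ := h.exists_jet hs F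
  refine ⟨comp m Ω 0 U, ⟨memH0_of_mem hΩ hU, fun v hv => ?_⟩, fun u hu => ?_⟩
  · obtain ⟨W, hW, rfl⟩ := (memH0_iff hΩ).1 hv
    rw [bForm_eq_jetForm hΩ H hre hU hW, hUF W hW, pairing_apply]
  · obtain ⟨hu, huF⟩ := hu
    obtain ⟨V, hV, rfl⟩ := (memH0_iff hΩ).1 hu
    have hVU : V - U ∈ sobolevJets m Ω := Submodule.sub_mem _ hV hU
    have h1 := huF _ (memH0_of_mem hΩ hVU)
    rw [bForm_eq_jetForm hΩ H hre hV hVU, ← pairing_apply] at h1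
    have h2 : jetForm σ m Ω a s (V - U) (V - U) = 0 := by
      rw [map_sub (jetForm σ m Ω a s), sub_apply, h1, hUF _ hVU, sub_self]
    have h3 := h.norm_sq_le hVU
    rw [h2, Quaternion.re_zero] at h3
    have h4 : 0 < ‖s‖ ^ 2 := by positivity
    have h5 : ‖comp m Ω 0 (V - U)‖ ^ 2 = 0 :=
      le_antisymm (nonpos_of_mul_nonpos_right h3 h4) (by positivity)
    rw [sq_eq_zero_iff, norm_eq_zero, map_sub, sub_eq_zero] at h5
    exact h5

lemma opT_ae_eq (hΩ : IsOpen Ω) (H : BoundedCoefs m Ω a) {U : Jets m Ω}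
    (hU : U ∈ sobolevJets m Ω) : opT m Ω a (comp m Ω 0 U) =ᵐ[volume.restrict Ω]
      fun x => mulI^[m - 1] (opJet m Ω a U x) := by
  filter_upwards [coeFn_opJet hΩ H U] with x hx
  simp only [opT, hx, wd_of_mem hΩ hU _ le_rfl]

lemma memLp_opT (hΩ : IsOpen Ω) (H : BoundedCoefs m Ω a) {U : Jets m Ω}
    (hU : U ∈ sobolevJets m Ω) : MemLp (opT m Ω a (comp m Ω 0 U)) 2 (volume.restrict Ω) := by
  refine MemLp.ae_eq (opT_ae_eq hΩ H hU).symm ?_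
  refine (Lp.memLp (opJet m Ω a U)).of_le
    ((continuous_mulI_iterate _).comp_aestronglyMeasurable (Lp.aestronglyMeasurable _)) ?_
  exact Filter.Eventually.of_forall fun x => (norm_mulI_iterate _ _).le

lemma integral_norm_opT_sq (hΩ : IsOpen Ω) (H : BoundedCoefs m Ω a) {U : Jets m Ω}
    (hU : U ∈ sobolevJets m Ω) :
    ∫ x in Ω, ‖opT m Ω a (comp m Ω 0 U) x‖ ^ 2 = ‖opJet m Ω a U‖ ^ 2 := by
  rw [L2_norm_sq]
  refine integral_congr_ae ?_
  filter_upwards [opT_ae_eq hΩ H hU] with x hx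
  rw [hx, norm_mulI_iterate]

end Solvability

section Conclusion

/-! ### The constants -/

variable {Ω : Set E3} {m : ℕ} {φ : E3 → ℝ} {lam B C : ℝ} {ν : E3 → E3} {a : Fin 3 → E3 → ℝ}

/-- A bound for the oscillation and the derivatives of the coefficients, and for the constants of
the weighted inequalities. -/
def weightConst (m : ℕ) (lam B C : ℝ) : ℝ :=
  1 + √C + √(C * B) + 12 * √(C * B) / lam + (1 + 12 / lam ^ 2) ^ m * B

lemma DecayField.admissible (h : DecayField Ω φ lam ν) (hΩ : IsOpen Ω) (hconn : IsConnected Ω)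
    (hm : 1 ≤ m) (hlam : 0 < lam) (hφ : ContDiffOn ℝ 1 φ Ω) (hpos : ∀ x ∈ Ω, 0 < φ x)
    (hB0 : 0 ≤ B) (hB : ∀ x ∈ Ω, φ x ≤ B) (hC : 0 < C) (ha : ∀ l, ContDiffOn ℝ m (a l) Ω)
    (hda : ∀ j l : Fin 3, ∀ t ∈ Finset.Icc 1 m, ∀ x ∈ Ω, |pdIter l t (a j) x| ^ 2 ≤ C * φ x)
    {y : E3} (hy : y ∈ Ω) :
    Admissible m Ω φ (weightConst m lam B C) a fun l => a l y := by
  have k1 : 0 ≤ √C := Real.sqrt_nonneg _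
  have k2 : 0 ≤ √(C * B) := Real.sqrt_nonneg _
  have k3 : 0 ≤ 12 * √(C * B) / lam := by positivity
  have k4 : 0 ≤ (1 + 12 / lam ^ 2) ^ m * B := by positivity
  have hle : ∀ j l t, 1 ≤ t → t ≤ m → ∀ x ∈ Ω, |pdIter l t (a j) x| ≤ √(C * φ x) :=
    fun j l t h1 h2 x hx => Real.le_sqrt_of_sq_le (hda j l t (Finset.mem_Icc.2 ⟨h1, h2⟩) x hx)
  have hκ : 1 ≤ weightConst m lam B C := by unfold weightConst; linarith
  refine ⟨hΩ, hκ, hφ.continuousOn, hpos, ha, fun l x hx => ?_, fun j l t h1 h2 x hx => ?_,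
    fun j l t h1 h2 x hx => ?_, fun u hu l t ht => ?_⟩
  · refine (h.oscillation hΩ hconn hlam hφ hpos hB hC ((ha l).of_le (by exact_mod_cast hm))
      (fun i z hz => hda l i 1 (Finset.mem_Icc.2 ⟨le_rfl, hm⟩) z hz) hx hy).trans ?_
    unfold weightConst
    linarith
  · refine (hle j l t h1 h2 x hx).trans ?_
    rw [Real.sqrt_mul hC.le]
    refine mul_le_mul_of_nonneg_right ?_ (Real.sqrt_nonneg _)
    unfold weightConst
    linarith
  · refine (hle j l t h1 h2 x hx).trans ((Real.sqrt_le_sqrt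
      (mul_le_mul_of_nonneg_left (hB x hx) hC.le)).trans ?_)
    unfold weightConst
    linarith
  -- Starting from `∂_l^t u`, exactly `m - t` steps of the Poincaré inequality reach order `m`.
  · have hw := h.weighted_le hΩ hlam hφ hpos hB0 hB hu (m - t) (Pi.single l t)
    rw [multiPd_single, Finset.sum_pi_single', if_pos (Finset.mem_univ l),
      Nat.sub_add_cancel ht, ← mul_assoc] at hw
    refine hw.trans (mul_le_mul_of_nonneg_right ?_ (pureNorm_nonneg m u))
    have hq : 0 ≤ 12 / lam ^ 2 := by positivity
    have h1 : (12 / lam ^ 2) ^ (m - t) ≤ (1 + 12 / lam ^ 2) ^ m :=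
      (pow_le_pow_left₀ hq (by linarith) _).trans
        (pow_le_pow_right₀ (by linarith) (Nat.sub_le m t))
    have h2 := mul_le_mul_of_nonneg_right h1 hB0
    have h3 : (1 + 12 / lam ^ 2) ^ m * B ≤ weightConst m lam B C := by
      unfold weightConst; linarith
    nlinarith

lemma boundedCoefs_of_weight (hΩ : IsOpen Ω) (ha : ∀ l, ContDiffOn ℝ m (a l) Ω)
    (hb : ∀ l, ∃ D : ℝ, ∀ x ∈ Ω, |a l x| ≤ D) (hB : ∀ x ∈ Ω, φ x ≤ B) (hC : 0 < C)
    (hda : ∀ j l : Fin 3, ∀ t ∈ Finset.Icc 1 m, ∀ x ∈ Ω, |pdIter l t (a j) x| ^ 2 ≤ C * φ x) :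
    BoundedCoefs m Ω a := by
  refine BoundedCoefs.of_contDiffOn hΩ ha fun j l t ht => ?_
  rcases Nat.eq_zero_or_pos t with rfl | h0
  · exact hb j
  · exact ⟨√(C * B), fun x hx => Real.le_sqrt_of_sq_le
      ((hda j l t (Finset.mem_Icc.2 ⟨h0, ht⟩) x hx).trans
        (mul_le_mul_of_nonneg_left (hB x hx) hC.le))⟩

lemma constCT_le (l : Fin 3) {x : E3} (hx : x ∈ Ω) : constCT Ω a ≤ (a l x) ^ 2 :=
  (ciInf_le (Set.finite_range _).bddBelow l).trans
    (ciInf_le (f := fun y : Ω => (a l y) ^ 2)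
      ⟨0, by rintro _ ⟨y, rfl⟩; exact sq_nonneg _⟩ ⟨x, hx⟩)

/-- No boundedness is needed: a real supremum of non-negative terms is non-negative even where it
takes its default value `0`. -/
lemma le_constM {K₁ : ℝ} (hK₁ : 0 ≤ K₁) (K₂ : ℝ) : K₂ ≤ constM K₁ K₂ m Ω a :=
  le_add_of_nonneg_left (mul_nonneg hK₁
    (Real.iSup_nonneg fun _ => Real.iSup_nonneg fun _ => by positivity))

end Conclusion

end QuatOp

end


theorem theorem4p3 (m : ℕ) (hm : 1 ≤ m) :
    ∃ K₁ : ℝ, 0 < K₁ ∧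
    ∀ (Ω : Set E3), IsOpen Ω → IsConnected Ω → ¬ Bornology.IsBounded Ω →
      HasC1Boundary Ω → PropertyR Ω →
    ∀ (φ : E3 → ℝ) (lam C : ℝ), IsBoundedWeight Ω φ lam → 0 < C →
    ∃ K₂ : ℝ, 0 < K₂ ∧
    ∀ (a : Fin 3 → E3 → ℝ),
      (∀ l, ContDiffClosure m Ω (a l)) →
      (∀ l, ∃ B : ℝ, ∀ x ∈ Ω, |a l x| ≤ B) →
      (∀ j l : Fin 3, ∀ t ∈ Finset.Icc 1 m, ∀ x ∈ Ω, |pdIter l t (a j) x| ^ 2 ≤ C * φ x) →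
      0 < constCT Ω a →
      0 < constCT Ω a / 2 - constM K₁ K₂ m Ω a →
    ∀ (s : ℍ[ℝ]), s ≠ 0 → s.re = 0 →
    ∀ (σ : ℝ), σ = 1 ∨ σ = -1 →
      (∀ F : L2 Ω, ∃! u : L2 Ω, IsWeakSolution σ m Ω a s F u) ∧
      (∀ u : L2 Ω, MemH0 m Ω u →
        ‖u‖ ^ 2 ≤ 1 / ‖s‖ ^ 2 * (bForm σ m Ω a s u u).re) ∧
      (∀ u : L2 Ω, MemH0 m Ω u →
        MemLp (opT m Ω a u) 2 (volume.restrict Ω) ∧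
        (constCT Ω a - 2 * constM K₁ K₂ m Ω a) / (2 * constCT Ω a)
            * (∫ x in Ω, ‖opT m Ω a u x‖ ^ 2) ≤ (bForm σ m Ω a s u u).re) := by
  -- The derivatives of the coefficients are already bounded in terms of `C` and the bound of `φ`,
  -- so `K₂` can carry the whole estimate and `K₁ = 1` will do.
  refine ⟨1, one_pos, fun Ω hΩ hconn _ _ _ φ lam C hW hC => ?_⟩
  obtain ⟨ν, hν⟩ := hW.exists_decayField hΩ
  obtain ⟨hlam, -, hpos, ⟨B, hB⟩, -⟩ := id hW
  -- The constants `c_l` will be the values `a_l(y)` at this point; `κ` does not depend on it.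
  obtain ⟨y, hy⟩ := hconn.nonempty
  have hB0 : 0 ≤ B := (hpos y hy).le.trans (hB y hy)
  set κ := weightConst m lam B C
  set K := max 1 (max (constForm m κ) (24 * κ ^ 3))
  have hK : 1 ≤ K := le_max_left _ _
  -- This is the threshold of `le_of_error_le`; the hypothesis gives `C_T > 2M ≥ 2 · 256 K²`.
  refine ⟨256 * K ^ 2, by positivity, fun a ha hb hda hCT hM s hs hre σ hσ => ?_⟩
  have hac : ∀ l, ContDiffOn ℝ m (a l) Ω := fun l => (ha l).1
  have H := boundedCoefs_of_weight hΩ hac hb hB hC hda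
  have hA := hν.admissible hΩ hconn hm hlam hW.contDiffOn hpos hB0 hB hC hac hda hy
  have hKM : 256 * K ^ 2 ≤ constM 1 (256 * K ^ 2) m Ω a := le_constM zero_le_one _
  have hK0 : 0 ≤ 256 * K ^ 2 := by positivity
  have hell : IsElliptic σ m Ω a s := by
    refine hA.isElliptic H hm (by rcases hσ with rfl | rfl <;> simp) s hK
      ((le_max_left _ _).trans (le_max_right _ _)) ((le_max_right _ _).trans (le_max_right _ _))
      fun l x hx => le_trans ?_ (constCT_le l hx)
    linarith
  refine ⟨hell.existsUnique hΩ H hs hre, fun u hu => ?_, fun u hu => ?_⟩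
  · obtain ⟨U, hU, rfl⟩ := (memH0_iff hΩ).1 hu
    rw [bForm_eq_jetForm hΩ H hre hU hU, one_div_mul_eq_div, le_div_iff₀ (by positivity), mul_comm]
    exact hell.norm_sq_le hU
  · obtain ⟨U, hU, rfl⟩ := (memH0_iff hΩ).1 hu
    refine ⟨memLp_opT hΩ H hU, ?_⟩
    rw [bForm_eq_jetForm hΩ H hre hU hU, integral_norm_opT_sq hΩ H hU]
    -- Since `M ≥ 0`, the constant `C₁ = ½ - M / C_T` is at most the `½` provided by ellipticity.
    refine le_trans (mul_le_mul_of_nonneg_right ?_ (sq_nonneg _)) (hell.norm_opJet_sq_le hU)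
    rw [div_le_div_iff₀ (by positivity) two_pos]
    linarith
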